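/- Notation. For $\delta>0$ let $w_\delta(x)=(1+|x|)^{-\delta}$ on $\mathbb{R}^3$ and $L^r_{w_\delta}=L^r(\mathbb{R}^3,w_\delta\,dx)$. For a tensor $\mathbb{F}=(F_{i,j})_{1\le i,j\le 3}$ let $(\nabla\cdot\mathbb{F})_j=\sum_i\partial_iF_{i,j}$, $|\mathbb{F}|^2=\sum_{i,j}F_{i,j}^2$ and $|\nabla u|^2=\sum_{i,j}(\partial_iu_j)^2$. Let $R_i=\partial_i/\sqrt{-\Delta}$ be the Riesz transforms. Theorem. Let $0<\gamma\le 2$. There is a constant $C_\gamma>0$ depending only on $\gamma$ such that the following holds for every $0<T<+\infty$. Let $u_0\in L^2_{w_\gamma}$ be a divergence-free vector field on $\mathbb{R}^3$, let $\mathbb{F}\in L^2((0,T),L^2_{w_\gamma})$ be a tensor, and let $b\in L^3((0,T),L^3_{w_{3\gamma/2}})$ be a time-dependent vector field with $\nabla\cdot b=0$. Let $(u,p)$ be a solution on $(0,T)\times\mathbb{R}^3$, in the sense of distributions, of $$\partial_t u=\Delta u-(b\cdot\nabla)u-\nabla p+\nabla\cdot\mathbb{F},\qquad \nabla\cdot u=0,\qquad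 u(0,\cdot)=u_0,$$ such that: (1) $u\in L^\infty((0,T),L^2_{w_\gamma})$ and $\nabla u\in L^2((0,T),L^2_{w_\gamma})$; (2) $p=\sum_{i,j}R_iR_j(b_iu_j-F_{i,j})$, where $\sum_{i,j}R_iR_j(b_iu_j)\in L^3((0,T),L^{6/5}_{w_{6\gamma/5}})$ and $\sum_{i,j}R_iR_jF_{i,j}\in L^2((0,T),L^2_{w_\gamma})$; (3) $t\mapsto u(t,\cdot)$ is weakly continuous from $[0,T)$ to $L^2_{w_\gamma}$, and $\lim_{t\to0^+}\|u(t,\cdot)-u_0\|_{L^2_{w_\gamma}}=0$; (4) there is a non-negative locally finite measure $\mu$ on $(0,T)\times\mathbb{R}^3$ such that, in the sense of distributions on $(0,T)\times\mathbb{R}^3$, $$\partial_t\Big(\frac{|u|^2}2\Big)=\Delta\Big(\frac{|u|^2}2\Big)-|\nabla u|^2-\nabla\cdot\Big(\frac{|u|^2}2b\Big)-\nabla\cdot(pu)+u\cdot(\nabla\cdot\mathbb{F})-\mu,$$ where $u\cdot(\nabla\cdot\mathbb{F})=\sum_{i,j}\big(\partial_i(F_{i,j}u_j)-F_{i,j}\,\partial_iu_j\big)$.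 Then for every $t\in[0,T)$ (all the integrals below being absolutely convergent) $$\begin{aligned}\|u(t,\cdot)\|_{L^2_{w_\gamma}}^2+2\int_0^t\|\nabla u(s,\cdot)\|_{L^2_{w_\gamma}}^2\,ds\le{}&\|u_0\|_{L^2_{w_\gamma}}^2-\int_0^t\!\int\nabla|u|^2\cdot\nabla w_\gamma\,dx\,ds+\int_0^t\!\int|u|^2\,b\cdot\nabla w_\gamma\,dx\,ds\\&+2\int_0^t\!\int p\,u\cdot\nabla w_\gamma\,dx\,ds-2\sum_{i,j}\int_0^t\!\int\big(F_{i,j}(\partial_iu_j)w_\gamma+F_{i,j}u_j\,\partial_iw_\gamma\big)\,dx\,ds\end{aligned}$$ and $$\|u(t,\cdot)\|_{L^2_{w_\gamma}}^2+\int_0^t\|\nabla u\|_{L^2_{w_\gamma}}^2\,ds\le\|u_0\|_{L^2_{w_\gamma}}^2+C_\gamma\int_0^t\|\mathbb{F}(s,\cdot)\|_{L^2_{w_\gamma}}^2\,ds+C_\gamma\int_0^t\big(1+\|b(s,\cdot)\|_{L^3_{w_{3\gamma/2}}}^2\big)\|u(s,\cdot)\|_{L^2_{w_\gamma}}^2\,ds.$$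 -/

import Mathlib

open MeasureTheory Set Filter Topology
open scoped ENNReal FourierTransform

noncomputable section

namespace AdvectionDiffusion

/-- The Euclidean space of dimension three. -/
abbrev R3 : Type := EuclideanSpace ℝ (Fin 3)

/-- Tensors `(A i j)` with `1 ≤ i, j ≤ 3`; the norm is the Euclidean (Frobenius) norm
`(∑ i, ∑ j, A i j ^ 2) ^ (1/2)`. The entry `A i j` is written `A (i, j)`. -/
abbrev Tensor3 : Type := EuclideanSpace ℝ (Fin 3 × Fin 3)

/-- The weight `w_δ(x) = (1 + |x|)^(-δ)`. -/
def weight (δ : ℝ) (x : R3) : ℝ := (1 + ‖x‖) ^ (-δ)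

/-- The measure `w_δ dx`. -/
def weightMeasure (δ : ℝ) : Measure R3 :=
  (volume : Measure R3).withDensity fun x => ENNReal.ofReal (weight δ x)

/-- The norm of `L^r(w_δ dx)`, as a real number. -/
def weightNorm {H : Type*} [NormedAddCommGroup H] (r : ℝ≥0∞) (δ : ℝ) (f : R3 → H) : ℝ :=
  (eLpNorm f r (weightMeasure δ)).toReal

/-- Lebesgue measure on the strip `(0,T) × ℝ³`. -/
def stripMeasure (T : ℝ) : Measure (ℝ × R3) :=
  ((volume : Measure ℝ).restrict (Ioo 0 T)).prod (volume : Measure R3)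

/-- `f ∈ L^q((0,T), L^r(w_δ dx))`. -/
def MemMixed {H : Type*} [NormedAddCommGroup H] (T : ℝ) (q r : ℝ≥0∞) (δ : ℝ)
    (f : ℝ → R3 → H) : Prop :=
  AEStronglyMeasurable (fun z : ℝ × R3 => f z.1 z.2) (stripMeasure T) ∧
    eLpNorm (fun t => eLpNorm (f t) r (weightMeasure δ)) q
      ((volume : Measure ℝ).restrict (Ioo 0 T)) < ⊤

/-- Test functions on `ℝ³`: smooth with compact support. -/
def IsTest (φ : R3 → ℝ) : Prop := ContDiff ℝ (⊤ : ℕ∞) φ ∧ HasCompactSupport φ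

/-- Test functions on `(0,T) × ℝ³`: smooth with compact support inside the open strip. -/
def IsStripTest (T : ℝ) (φ : ℝ × R3 → ℝ) : Prop :=
  ContDiff ℝ (⊤ : ℕ∞) φ ∧ HasCompactSupport φ ∧ tsupport φ ⊆ Ioo 0 T ×ˢ univ

/-- The time derivative of a function on space-time. -/
def timeDeriv (φ : ℝ × R3 → ℝ) (z : ℝ × R3) : ℝ := deriv (fun s => φ (s, z.2)) z.1

/-- The gradient in `x` of a function on space-time. -/
def spaceGrad (φ : ℝ × R3 → ℝ) (z : ℝ × R3) : R3 := gradient (fun y => φ (z.1, y)) z.2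

/-- The Laplacian in `x` of a function on space-time. -/
def spaceLaplacian (φ : ℝ × R3 → ℝ) (z : ℝ × R3) : ℝ :=
  Laplacian.laplacian (fun y => φ (z.1, y)) z.2

/-- `V` is the gradient of `f` in the sense of distributions on `ℝ³`. -/
def IsWeakGradient (f : R3 → ℝ) (V : R3 → R3) : Prop :=
  LocallyIntegrable f volume ∧ LocallyIntegrable V volume ∧
    ∀ φ, IsTest φ → ∀ i : Fin 3, ∫ x, f x * gradient φ x i = - ∫ x, V x i * φ x

/-- `D` is the gradient of the vector field `v` in the sense of distributions on `ℝ³`: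
`D (i, j)` is the derivative of `v j` in the direction `i`. -/
def IsWeakJacobian (v : R3 → R3) (D : R3 → Tensor3) : Prop :=
  ∀ j : Fin 3, IsWeakGradient (fun x => v x j) (fun x => WithLp.toLp 2 fun i => D x (i, j))

/-- `∇ · v = 0` in the sense of distributions on `ℝ³`. -/
def IsWeakDivFree (v : R3 → R3) : Prop :=
  LocallyIntegrable v volume ∧ ∀ φ, IsTest φ → ∫ x, inner ℝ (v x) (gradient φ x) = 0

/-- The Fourier symbol `i ξ_k / |ξ|` of the Riesz transform `R_k = ∂_k / √(-Δ)`. -/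
def rieszSymbol (k : Fin 3) (ξ : R3) : ℂ := Complex.I * (ξ k : ℂ) / (‖ξ‖ : ℂ)

/-- `R_i R_j φ` for a real test function `φ`, as a Fourier multiplier
(the inverse Fourier transform is real-valued, since the symbol is real and even). -/
def rieszRieszTest (i j : Fin 3) (φ : R3 → ℝ) (x : R3) : ℝ :=
  (𝓕⁻ (fun ξ : R3 => rieszSymbol i ξ * (rieszSymbol j ξ * 𝓕 (fun y : R3 => (φ y : ℂ)) ξ)) x).re

/-- `q = ∑ i, ∑ j, R_i R_j (A i j)`, where `R_i R_j` is extended from test functions by duality: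
it is a symmetric operator, so `∫ (R_i R_j f) φ = ∫ f (R_i R_j φ)`. Since `R_i R_j φ` is bounded
and `O(|x|^(-3))` at infinity, the integrals on the right converge absolutely when the entries of
`A` are in `L^r(w_δ dx)` with `1 < r < ∞` and `0 < δ < 3`; in that case `q` is the value at `A` of
the continuous extension of `∑ i, ∑ j, R_i R_j` to `L^r(w_δ dx)`. -/
def IsRieszSum (A : Fin 3 → Fin 3 → R3 → ℝ) (q : R3 → ℝ) : Prop :=
  ∀ φ, IsTest φ → ∫ x, q x * φ x = ∑ i, ∑ j, ∫ x, A i j x * rieszRieszTest i j φ x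

/-- The equation `∂_t u = Δ u - (b · ∇) u - ∇ p + ∇ · F` in the sense of distributions on
`(0,T) × ℝ³`, where `(∇ · F) j = ∑ i, ∂_i F (i, j)` and `D` is the space gradient of `u`,
so that `((b · ∇) u) j = ∑ i, b i * D (i, j)`. -/
def SolvesAD (T : ℝ) (b u : ℝ → R3 → R3) (D F : ℝ → R3 → Tensor3) (p : ℝ → R3 → ℝ) : Prop :=
  ∀ φ, IsStripTest T φ → ∀ j : Fin 3,
    ∫ z, (u z.1 z.2 j * timeDeriv φ z + u z.1 z.2 j * spaceLaplacian φ z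
      - (∑ i, b z.1 z.2 i * D z.1 z.2 (i, j)) * φ z
      + p z.1 z.2 * spaceGrad φ z j
      - ∑ i, F z.1 z.2 (i, j) * spaceGrad φ z i) ∂(stripMeasure T) = 0

/-- The pressure formula `p = ∑ i, ∑ j, R_i R_j (b i * u j - F (i, j))`, where
`∑ i, ∑ j, R_i R_j (b i * u j)` is in `L^3((0,T), L^(6/5)(w_(6γ/5) dx))` and
`∑ i, ∑ j, R_i R_j (F (i, j))` is in `L^2((0,T), L^2(w_γ dx))`. -/
def PressureFormula (γ T : ℝ) (b u : ℝ → R3 → R3) (F : ℝ → R3 → Tensor3)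
    (p : ℝ → R3 → ℝ) : Prop :=
  ∃ p₁ p₂ : ℝ → R3 → ℝ,
    MemMixed T 3 (6 / 5) (6 * γ / 5) p₁ ∧ MemMixed T 2 2 γ p₂ ∧
    (∀ᵐ t ∂(volume.restrict (Ioo 0 T)), IsRieszSum (fun i j x => b t x i * u t x j) (p₁ t)) ∧
    (∀ᵐ t ∂(volume.restrict (Ioo 0 T)), IsRieszSum (fun i j x => F t x (i, j)) (p₂ t)) ∧
    ∀ᵐ z ∂(stripMeasure T), p z.1 z.2 = p₁ z.1 z.2 - p₂ z.1 z.2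

/-- The map `t ∈ [0,T) ↦ u(t,·)` is weakly continuous with values in `L^2(w_γ dx)`. -/
def WeaklyContinuous (γ T : ℝ) (u : ℝ → R3 → R3) : Prop :=
  (∀ t ∈ Ico 0 T, MemLp (u t) 2 (weightMeasure γ)) ∧
    ∀ g : R3 → R3, MemLp g 2 (weightMeasure γ) →
      ContinuousOn (fun t => ∫ x, inner ℝ (u t x) (g x) ∂(weightMeasure γ)) (Ico 0 T)

/-- The local energy balance: there is a non-negative measure `μ`, locally finite on
`(0,T) × ℝ³`, such that, in the sense of distributions on `(0,T) × ℝ³`,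
`∂_t (|u|²/2) = Δ (|u|²/2) - |∇u|² - ∇ · ((|u|²/2) b) - ∇ · (p u) + u · (∇ · F) - μ`.
Here `D` is the space gradient of `u` and the term `u · (∇ · F)` is the distribution
`∑ i, ∑ j, (∂_i (F (i, j) * u j) - F (i, j) * D (i, j))`. -/
def LocalEnergyBalance (T : ℝ) (b u : ℝ → R3 → R3) (D F : ℝ → R3 → Tensor3)
    (p : ℝ → R3 → ℝ) : Prop :=
  ∃ μ : Measure (ℝ × R3),
    (∀ K : Set (ℝ × R3), IsCompact K → K ⊆ Ioo 0 T ×ˢ univ → μ K < ⊤) ∧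
    ∀ φ, IsStripTest T φ →
      - ∫ z, ‖u z.1 z.2‖ ^ 2 / 2 * timeDeriv φ z ∂(stripMeasure T)
        = (∫ z, ‖u z.1 z.2‖ ^ 2 / 2 * spaceLaplacian φ z ∂(stripMeasure T))
          - (∫ z, ‖D z.1 z.2‖ ^ 2 * φ z ∂(stripMeasure T))
          + (∫ z, ‖u z.1 z.2‖ ^ 2 / 2 * inner ℝ (b z.1 z.2) (spaceGrad φ z) ∂(stripMeasure T))
          + (∫ z, p z.1 z.2 * inner ℝ (u z.1 z.2) (spaceGrad φ z) ∂(stripMeasure T))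
          - (∫ z, (∑ i, ∑ j, F z.1 z.2 (i, j) *
              (u z.1 z.2 j * spaceGrad φ z i + D z.1 z.2 (i, j) * φ z)) ∂(stripMeasure T))
          - ∫ z, φ z ∂μ

/-- `u`, with space gradient `D` and pressure `p`, is a solution on `(0,T)` of the
advection-diffusion problem with drift `b`, initial value `u₀` and forcing tensor `F`, in the
class of solutions under consideration. -/
structure IsSolution (γ T : ℝ) (u₀ : R3 → R3) (F : ℝ → R3 → Tensor3) (b u : ℝ → R3 → R3)
    (D : ℝ → R3 → Tensor3) (p : ℝ → R3 → ℝ) : Prop where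
  equation : SolvesAD T b u D F p
  divFree : ∀ᵐ t ∂(volume.restrict (Ioo 0 T)), IsWeakDivFree (u t)
  initial : u 0 =ᵐ[volume] u₀
  memMixed : MemMixed T ⊤ 2 γ u
  isWeakJacobian : ∀ᵐ t ∂(volume.restrict (Ioo 0 T)), IsWeakJacobian (u t) (D t)
  memMixed_grad : MemMixed T 2 2 γ D
  pressure : PressureFormula γ T b u F p
  weaklyContinuous : WeaklyContinuous γ T u
  tendsto_initial :
    Tendsto (fun t => eLpNorm (fun x => u t x - u₀ x) 2 (weightMeasure γ)) (𝓝[>] 0) (𝓝 0)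
  energyBalance : LocalEnergyBalance T b u D F p

end AdvectionDiffusion

end

open AdvectionDiffusion

/-!
The local energy balance says that `∂_t |u|² + 2 |∇u|²` is at most the divergence of a flux plus
source terms, the measure `μ` being dropped because it is non-negative. Testing it against
`α(t) Φ(x)` with `Φ ≥ 0`, letting `Φ` tend to the weight `w_γ` and then `α` to the indicator of
`[0, t]` gives the weighted energy inequality; the Gronwall-type bound follows from it by Young's
inequality. What has to be proved is that every term is absolutely integrable against `w_γ` or
`∇w_γ`, with a bound in which `‖∇u‖` can be absorbed by the dissipation. Since
`|∇w_γ| ≤ γ w_{γ+1}`, one power of `1 + |x|` is gained in the flux terms.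

*The drift.* The weighted Sobolev inequality `‖w_{γ/2} u‖₆ ≤ C (‖w_{γ/2} u‖₂ + ‖w_{γ/2} ∇u‖₂)`
(`exists_eLpNorm_weight_six_le`) and Hölder's inequality with exponents `2`, `3`, `6` bound
`∫ |u|² |b| w_{γ+1}` (`exists_lintegral_drift_le`).

*The pressure.* It suffices to estimate the pressure in `L²(w_{γ+2})`, because
`w_{γ+1} = w_{γ/2+1} w_{γ/2}`. For `γ ≥ 1` the weight `w_{γ+2}` decays too fast to be a Muckenhoupt
weight and `R_i R_j` is not bounded on `L²(w_{γ+2})`. However, with `⟨x⟩ = (1 + |x|²)^(1/2)` and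
`a = γ/2 + 1 ∈ [1, 2]`, the commutator of `R_i R_j` with multiplication by `⟨x⟩ ^ a`, applied to
`⟨·⟩ ^ (-a) ψ`, has a kernel bounded by a multiple of `|⟨x⟩^a / ⟨y⟩^a - 1| |x - y|⁻³`
(`commutator_kernel_le`). Near the diagonal this is integrable and Schur's test applies; away from
the diagonal it is bounded by a product of a function of `x` and a function of `y`, at the price of
an `L¹` norm of `b_i u_j` and `F_{i,j}` with weight `⟨x⟩ ^ (-a - 3/4)`, which the hypotheses control
(`exists_enorm_integral_mul_rieszRieszTest_le`). Thus only the `L²` bound of `R_i R_j`, that is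
Plancherel's theorem, and the size `O(|x - y|⁻³)` of its kernel are needed. The latter comes from
writing the symbol as `c⁻¹ ∫_0^∞ η(tξ) dt/t` with `η` smooth of compact support
(`rieszRieszTest_eq_integral`). A duality argument gives the estimate for every `q` such that
`IsRieszSum A q` (`exists_eLpNorm_le_of_isRieszSum`).

*The diffusion.* In `Δ(|u|²)` one derivative is moved to `|u|²`, whose gradient is `2 ∑ j, u_j ∇u_j`
(`IsWeakJacobian.isWeakGradient_sq`); this leaves only first derivatives of the weight,
which are bounded although the weight is not differentiable at the origin.

*The time variable.* Weak continuity makes `t ↦ ‖u(t)‖²` lower semicontinuous, and strong continuity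
at `0` identifies its limit there; hence the inequality in the sense of distributions on `(0, T)`
holds at every time (`le_add_integral_of_distrib`).
-/

namespace AdvectionDiffusion

open scoped ContDiff NNReal Convolution SchwartzMap

/-! ### Mollification and duality in `L²` -/

theorem sq_eLpNorm_two {α E : Type*} [MeasurableSpace α] [NormedAddCommGroup E] {μ : Measure α}
    (f : α → E) : eLpNorm f 2 μ ^ 2 = ∫⁻ x, ‖f x‖ₑ ^ 2 ∂μ := by
  have h := eLpNorm_nnreal_pow_eq_lintegral (f := f) (μ := μ) (p := 2) two_ne_zero
  have h2 : ((2 : NNReal) : ℝ≥0∞) = 2 := rfl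
  simp only [h2, NNReal.coe_ofNat, ENNReal.rpow_ofNat] at h
  exact h

theorem eLpNorm_two_le_of_sq_le {α E : Type*} [MeasurableSpace α] [NormedAddCommGroup E]
    {μ : Measure α} {f : α → E} {c : ℝ≥0∞} (h : ∫⁻ x, ‖f x‖ₑ ^ 2 ∂μ ≤ c ^ 2) :
    eLpNorm f 2 μ ≤ c := by
  rw [← sq_eLpNorm_two] at h
  exact (ENNReal.pow_right_strictMono two_ne_zero).le_iff_le.1 h

/-- A sequence of bump functions on `ℝ³` whose supports shrink to the origin. -/
noncomputable def mollBump (k : ℕ) : ContDiffBump (0 : R3) where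
  rIn := 1 / (k + 1)
  rOut := 2 / (k + 1)
  rIn_pos := by positivity
  rIn_lt_rOut := by gcongr; norm_num

/-- The mollification `ρ_k ⋆ f`, where `ρ_k` is the normalized bump function `mollBump k`. -/
noncomputable def moll {E : Type*} [NormedAddCommGroup E] [NormedSpace ℝ E] (k : ℕ) (f : R3 → E) :
    R3 → E :=
  (mollBump k).normed volume ⋆[ContinuousLinearMap.lsmul ℝ ℝ, volume] f

section Moll

variable {E : Type*} [NormedAddCommGroup E] [NormedSpace ℝ E] {k : ℕ} {f : R3 → E}

theorem moll_apply (k : ℕ) (f : R3 → E) (x : R3) :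
    moll k f x = ∫ y, (mollBump k).normed volume (x - y) • f y :=
  convolution_lsmul_swap

theorem integrable_moll_integrand (hf : LocallyIntegrable f volume) (x : R3) :
    Integrable fun y => (mollBump k).normed volume (x - y) • f y := by
  apply hf.integrable_smul_left_of_hasCompactSupport
  · exact (mollBump k).continuous_normed.comp (continuous_const.sub continuous_id)
  · exact (mollBump k).hasCompactSupport_normed.comp_homeomorph (Homeomorph.subLeft x)

theorem contDiff_moll (hf : LocallyIntegrable f volume) : ContDiff ℝ ∞ (moll k f) :=
  (mollBump k).hasCompactSupport_normed.contDiff_convolution_left _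
    (mollBump k).contDiff_normed hf

theorem hasCompactSupport_moll (hf : HasCompactSupport f) : HasCompactSupport (moll k f) :=
  (mollBump k).hasCompactSupport_normed.convolution _ hf

theorem rOut_mollBump_le (k : ℕ) : (mollBump k).rOut ≤ 2 := by
  have : (2 : ℝ) / (k + 1) ≤ 2 / 1 := by
    gcongr
    linarith [(Nat.cast_nonneg k : (0 : ℝ) ≤ k)]
  simpa [mollBump] using this

theorem ae_tendsto_moll [CompleteSpace E] (hf : LocallyIntegrable f volume) :
    ∀ᵐ x, Tendsto (fun k => moll k f x) atTop (𝓝 (f x)) := by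
  apply ContDiffBump.ae_convolution_tendsto_right_of_locallyIntegrable (K := 2) _ _ hf
  · have := (tendsto_one_div_add_atTop_nhds_zero_nat (𝕜 := ℝ)).const_mul 2
    simpa [mollBump, div_eq_mul_inv] using this
  · refine Eventually.of_forall fun k => ?_
    simp only [mollBump]
    rw [mul_one_div]

theorem norm_moll_le {N : ℝ} (hf : LocallyIntegrable f volume) (hN : ∀ x, ‖f x‖ ≤ N) (x : R3) :
    ‖moll k f x‖ ≤ N := by
  rw [moll_apply]
  have hi : Integrable fun y => (mollBump k).normed volume (x - y) :=
    ((mollBump k).integrable_normed).comp_sub_left x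
  calc ‖∫ y, (mollBump k).normed volume (x - y) • f y‖
      ≤ ∫ y, ‖(mollBump k).normed volume (x - y) • f y‖ := norm_integral_le_integral_norm _
    _ ≤ ∫ y, (mollBump k).normed volume (x - y) * N := by
        apply integral_mono (integrable_moll_integrand hf x).norm (hi.mul_const N)
        intro y
        simp only [norm_smul, Real.norm_eq_abs, abs_of_nonneg ((mollBump k).nonneg_normed _)]
        exact mul_le_mul_of_nonneg_left (hN y) ((mollBump k).nonneg_normed _)
    _ = N := by
        rw [integral_mul_const, integral_sub_left_eq_self (fun y => (mollBump k).normed volume y),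
          (mollBump k).integral_normed, one_mul]

theorem moll_eq_zero {r : ℝ} (hf : ∀ x, r < ‖x‖ → f x = 0) {x : R3} (hx : r + 2 < ‖x‖) :
    moll k f x = 0 := by
  rw [moll_apply]
  apply integral_eq_zero_of_ae
  refine Eventually.of_forall fun y => ?_
  by_cases hy : r < ‖y‖
  · simp [hf y hy]
  · have : (mollBump k).normed volume (x - y) = 0 := by
      have h : x - y ∉ Function.support ((mollBump k).normed volume) := by
        rw [(mollBump k).support_normed_eq, Metric.mem_ball, dist_zero_right]
        have := rOut_mollBump_le k
        have := norm_sub_norm_le x y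
        linarith
      simpa using h
    simp [this]

/-- Mollification is a contraction of `L²`. -/
theorem eLpNorm_moll_le (hf : AEStronglyMeasurable f volume) :
    eLpNorm (moll k f) 2 volume ≤ eLpNorm f 2 volume := by
  set ρ : R3 → ℝ≥0∞ := fun z => ENNReal.ofReal ((mollBump k).normed volume z) with hρ
  have hρm : Measurable ρ := ((mollBump k).continuous_normed.measurable).ennreal_ofReal
  have hρ1 : ∫⁻ z, ρ z = 1 := by
    rw [← ofReal_integral_eq_lintegral_ofReal (mollBump k).integrable_normed
      (Eventually.of_forall (mollBump k).nonneg_normed), (mollBump k).integral_normed,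
      ENNReal.ofReal_one]
  have hsub : ∀ x, ∫⁻ y, ρ (x - y) = 1 := fun x => by
    rw [lintegral_sub_left_eq_self ρ x, hρ1]
  have hpt : ∀ x, ‖moll k f x‖ₑ ^ 2 ≤ ∫⁻ y, ρ (x - y) * ‖f y‖ₑ ^ 2 := by
    intro x
    have h1 : ‖moll k f x‖ₑ ≤ ∫⁻ y, ρ (x - y) * ‖f y‖ₑ := by
      rw [moll_apply]
      refine (enorm_integral_le_lintegral_enorm _).trans (lintegral_mono fun y => ?_)
      rw [enorm_smul, Real.enorm_eq_ofReal ((mollBump k).nonneg_normed _)]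
    have hm1 : AEMeasurable (fun y => ρ (x - y) ^ (1 / 2 : ℝ)) :=
      ((hρm.comp (measurable_const.sub measurable_id)).pow_const _).aemeasurable
    have h2 := ENNReal.lintegral_mul_le_Lp_mul_Lq volume Real.HolderConjugate.two_two hm1
      (hm1.mul hf.enorm)
    have e1 : ∀ y, ((fun y => ρ (x - y) ^ (1 / 2 : ℝ)) *
        ((fun y => ρ (x - y) ^ (1 / 2 : ℝ)) * fun y => ‖f y‖ₑ)) y = ρ (x - y) * ‖f y‖ₑ := by
      intro y
      simp only [Pi.mul_apply]
      rw [← mul_assoc, ← ENNReal.rpow_add_of_nonneg _ _ (by norm_num) (by norm_num)]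
      norm_num
    simp only [e1] at h2
    have e2 : ∀ y, (ρ (x - y) ^ (1 / 2 : ℝ)) ^ (2 : ℝ) = ρ (x - y) := by
      intro y
      rw [← ENNReal.rpow_mul]; norm_num
    have e3 : ∀ y, ((fun y => ρ (x - y) ^ (1 / 2 : ℝ)) * fun y => ‖f y‖ₑ) y ^ (2 : ℝ)
        = ρ (x - y) * ‖f y‖ₑ ^ 2 := by
      intro y
      simp only [Pi.mul_apply]
      rw [ENNReal.mul_rpow_of_nonneg _ _ (by norm_num), e2]
      norm_num
    simp only [e2, e3, hsub, ENNReal.one_rpow, one_mul] at h2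
    calc ‖moll k f x‖ₑ ^ 2 ≤ ((∫⁻ y, ρ (x - y) * ‖f y‖ₑ ^ 2) ^ (1 / 2 : ℝ)) ^ 2 := by
          gcongr; exact h1.trans h2
      _ = _ := by
          rw [← ENNReal.rpow_natCast, ← ENNReal.rpow_mul]; norm_num
  apply eLpNorm_two_le_of_sq_le
  calc ∫⁻ x, ‖moll k f x‖ₑ ^ 2 ≤ ∫⁻ x, ∫⁻ y, ρ (x - y) * ‖f y‖ₑ ^ 2 := lintegral_mono hpt
    _ = ∫⁻ y, ∫⁻ x, ρ (x - y) * ‖f y‖ₑ ^ 2 := by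
        apply lintegral_lintegral_swap
        exact (hρm.comp (measurable_fst.sub measurable_snd)).aemeasurable.mul
          (hf.comp_snd.enorm.pow_const 2)
    _ = ∫⁻ y, ‖f y‖ₑ ^ 2 := by
        apply lintegral_congr fun y => ?_
        have hm : Measurable fun x => ρ (x - y) := hρm.comp (measurable_id.sub measurable_const)
        rw [lintegral_mul_const _ hm, lintegral_sub_right_eq_self ρ y, hρ1, one_mul]
    _ = eLpNorm f 2 volume ^ 2 := (sq_eLpNorm_two f).symm

theorem isTest_moll {f : R3 → ℝ} (hf : LocallyIntegrable f volume) (hc : HasCompactSupport f) :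
    IsTest (moll k f) :=
  ⟨contDiff_moll hf, hasCompactSupport_moll hc⟩

end Moll

/-- The converse of Hölder's inequality in `L²`, tested on smooth functions only. -/
theorem eLpNorm_le_of_forall_isTest {h : R3 → ℝ} (hh : LocallyIntegrable h volume) {M : ℝ≥0∞}
    (hM : ∀ ψ, IsTest ψ → ‖∫ x, h x * ψ x‖ₑ ≤ M * eLpNorm ψ 2 volume) :
    eLpNorm h 2 volume ≤ M := by
  obtain ⟨h', hh'm, hhh'⟩ := hh.aestronglyMeasurable
  have hh'i : LocallyIntegrable h' volume := hh.congr hhh'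
  rw [eLpNorm_congr_ae hhh']
  -- truncations of `h'`, for which the claim follows by testing against mollifications
  set S : ℕ → Set R3 := fun N => Metric.closedBall 0 N ∩ {x | ‖h' x‖ ≤ N} with hS
  have hSm : ∀ N, MeasurableSet (S N) := fun N =>
    Metric.isClosed_closedBall.measurableSet.inter
      (measurableSet_le hh'm.norm.measurable measurable_const)
  have key : ∀ N, ∫⁻ x in S N, ‖h' x‖ₑ ^ 2 ≤ M ^ 2 := by
    intro N
    set g : R3 → ℝ := (S N).indicator h' with hg
    have hgN : ∀ x, ‖g x‖ ≤ N := by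
      intro x
      by_cases hx : x ∈ S N
      · rw [hg, indicator_of_mem hx]; exact hx.2
      · rw [hg, indicator_of_notMem hx]; simp
    have hg0 : ∀ x, (N : ℝ) < ‖x‖ → g x = 0 := by
      intro x hx
      rw [hg, indicator_of_notMem]
      intro hx'
      have := hx'.1
      rw [Metric.mem_closedBall, dist_zero_right] at this
      linarith
    have hgm : AEStronglyMeasurable g volume :=
      (hh'm.indicator (hSm N)).aestronglyMeasurable
    have hgi : LocallyIntegrable g volume := hh'i.indicator (hSm N)
    have hgc : HasCompactSupport g := by
      apply HasCompactSupport.intro (isCompact_closedBall (0 : R3) N)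
      intro x hx
      apply hg0
      simpa using hx
    -- only a.e. convergence of the mollifications is used: `g` is bounded, of compact support
    have hlim : Tendsto (fun k => ∫ x, h x * moll k g x) atTop (𝓝 (∫ x, h x * g x)) := by
      apply tendsto_integral_of_dominated_convergence
        (fun x => (Metric.closedBall (0 : R3) (N + 2)).indicator (fun x => ‖h x‖ * N) x)
      · intro k
        exact hh.aestronglyMeasurable.mul (contDiff_moll hgi).continuous.aestronglyMeasurable
      · rw [integrable_indicator_iff Metric.isClosed_closedBall.measurableSet]
        exact ((hh.integrableOn_isCompact (isCompact_closedBall _ _)).norm).mul_const _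
      · intro k
        refine Eventually.of_forall fun x => ?_
        by_cases hx : x ∈ Metric.closedBall (0 : R3) (N + 2)
        · rw [indicator_of_mem hx, norm_mul]
          exact mul_le_mul_of_nonneg_left (norm_moll_le hgi hgN x) (norm_nonneg _)
        · rw [indicator_of_notMem hx, moll_eq_zero hg0 (by simpa using hx)]
          simp
      · filter_upwards [ae_tendsto_moll hgi] with x hx
        exact hx.const_mul _
    have hint : Integrable (fun x => g x ^ 2) volume := by
      refine Integrable.mono' (g := (Metric.closedBall (0 : R3) N).indicator fun _ => (N : ℝ) ^ 2)
        ?_ (hgm.pow 2) (Eventually.of_forall fun x => ?_)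
      · rw [integrable_indicator_iff Metric.isClosed_closedBall.measurableSet]
        exact integrableOn_const (isCompact_closedBall _ _).measure_lt_top.ne
      · by_cases hx : x ∈ Metric.closedBall (0 : R3) N
        · rw [indicator_of_mem hx, norm_pow]
          exact pow_le_pow_left₀ (norm_nonneg _) (hgN x) 2
        · rw [indicator_of_notMem hx, hg0 x (by simpa using hx)]
          simp
    have hle : ‖∫ x, h x * g x‖ₑ ≤ M * eLpNorm g 2 volume := by
      apply le_of_tendsto hlim.enorm
      refine Eventually.of_forall fun k => ?_
      exact (hM _ (isTest_moll hgi hgc)).trans (by gcongr; exact eLpNorm_moll_le hgm)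
    have heq : ‖∫ x, h x * g x‖ₑ = eLpNorm g 2 volume ^ 2 := by
      have e : ∫ x, h x * g x = ∫ x, g x ^ 2 := by
        apply integral_congr_ae
        filter_upwards [hhh'] with x hx
        rw [hx]
        by_cases hxS : x ∈ S N
        · rw [hg, indicator_of_mem hxS]; ring
        · rw [hg, indicator_of_notMem hxS]; simp
      rw [e, Real.enorm_eq_ofReal (integral_nonneg fun x => sq_nonneg _),
        ofReal_integral_eq_lintegral_ofReal _ (Eventually.of_forall fun x => sq_nonneg _),
        sq_eLpNorm_two]
      · apply lintegral_congr fun x => ?_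
        rw [← Real.enorm_eq_ofReal (sq_nonneg _), enorm_pow]
      · exact hint
    have hfin : eLpNorm g 2 volume < ⊤ := ((memLp_two_iff_integrable_sq hgm).2 hint).2
    have : eLpNorm g 2 volume ≤ M := by
      rw [heq, sq] at hle
      by_cases h0 : eLpNorm g 2 volume = 0
      · rw [h0]; exact zero_le
      · exact (ENNReal.mul_le_mul_iff_left h0 hfin.ne).1 hle
    calc ∫⁻ x in S N, ‖h' x‖ₑ ^ 2 = ∫⁻ x, ‖g x‖ₑ ^ 2 := by
          rw [← lintegral_indicator (hSm N)]
          apply lintegral_congr fun x => ?_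
          by_cases hx : x ∈ S N
          · rw [hg, indicator_of_mem hx, indicator_of_mem hx]
          · rw [hg, indicator_of_notMem hx, indicator_of_notMem hx]; simp
      _ = eLpNorm g 2 volume ^ 2 := (sq_eLpNorm_two g).symm
      _ ≤ M ^ 2 := by gcongr
  apply eLpNorm_two_le_of_sq_le
  have hU : ⋃ N, S N = univ := by
    rw [eq_univ_iff_forall]
    intro x
    obtain ⟨N, hN⟩ := exists_nat_ge (max ‖x‖ ‖h' x‖)
    rw [mem_iUnion]
    exact ⟨N, by simpa using (le_max_left _ _).trans hN, (le_max_right _ _).trans hN⟩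
  have hmono : Monotone S := by
    intro N N' hNN' x hx
    have : (N : ℝ) ≤ N' := by exact_mod_cast hNN'
    exact ⟨Metric.closedBall_subset_closedBall this hx.1, le_trans hx.2 this⟩
  rw [← setLIntegral_univ, ← hU, setLIntegral_iUnion_of_directed _ hmono.directed_le]
  exact iSup_le key

theorem IsTest.contDiff_mul {g φ : R3 → ℝ} (hφ : IsTest φ) (hg : ContDiff ℝ ∞ g) :
    IsTest fun x => g x * φ x :=
  ⟨hg.mul hφ.1, hφ.2.mul_left⟩

theorem IsTest.memLp {φ : R3 → ℝ} (hφ : IsTest φ) (p : ℝ≥0∞) : MemLp φ p volume :=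
  hφ.1.continuous.memLp_of_hasCompactSupport hφ.2

theorem IsTest.integrable {φ : R3 → ℝ} (hφ : IsTest φ) : Integrable φ volume :=
  hφ.1.continuous.integrable_of_hasCompactSupport hφ.2

/-- The Cauchy–Schwarz inequality. -/
theorem lintegral_enorm_mul_le {α E E' : Type*} [MeasurableSpace α] {μ : Measure α}
    [NormedAddCommGroup E] [NormedAddCommGroup E'] {f : α → E} {g : α → E'}
    (hf : AEStronglyMeasurable f μ) (hg : AEStronglyMeasurable g μ) :
    ∫⁻ x, ‖f x‖ₑ * ‖g x‖ₑ ∂μ ≤ eLpNorm f 2 μ * eLpNorm g 2 μ := by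
  have h := eLpNorm_smul_le_mul_eLpNorm (p := 2) (q := 2) (r := 1) hg.norm hf.norm
  rw [eLpNorm_norm, eLpNorm_norm, eLpNorm_one_eq_lintegral_enorm] at h
  simpa [enorm_smul] using h

theorem enorm_integral_mul_le {α : Type*} [MeasurableSpace α] {μ : Measure α} {f g : α → ℝ}
    (hf : AEStronglyMeasurable f μ) (hg : AEStronglyMeasurable g μ) :
    ‖∫ x, f x * g x ∂μ‖ₑ ≤ eLpNorm f 2 μ * eLpNorm g 2 μ := by
  refine (enorm_integral_le_lintegral_enorm _).trans ?_
  simpa only [enorm_mul] using lintegral_enorm_mul_le hf hg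

/-- Mollifications of an `L²` function converge weakly in `L²`. -/
theorem tendsto_integral_mul_moll {h g : R3 → ℝ} (hh : MemLp h 2 volume) (hg : MemLp g 2 volume) :
    Tendsto (fun k => ∫ x, h x * moll k g x) atTop (𝓝 (∫ x, h x * g x)) := by
  have hloc : ∀ {f : R3 → ℝ}, MemLp f 2 volume → LocallyIntegrable f volume := fun hf =>
    hf.locallyIntegrable one_le_two
  rw [tendsto_iff_edist_tendsto_0, ENNReal.tendsto_nhds_zero]
  intro ε hε
  -- `c` is a test function with `‖h‖ ‖g - c‖ ≤ ε / 4`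
  obtain ⟨δ, hδ0, hδ⟩ : ∃ δ : ℝ, 0 < δ ∧
      eLpNorm h 2 volume * (ENNReal.ofReal δ + ENNReal.ofReal δ) ≤ ε / 2 := by
    have hcont : Tendsto (fun δ : ℝ => eLpNorm h 2 volume *
        (ENNReal.ofReal δ + ENNReal.ofReal δ)) (𝓝[>] 0) (𝓝 (eLpNorm h 2 volume * (0 + 0))) := by
      apply ENNReal.Tendsto.const_mul _ (Or.inr hh.2.ne)
      have : Tendsto (fun δ : ℝ => ENNReal.ofReal δ) (𝓝[>] 0) (𝓝 0) := by
        have := (ENNReal.continuous_ofReal.tendsto 0).mono_left (nhdsWithin_le_nhds (s := Ioi 0))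
        simpa using this
      exact this.add this
    rw [add_zero, mul_zero] at hcont
    have h2 : ∀ᶠ δ : ℝ in 𝓝[>] 0, eLpNorm h 2 volume *
        (ENNReal.ofReal δ + ENNReal.ofReal δ) ≤ ε / 2 :=
      ENNReal.tendsto_nhds_zero.1 hcont _ (ENNReal.half_pos hε.ne')
    obtain ⟨δ, hδ⟩ := (h2.and self_mem_nhdsWithin).exists
    exact ⟨δ, hδ.2, hδ.1⟩
  obtain ⟨c, hcc, hcs, hgc⟩ := hg.exist_eLpNorm_sub_le (by simp) one_le_two hδ0
  have hc2 : MemLp c 2 volume := hcs.continuous.memLp_of_hasCompactSupport hcc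
  have hcsm : Continuous c := hcs.continuous
  obtain ⟨N, hN⟩ := hcc.exists_bound_of_continuous hcsm
  obtain ⟨r, hr⟩ := hcc.isCompact.isBounded.subset_closedBall (0 : R3)
  have hr0 : ∀ x, r < ‖x‖ → c x = 0 := by
    intro x hx
    by_contra h0
    have := hr (subset_tsupport c h0)
    rw [mem_closedBall_zero_iff] at this
    linarith
  have hcl : LocallyIntegrable c volume := hcsm.locallyIntegrable
  have hlim : Tendsto (fun k => ∫ x, h x * moll k c x) atTop (𝓝 (∫ x, h x * c x)) := by
    apply tendsto_integral_of_dominated_convergence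
      (fun x => (Metric.closedBall (0 : R3) (r + 2)).indicator (fun x => ‖h x‖ * N) x)
    · intro k
      exact hh.1.mul (contDiff_moll hcl).continuous.aestronglyMeasurable
    · rw [integrable_indicator_iff Metric.isClosed_closedBall.measurableSet]
      exact (((hloc hh).integrableOn_isCompact (isCompact_closedBall _ _)).norm).mul_const _
    · intro k
      refine Eventually.of_forall fun x => ?_
      by_cases hx : x ∈ Metric.closedBall (0 : R3) (r + 2)
      · rw [indicator_of_mem hx, norm_mul]
        exact mul_le_mul_of_nonneg_left (norm_moll_le hcl hN x) (norm_nonneg _)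
      · rw [indicator_of_notMem hx, moll_eq_zero hr0 (by simpa using hx)]
        simp
    · filter_upwards [ae_tendsto_moll hcl] with x hx
      exact hx.const_mul _
  rw [tendsto_iff_edist_tendsto_0, ENNReal.tendsto_nhds_zero] at hlim
  filter_upwards [hlim _ (ENNReal.half_pos hε.ne')] with k hk
  have hmoll : ∀ {f : R3 → ℝ}, MemLp f 2 volume → MemLp (moll k f) 2 volume := fun hf =>
    ⟨(contDiff_moll (hloc hf)).continuous.aestronglyMeasurable,
      (eLpNorm_moll_le hf.1).trans_lt hf.2⟩
  have hd : MemLp (g - c) 2 volume := hg.sub hc2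
  have hsplit : ∀ x, moll k g x = moll k (g - c) x + moll k c x := by
    intro x
    simp only [moll_apply]
    rw [← integral_add (integrable_moll_integrand (hloc hd) x)
      (integrable_moll_integrand hcl x)]
    apply integral_congr_ae
    refine Eventually.of_forall fun y => ?_
    simp only [Pi.sub_apply, smul_eq_mul]
    ring
  have hI : ∀ {f : R3 → ℝ}, MemLp f 2 volume → Integrable (fun x => h x * f x) volume :=
    fun hf => hh.integrable_mul hf
  have e1 : ∫ x, h x * moll k g x = (∫ x, h x * moll k (g - c) x) + ∫ x, h x * moll k c x := by
    rw [← integral_add (hI (hmoll hd)) (hI (hmoll hc2))]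
    simp only [hsplit, mul_add]
  have e2 : ∫ x, h x * g x = (∫ x, h x * (g - c) x) + ∫ x, h x * c x := by
    rw [← integral_add (hI hd) (hI hc2)]
    congr 1; ext x; simp only [Pi.sub_apply]; ring
  rw [edist_eq_enorm_sub, e1, e2]
  rw [edist_eq_enorm_sub] at hk
  have e3 : ∀ a b a' b' : ℝ, a + b - (a' + b') = (a - a') + (b - b') := by intros; ring
  rw [e3]
  calc _ ≤ ‖(∫ x, h x * moll k (g - c) x) - ∫ x, h x * (g - c) x‖ₑ + ε / 2 :=
        (enorm_add_le _ _).trans (by gcongr)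
    _ ≤ (‖∫ x, h x * moll k (g - c) x‖ₑ + ‖∫ x, h x * (g - c) x‖ₑ) + ε / 2 := by
        gcongr; exact enorm_sub_le
    _ ≤ (eLpNorm h 2 volume * ENNReal.ofReal δ + eLpNorm h 2 volume * ENNReal.ofReal δ)
        + ε / 2 := by
        gcongr
        · exact (enorm_integral_mul_le hh.1 (hmoll hd).1).trans
            (by gcongr; exact (eLpNorm_moll_le hd.1).trans hgc)
        · exact (enorm_integral_mul_le hh.1 hd.1).trans (by gcongr)
    _ ≤ ε / 2 + ε / 2 := by
        gcongr
        rw [← mul_add]; exact hδ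
    _ = ε := ENNReal.add_halves ε

/-! ### The Riesz transforms on test functions -/

/-- The complexification of a test function, as a Schwartz function. -/
noncomputable def IsTest.toSchwartz {φ : R3 → ℝ} (hφ : IsTest φ) : 𝓢(R3, ℂ) :=
  HasCompactSupport.toSchwartzMap (f := fun y => (φ y : ℂ)) (hφ.2.comp_left Complex.ofReal_zero)
    (Complex.ofRealCLM.contDiff.comp hφ.1)

theorem IsTest.coe_toSchwartz {φ : R3 → ℝ} (hφ : IsTest φ) :
    ⇑hφ.toSchwartz = fun y => (φ y : ℂ) := rfl

theorem eLpNorm_fourier (f : 𝓢(R3, ℂ)) :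
    eLpNorm (𝓕 f : 𝓢(R3, ℂ)) 2 volume = eLpNorm f 2 volume := by
  have h1 : ∀ g : 𝓢(R3, ℂ), ‖g.toLp 2‖ = (eLpNorm g 2 volume).toReal :=
    fun g => SchwartzMap.norm_toLp
  have h2 : ∀ g : 𝓢(R3, ℂ), eLpNorm g 2 volume ≠ ⊤ := fun g => (g.memLp 2 volume).2.ne
  have h : ∀ g : 𝓢(R3, ℂ), g = 𝓕 f → eLpNorm g 2 volume = eLpNorm f 2 volume := by
    intro g hg
    rw [← ENNReal.toReal_eq_toReal_iff' (h2 g) (h2 f), ← h1, ← h1, hg]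
    exact SchwartzMap.norm_fourier_toL2_eq f
  exact h _ rfl

theorem eLpNorm_fourierInv (f : 𝓢(R3, ℂ)) :
    eLpNorm (𝓕⁻ f : 𝓢(R3, ℂ)) 2 volume = eLpNorm f 2 volume := by
  have h := eLpNorm_fourier (𝓕⁻ f : 𝓢(R3, ℂ))
  have e : 𝓕 (𝓕⁻ f : 𝓢(R3, ℂ)) = f := FourierTransform.fourier_fourierInv_eq f
  rw [e] at h
  exact h.symm

theorem integral_fourier_mul_eq {f g : R3 → ℂ} (hf : Integrable f) (hg : Integrable g) :
    ∫ ξ, 𝓕 f ξ * g ξ = ∫ x, f x * 𝓕 g x := by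
  simpa using! VectorFourier.integral_fourierIntegral_smul_eq_flip (L := innerₗ R3)
    Real.continuous_fourierChar continuous_inner hf hg

theorem integral_fourierInv_mul_eq {f g : R3 → ℂ} (hf : Integrable f) (hg : Integrable g) :
    ∫ ξ, 𝓕⁻ f ξ * g ξ = ∫ x, f x * 𝓕⁻ g x := by
  rw [Real.fourierInv_eq_fourier_comp_neg g, ← integral_fourier_mul_eq hf hg.comp_neg,
    ← integral_neg_eq_self]
  simp [Real.fourierInv_eq_fourier_neg]

/-- The symbol `-ξ_i ξ_j / |ξ|²` of `R_i R_j`. -/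
theorem rieszSymbol_mul (i j : Fin 3) (ξ : R3) :
    rieszSymbol i ξ * rieszSymbol j ξ = ((-(ξ i * ξ j) / ‖ξ‖ ^ 2 : ℝ) : ℂ) := by
  simp only [rieszSymbol]
  rw [div_mul_div_comm]
  push_cast
  congr 1
  · linear_combination (ξ i * ξ j : ℂ) * Complex.I_mul_I
  · ring

theorem abs_apply_mul_apply_le (i j : Fin 3) (ξ : R3) : |ξ i * ξ j| ≤ ‖ξ‖ ^ 2 := by
  have h : ∀ k, |ξ k| ≤ ‖ξ‖ := fun k => by simpa using PiLp.norm_apply_le ξ k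
  rw [abs_mul, sq]
  gcongr <;> exact h _

theorem norm_rieszSymbol_mul_le (i j : Fin 3) (ξ : R3) :
    ‖rieszSymbol i ξ * rieszSymbol j ξ‖ ≤ 1 := by
  rw [rieszSymbol_mul, Complex.norm_real, Real.norm_eq_abs, abs_div, abs_neg,
    abs_of_nonneg (sq_nonneg ‖ξ‖)]
  exact div_le_one_of_le₀ (abs_apply_mul_apply_le i j ξ) (sq_nonneg _)

theorem measurable_rieszSymbol (k : Fin 3) : Measurable (rieszSymbol k) := by
  unfold rieszSymbol
  fun_prop

/-- The Fourier transform of `R_i R_j φ`. -/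
noncomputable def rieszFourier (i j : Fin 3) (φ : R3 → ℝ) (ξ : R3) : ℂ :=
  rieszSymbol i ξ * (rieszSymbol j ξ * 𝓕 (fun y : R3 => (φ y : ℂ)) ξ)

theorem IsTest.fourier_eq {φ : R3 → ℝ} (hφ : IsTest φ) :
    𝓕 (fun y : R3 => (φ y : ℂ)) = ⇑(𝓕 hφ.toSchwartz : 𝓢(R3, ℂ)) := by
  rw [SchwartzMap.fourier_coe, hφ.coe_toSchwartz]

theorem IsTest.fourierInv_eq {φ : R3 → ℝ} (hφ : IsTest φ) :
    𝓕⁻ (fun y : R3 => (φ y : ℂ)) = ⇑(𝓕⁻ hφ.toSchwartz : 𝓢(R3, ℂ)) := by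
  rw [SchwartzMap.fourierInv_coe, hφ.coe_toSchwartz]

theorem IsTest.aestronglyMeasurable_rieszFourier {φ : R3 → ℝ} (hφ : IsTest φ) (i j : Fin 3) :
    AEStronglyMeasurable (rieszFourier i j φ) volume := by
  unfold rieszFourier
  rw [hφ.fourier_eq]
  exact ((measurable_rieszSymbol i).mul ((measurable_rieszSymbol j).mul
    (SchwartzMap.continuous _).measurable)).aestronglyMeasurable

theorem norm_rieszFourier_le (i j : Fin 3) (φ : R3 → ℝ) (ξ : R3) :
    ‖rieszFourier i j φ ξ‖ ≤ ‖𝓕 (fun y : R3 => (φ y : ℂ)) ξ‖ := by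
  rw [rieszFourier, ← mul_assoc, norm_mul]
  exact mul_le_of_le_one_left (norm_nonneg _) (norm_rieszSymbol_mul_le i j ξ)

theorem IsTest.integrable_rieszFourier {φ : R3 → ℝ} (hφ : IsTest φ) (i j : Fin 3) :
    Integrable (rieszFourier i j φ) volume := by
  have h : Integrable (𝓕 (fun y : R3 => (φ y : ℂ))) volume := by
    rw [hφ.fourier_eq]; exact SchwartzMap.integrable _
  exact h.mono (hφ.aestronglyMeasurable_rieszFourier i j)
    (Eventually.of_forall (norm_rieszFourier_le i j φ))

theorem rieszRieszTest_eq (i j : Fin 3) (φ : R3 → ℝ) (x : R3) :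
    rieszRieszTest i j φ x = (𝓕⁻ (rieszFourier i j φ) x).re := rfl

theorem continuous_fourierInv {f : R3 → ℂ} (hf : Integrable f volume) : Continuous (𝓕⁻ f) := by
  have h : Continuous (𝓕 f) := VectorFourier.fourierIntegral_continuous
    Real.continuous_fourierChar (L := innerₗ R3) continuous_inner hf
  have e : 𝓕⁻ f = fun w => 𝓕 f (-w) := funext (Real.fourierInv_eq_fourier_neg f)
  rw [e]
  exact h.comp continuous_neg

theorem IsTest.continuous_rieszRieszTest {φ : R3 → ℝ} (hφ : IsTest φ) (i j : Fin 3) :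
    Continuous (rieszRieszTest i j φ) :=
  Complex.continuous_re.comp (continuous_fourierInv (hφ.integrable_rieszFourier i j))

/-- `R_i R_j` is a contraction of `L²`, by Plancherel's theorem. -/
theorem IsTest.eLpNorm_rieszRieszTest_le {φ : R3 → ℝ} (hφ : IsTest φ) (i j : Fin 3) :
    eLpNorm (rieszRieszTest i j φ) 2 volume ≤ eLpNorm φ 2 volume := by
  have hnorm : ∀ {ψ : R3 → ℝ} (hψ : IsTest ψ), eLpNorm (hψ.toSchwartz) 2 volume
      = eLpNorm ψ 2 volume := fun {ψ} hψ => by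
    rw [hψ.coe_toSchwartz]
    exact eLpNorm_congr_norm_ae (Eventually.of_forall fun x => Complex.norm_real _)
  apply eLpNorm_le_of_forall_isTest (hφ.continuous_rieszRieszTest i j).locallyIntegrable
  intro ψ hψ
  have hψi : Integrable (fun y => (ψ y : ℂ)) volume := hψ.integrable.ofReal
  have hint : Integrable (fun x => (ψ x : ℂ) * 𝓕⁻ (rieszFourier i j φ) x) volume := by
    apply Continuous.integrable_of_hasCompactSupport
    · exact (Complex.continuous_ofReal.comp hψ.1.continuous).mul
        (continuous_fourierInv (hφ.integrable_rieszFourier i j))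
    · exact HasCompactSupport.mul_right (hψ.2.comp_left (g := Complex.ofReal) Complex.ofReal_zero)
  have e1 : ∫ x, rieszRieszTest i j φ x * ψ x
      = (∫ x, 𝓕⁻ (fun y => (ψ y : ℂ)) x * rieszFourier i j φ x).re := by
    rw [integral_fourierInv_mul_eq hψi (hφ.integrable_rieszFourier i j)]
    have := integral_re hint
    simp only [RCLike.re_eq_complex_re] at this
    rw [← this]
    apply integral_congr_ae
    refine Eventually.of_forall fun x => ?_
    simp only [rieszRieszTest_eq, Complex.re_ofReal_mul]
    ring
  rw [e1]
  calc ‖(∫ x, 𝓕⁻ (fun y => (ψ y : ℂ)) x * rieszFourier i j φ x).re‖ₑ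
      ≤ ‖∫ x, 𝓕⁻ (fun y => (ψ y : ℂ)) x * rieszFourier i j φ x‖ₑ := by
        rw [enorm_le_iff_norm_le]
        exact Complex.abs_re_le_norm _
    _ ≤ ∫⁻ x, ‖𝓕⁻ (fun y => (ψ y : ℂ)) x‖ₑ * ‖rieszFourier i j φ x‖ₑ := by
        simpa only [enorm_mul] using enorm_integral_le_lintegral_enorm
          (fun x => 𝓕⁻ (fun y => (ψ y : ℂ)) x * rieszFourier i j φ x)
    _ ≤ eLpNorm (𝓕⁻ (fun y => (ψ y : ℂ))) 2 volume * eLpNorm (rieszFourier i j φ) 2 volume :=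
        lintegral_enorm_mul_le (continuous_fourierInv hψi).aestronglyMeasurable
          (hφ.aestronglyMeasurable_rieszFourier i j)
    _ ≤ eLpNorm (𝓕⁻ (fun y => (ψ y : ℂ))) 2 volume
          * eLpNorm (𝓕 (fun y => (φ y : ℂ))) 2 volume := by
        gcongr
        exact eLpNorm_mono (norm_rieszFourier_le i j φ)
    _ = eLpNorm φ 2 volume * eLpNorm ψ 2 volume := by
        rw [hφ.fourier_eq, hψ.fourierInv_eq, eLpNorm_fourier, eLpNorm_fourierInv, hnorm, hnorm,
          mul_comm]

theorem rieszRieszTest_const_mul_sub {φ ψ : R3 → ℝ} (hφ : IsTest φ) (hψ : IsTest ψ) (i j : Fin 3)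
    (c : ℝ) (x : R3) :
    rieszRieszTest i j (fun y => c * φ y - ψ y) x
      = c * rieszRieszTest i j φ x - rieszRieszTest i j ψ x := by
  have hF : 𝓕 (fun y => ((c * φ y - ψ y : ℝ) : ℂ))
      = fun ξ => (c : ℂ) * 𝓕 (fun y => (φ y : ℂ)) ξ - 𝓕 (fun y => (ψ y : ℂ)) ξ := by
    have hI : ∀ {f : R3 → ℂ} (ξ : R3), Integrable f volume →
        Integrable (fun v => Real.fourierChar (-inner ℝ v ξ) • f v) volume := fun ξ hf =>
      (Real.fourierIntegral_convergent_iff ξ).2 hf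
    have hφc : Integrable (fun y => (φ y : ℂ)) volume := hφ.integrable.ofReal
    have hψc : Integrable (fun y => (ψ y : ℂ)) volume := hψ.integrable.ofReal
    ext ξ
    simp only [Real.fourier_eq]
    rw [← integral_const_mul, ← integral_sub ((hI ξ hφc).const_mul (c : ℂ)) (hI ξ hψc)]
    congr 1
    ext v
    simp only [Circle.smul_def, smul_eq_mul]
    push_cast
    ring
  have hR : rieszFourier i j (fun y => c * φ y - ψ y)
      = fun ξ => (c : ℂ) • rieszFourier i j φ ξ - rieszFourier i j ψ ξ := by
    ext ξ
    simp only [rieszFourier, hF, smul_eq_mul]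
    ring
  simp only [rieszRieszTest_eq, hR]
  have e : 𝓕⁻ (fun ξ => (c : ℂ) • rieszFourier i j φ ξ - rieszFourier i j ψ ξ) x
      = (c : ℂ) * 𝓕⁻ (rieszFourier i j φ) x - 𝓕⁻ (rieszFourier i j ψ) x := by
    have hI : ∀ {f : R3 → ℂ}, Integrable f volume →
        Integrable (fun v => Real.fourierChar (inner ℝ v x) • f v) volume := by
      intro f hf
      have := (Real.fourierIntegral_convergent_iff (-x)).2 hf
      simpa using this
    simp only [Real.fourierInv_eq]
    rw [← integral_const_mul, ← integral_sub]
    · congr 1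
      ext v
      simp only [Circle.smul_def, smul_eq_mul]
      ring
    · exact (hI (hφ.integrable_rieszFourier i j)).const_mul _
    · exact hI (hψ.integrable_rieszFourier i j)
  rw [e]
  simp

/-! ### The kernel of the double Riesz transforms -/

/-- A smooth cutoff on the line, used to decompose the symbol of `R_i R_j` into
pieces at all scales. -/
noncomputable def symbolBump : ContDiffBump (0 : ℝ) := ⟨1, 2, one_pos, one_lt_two⟩

/-- The constant `c = ∫_0^∞ s β(s²) ds`, where `β` is `symbolBump`. -/
noncomputable def symbolConst : ℝ := ∫ s in Ioi (0 : ℝ), s * symbolBump (s ^ 2)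

theorem integrable_symbolBump : Integrable (fun s : ℝ => s * symbolBump (s ^ 2)) volume := by
  apply Continuous.integrable_of_hasCompactSupport
  · exact continuous_id.mul (symbolBump.continuous.comp (continuous_pow 2))
  · apply HasCompactSupport.mul_left
    apply HasCompactSupport.intro (isCompact_Icc (a := (-2 : ℝ)) (b := 2))
    intro s hs
    apply symbolBump.zero_of_le_dist
    rw [dist_zero_right, Real.norm_of_nonneg (sq_nonneg s)]
    change (2 : ℝ) ≤ s ^ 2
    rw [mem_Icc, not_and_or, not_le, not_le] at hs
    rcases hs with hs | hs <;> nlinarith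

theorem symbolConst_pos : 0 < symbolConst := by
  rw [symbolConst, setIntegral_pos_iff_support_of_nonneg_ae]
  · have : Ioo (0 : ℝ) 1 ⊆ Function.support (fun s : ℝ => s * symbolBump (s ^ 2)) ∩ Ioi 0 := by
      intro s hs
      refine ⟨?_, hs.1⟩
      rw [Function.mem_support, symbolBump.one_of_mem_closedBall]
      · simpa using hs.1.ne'
      · rw [mem_closedBall_zero_iff, Real.norm_of_nonneg (sq_nonneg s)]
        change s ^ 2 ≤ 1
        nlinarith [hs.1, hs.2]
    refine lt_of_lt_of_le ?_ (measure_mono this)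
    simp
  · refine (ae_restrict_iff' measurableSet_Ioi).2 (Eventually.of_forall fun s hs => ?_)
    exact mul_nonneg (le_of_lt hs) symbolBump.nonneg
  · exact integrable_symbolBump.integrableOn

theorem integral_symbolBump {r : ℝ} (hr : 0 < r) :
    ∫ t in Ioi (0 : ℝ), t * symbolBump ((t * r) ^ 2) = symbolConst / r ^ 2 := by
  have h := integral_comp_mul_left_Ioi (fun s : ℝ => s * symbolBump (s ^ 2)) 0 hr
  rw [mul_zero, ← symbolConst, smul_eq_mul] at h
  have e : ∀ t : ℝ, t * symbolBump ((t * r) ^ 2) = r⁻¹ * (r * t * symbolBump ((r * t) ^ 2)) := by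
    intro t
    rw [mul_comm t r]
    field_simp
  simp only [e]
  rw [integral_const_mul, h]
  field_simp

theorem integrableOn_symbolBump {r : ℝ} (hr : 0 < r) :
    IntegrableOn (fun t : ℝ => t * symbolBump ((t * r) ^ 2)) (Ioi 0) volume := by
  have h := (integrableOn_Ioi_comp_mul_left_iff (fun s : ℝ => s * symbolBump (s ^ 2)) 0 hr).2
    integrable_symbolBump.integrableOn
  refine (Integrable.const_mul h r⁻¹).congr (Eventually.of_forall fun t => ?_)
  simp only
  rw [mul_comm t r]
  field_simp

/-- The smooth, compactly supported multiplier `η(ξ) = -ξ_i ξ_j β(|ξ|²)`; the symbol of `R_i R_j`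
is `c⁻¹ ∫_0^∞ η(tξ) dt/t`, with `c` the constant `symbolConst`. -/
noncomputable def symbolPiece (i j : Fin 3) (ξ : R3) : ℂ :=
  ((-(ξ i * ξ j) * symbolBump (‖ξ‖ ^ 2) : ℝ) : ℂ)

theorem hasCompactSupport_symbolPiece (i j : Fin 3) : HasCompactSupport (symbolPiece i j) := by
  apply HasCompactSupport.intro (isCompact_closedBall (0 : R3) 2)
  intro ξ hξ
  rw [mem_closedBall_zero_iff, not_le] at hξ
  rw [symbolPiece, symbolBump.zero_of_le_dist]
  · simp
  · rw [dist_zero_right, Real.norm_of_nonneg (sq_nonneg _)]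
    change (2 : ℝ) ≤ ‖ξ‖ ^ 2
    nlinarith

theorem contDiff_coord (i : Fin 3) : ContDiff ℝ ∞ (fun ξ : R3 => ξ i) :=
  (EuclideanSpace.proj (𝕜 := ℝ) i).contDiff

theorem contDiff_symbolPiece (i j : Fin 3) : ContDiff ℝ ∞ (symbolPiece i j) :=
  Complex.ofRealCLM.contDiff.comp
    ((((contDiff_coord i).mul (contDiff_coord j)).neg).mul
      (symbolBump.contDiff.comp (contDiff_norm_sq ℝ)))

theorem symbolPiece_smul (i j : Fin 3) (t : ℝ) (ξ : R3) (ht : t ≠ 0) :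
    (t : ℂ)⁻¹ * symbolPiece i j (t • ξ)
      = ((-(ξ i * ξ j) * (t * symbolBump ((t * ‖ξ‖) ^ 2)) : ℝ) : ℂ) := by
  have ht' : (t : ℂ) ≠ 0 := by exact_mod_cast ht
  simp only [symbolPiece, norm_smul, mul_pow, Real.norm_eq_abs, sq_abs, PiLp.smul_apply,
    smul_eq_mul]
  push_cast
  field_simp

/-- The inverse Fourier transform of `symbolPiece`. -/
noncomputable def rieszPiece (i j : Fin 3) : R3 → ℂ := 𝓕⁻ (symbolPiece i j)

theorem continuous_symbolPiece (i j : Fin 3) : Continuous (symbolPiece i j) :=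
  (contDiff_symbolPiece i j).continuous

/-- `rieszPiece` is a Schwartz function; the decay of order `4 > 3` makes the integral over the
scales of `t⁻⁴ K(z/t)` converge to a kernel of size `|z|⁻³`. -/
theorem exists_norm_rieszPiece_le (i j : Fin 3) :
    ∃ C : ℝ, 0 ≤ C ∧ ∀ z, (1 + ‖z‖) ^ 4 * ‖rieszPiece i j z‖ ≤ C := by
  set f : 𝓢(R3, ℂ) :=
    (hasCompactSupport_symbolPiece i j).toSchwartzMap (contDiff_symbolPiece i j) with hf
  have e : rieszPiece i j = ⇑(𝓕⁻ f : 𝓢(R3, ℂ)) := by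
    rw [SchwartzMap.fourierInv_coe]; rfl
  have h : ∀ z, (1 + ‖z‖) ^ 4 * ‖rieszPiece i j z‖ ≤ 2 ^ 4 *
      ((Finset.Iic (4, 0)).sup fun m => SchwartzMap.seminorm ℝ m.1 m.2) (𝓕⁻ f : 𝓢(R3, ℂ)) := by
    intro z
    have h := SchwartzMap.one_add_le_sup_seminorm_apply (𝕜 := ℝ) (m := (4, 0)) (k := 4) (n := 0)
      le_rfl le_rfl (𝓕⁻ f : 𝓢(R3, ℂ)) z
    rw [norm_iteratedFDeriv_zero, ← e] at h
    exact h
  exact ⟨_, le_trans (by positivity) (h 0), h⟩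

theorem fourierChar_smul_eq {t : ℝ} (ht : t ≠ 0) (ξ z : R3) :
    Real.fourierChar (inner ℝ ξ z) = Real.fourierChar (inner ℝ (t • ξ) (t⁻¹ • z)) := by
  rw [inner_smul_left, inner_smul_right]
  simp [ht]

/-- A piece of the multiplier, at scale `t`, is the convolution with a rescaled kernel. -/
theorem integral_symbolPiece {φ : R3 → ℝ} (hφ : IsTest φ) (i j : Fin 3) {t : ℝ} (ht : 0 < t)
    (x : R3) :
    ∫ ξ, Real.fourierChar (inner ℝ ξ x) • (((t : ℂ)⁻¹ * symbolPiece i j (t • ξ))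
        * 𝓕 (fun y => (φ y : ℂ)) ξ)
      = ∫ y, (φ y : ℂ) * (((t ^ 4)⁻¹ : ℝ) * rieszPiece i j (t⁻¹ • (x - y))) := by
  set G : R3 → ℂ := fun ξ =>
    Real.fourierChar (inner ℝ ξ x) • ((t : ℂ)⁻¹ * symbolPiece i j (t • ξ)) with hG
  have hGc : Continuous G := by
    have := continuous_symbolPiece i j
    have := Real.continuous_fourierChar
    simp only [hG, Circle.smul_def]
    fun_prop
  have hGi : Integrable G volume := by
    apply hGc.integrable_of_hasCompactSupport
    have h1 : HasCompactSupport fun ξ : R3 => symbolPiece i j (t • ξ) :=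
      (hasCompactSupport_symbolPiece i j).comp_smul ht.ne'
    simp only [hG, Circle.smul_def, smul_eq_mul]
    exact (h1.mul_left).mul_left
  have hφi : Integrable (fun y => (φ y : ℂ)) volume := hφ.integrable.ofReal
  have h := integral_fourier_mul_eq hφi hGi
  have e1 : ∀ y, 𝓕 G y = ((t ^ 4)⁻¹ : ℝ) * rieszPiece i j (t⁻¹ • (x - y)) := by
    intro y
    rw [Real.fourier_eq, rieszPiece, Real.fourierInv_eq]
    have h2 : ∀ v, Real.fourierChar (-inner ℝ v y) • G v = (t : ℂ)⁻¹ *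
        (fun w => Real.fourierChar (inner ℝ w (t⁻¹ • (x - y))) • symbolPiece i j w) (t • v) := by
      intro v
      simp only [hG]
      rw [← fourierChar_smul_eq ht.ne', inner_sub_right, sub_eq_neg_add, AddChar.map_add_eq_mul]
      simp only [Circle.smul_def, smul_eq_mul, Circle.coe_mul]
      ring
    simp only [h2]
    rw [integral_const_mul, Measure.integral_comp_smul volume
      (fun w => Real.fourierChar (inner ℝ w (t⁻¹ • (x - y))) • symbolPiece i j w)]
    have h3 : |((t ^ Module.finrank ℝ R3)⁻¹)| = (t ^ 3)⁻¹ := by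
      rw [finrank_euclideanSpace_fin, abs_of_pos (by positivity)]
    rw [h3, Complex.real_smul, ← mul_assoc]
    congr 1
    push_cast
    rw [← mul_inv]
    ring
  simp only [e1] at h
  rw [← h]
  apply integral_congr_ae
  refine Eventually.of_forall fun ξ => ?_
  simp only [hG, Circle.smul_def, smul_eq_mul]
  ring

/-- The representation of `R_i R_j φ` by an integral over the scales. -/
theorem rieszRieszTest_eq_integral {φ : R3 → ℝ} (hφ : IsTest φ) (i j : Fin 3) (x : R3) :
    symbolConst * 𝓕⁻ (rieszFourier i j φ) x
      = ∫ t in Ioi (0 : ℝ), ∫ y, (φ y : ℂ) *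
          (((t ^ 4)⁻¹ : ℝ) * rieszPiece i j (t⁻¹ • (x - y))) := by
  have hF : Continuous (𝓕 (fun y => (φ y : ℂ))) := by
    rw [hφ.fourier_eq]; exact SchwartzMap.continuous _
  have hFi : Integrable (𝓕 (fun y => (φ y : ℂ))) volume := by
    rw [hφ.fourier_eq]; exact SchwartzMap.integrable _
  set H : ℝ → R3 → ℂ := fun t ξ => Real.fourierChar (inner ℝ ξ x) •
    (((-(ξ i * ξ j) * (t * symbolBump ((t * ‖ξ‖) ^ 2)) : ℝ) : ℂ) * 𝓕 (fun y => (φ y : ℂ)) ξ) with hH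
  have hHn : ∀ t ξ, 0 < t → ‖H t ξ‖ = (t * symbolBump ((t * ‖ξ‖) ^ 2)) *
      (|ξ i * ξ j| * ‖𝓕 (fun y => (φ y : ℂ)) ξ‖) := by
    intro t ξ ht
    simp only [hH, Circle.norm_smul, norm_mul, Complex.norm_real, Real.norm_eq_abs, abs_neg,
      abs_mul, abs_of_pos ht, abs_of_nonneg (symbolBump.nonneg (x := (t * ‖ξ‖) ^ 2))]
    ring
  have hne : ∀ᵐ ξ : R3, ξ ≠ 0 := by
    rw [ae_iff]; simp
  have hHc : Continuous (Function.uncurry H) := by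
    have := Real.continuous_fourierChar
    have := symbolBump.continuous
    have := fun k => (contDiff_coord k).continuous
    simp only [hH, Circle.smul_def, Function.uncurry_def]
    fun_prop
  -- absolute integrability in `(t, ξ)`: integrating in `t` first gives a multiple of
  -- `|ξ_i ξ_j| / |ξ|² ≤ 1`
  have hint : Integrable (Function.uncurry H) ((volume.restrict (Ioi (0 : ℝ))).prod volume) := by
    rw [integrable_prod_iff' hHc.aestronglyMeasurable]
    constructor
    · filter_upwards [hne] with ξ hξ
      have h1 := (integrableOn_symbolBump (norm_pos_iff.2 hξ)).mul_const
        (|ξ i * ξ j| * ‖𝓕 (fun y => (φ y : ℂ)) ξ‖)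
      refine h1.mono' (hHc.comp (Continuous.prodMk_left ξ)).aestronglyMeasurable ?_
      refine (ae_restrict_iff' measurableSet_Ioi).2 (Eventually.of_forall fun t ht => ?_)
      exact (hHn t ξ ht).le
    · refine (hFi.norm.const_mul symbolConst).mono' ?_ ?_
      · exact (hHc.aestronglyMeasurable.norm.prod_swap).integral_prod_right'
      · filter_upwards [hne] with ξ hξ
        have h1 : ∫ t in Ioi (0 : ℝ), ‖Function.uncurry H (t, ξ)‖
            = symbolConst / ‖ξ‖ ^ 2 * (|ξ i * ξ j| * ‖𝓕 (fun y => (φ y : ℂ)) ξ‖) := by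
          rw [← integral_symbolBump (norm_pos_iff.2 hξ), ← integral_mul_const]
          exact setIntegral_congr_fun measurableSet_Ioi fun t ht => hHn t ξ ht
        rw [h1, Real.norm_of_nonneg (by have := symbolConst_pos.le; positivity)]
        have h2 := abs_apply_mul_apply_le i j ξ
        have h3 : 0 < ‖ξ‖ ^ 2 := by have := norm_pos_iff.2 hξ; positivity
        have h4 := symbolConst_pos
        rw [div_mul_eq_mul_div, div_le_iff₀ h3]
        have := mul_le_mul_of_nonneg_left h2
          (mul_nonneg h4.le (norm_nonneg (𝓕 (fun y => (φ y : ℂ)) ξ)))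
        linarith
  have hswap := integral_integral_swap hint
  have e1 : ∫ t in Ioi (0 : ℝ), ∫ ξ, H t ξ = ∫ t in Ioi (0 : ℝ), ∫ y, (φ y : ℂ) *
          (((t ^ 4)⁻¹ : ℝ) * rieszPiece i j (t⁻¹ • (x - y))) := by
    apply setIntegral_congr_fun measurableSet_Ioi
    intro t ht
    simp only
    rw [← integral_symbolPiece hφ i j ht x]
    simp only [hH, symbolPiece_smul i j t _ (ne_of_gt ht)]
  rw [← e1, hswap, Real.fourierInv_eq, ← integral_const_mul]
  apply integral_congr_ae
  filter_upwards [hne] with ξ hξ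
  have e2 : ∀ t, H t ξ = ((t * symbolBump ((t * ‖ξ‖) ^ 2) : ℝ) : ℂ) *
      (Real.fourierChar (inner ℝ ξ x) • (((-(ξ i * ξ j) : ℝ) : ℂ) * 𝓕 (fun y => (φ y : ℂ)) ξ)) := by
    intro t
    simp only [hH, Circle.smul_def, smul_eq_mul]
    push_cast
    ring
  simp only [e2]
  rw [integral_mul_const, integral_complex_ofReal, integral_symbolBump (norm_pos_iff.2 hξ),
    rieszFourier, ← mul_assoc (rieszSymbol i ξ), rieszSymbol_mul]
  simp only [Circle.smul_def, smul_eq_mul]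
  push_cast
  ring

theorem lintegral_scales_le {r C : ℝ} (hr : 0 < r) (hC : 0 ≤ C) :
    ∫⁻ t in Ioi (0 : ℝ), ENNReal.ofReal (C * ((t + r) ^ 4)⁻¹) ≤ ENNReal.ofReal (C * (r ^ 3)⁻¹) := by
  have hd : ∀ t ∈ Ioi (0 : ℝ), HasDerivAt (fun t : ℝ => -C / 3 * ((t + r) ^ 3)⁻¹)
      (C * ((t + r) ^ 4)⁻¹) t := by
    intro t ht
    have ht' : t + r ≠ 0 := (add_pos ht hr).ne'
    have h := ((((hasDerivAt_id' t).add_const r).fun_pow 3).fun_inv (pow_ne_zero 3 ht')).const_mul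
      (-C / 3)
    refine h.congr_deriv ?_
    simp only [Nat.cast_ofNat, Nat.reduceSub, mul_one]
    field_simp
  have hpos : ∀ t ∈ Ioi (0 : ℝ), 0 ≤ C * ((t + r) ^ 4)⁻¹ := fun t ht => by
    have : 0 < t + r := add_pos ht hr
    positivity
  have hlim : Tendsto (fun t : ℝ => -C / 3 * ((t + r) ^ 3)⁻¹) atTop (𝓝 (-C / 3 * 0)) := by
    apply Tendsto.const_mul
    apply tendsto_inv_atTop_zero.comp
    exact (tendsto_pow_atTop three_ne_zero).comp (tendsto_atTop_add_const_right _ r tendsto_id)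
  have hc : ContinuousWithinAt (fun t : ℝ => -C / 3 * ((t + r) ^ 3)⁻¹) (Ici 0) 0 := by
    apply ContinuousAt.continuousWithinAt
    apply ContinuousAt.mul continuousAt_const
    apply ContinuousAt.inv₀
    · fun_prop
    · positivity
  have hi := integrableOn_Ioi_deriv_of_nonneg hc hd hpos hlim
  have he := integral_Ioi_of_hasDerivAt_of_nonneg hc hd hpos hlim
  rw [← ofReal_integral_eq_lintegral_ofReal hi
    ((ae_restrict_iff' measurableSet_Ioi).2 (Eventually.of_forall hpos)), he]
  apply ENNReal.ofReal_le_ofReal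
  have : 0 ≤ C * (r ^ 3)⁻¹ := by positivity
  simp only [zero_add]
  linarith

/-- The kernel of `R_i R_j` is `O(|x - y|⁻³)`. For `x` in the support of `φ` the right-hand side is
infinite unless `φ` vanishes at `x`. -/
theorem exists_enorm_rieszRieszTest_le (i j : Fin 3) :
    ∃ C : ℝ, 0 ≤ C ∧ ∀ φ, IsTest φ → ∀ x,
      ‖rieszRieszTest i j φ x‖ₑ ≤ ∫⁻ y, ‖φ y‖ₑ * ENNReal.ofReal (C * (‖x - y‖ ^ 3)⁻¹) := by
  obtain ⟨C, hC, hK⟩ := exists_norm_rieszPiece_le i j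
  have hc := symbolConst_pos
  refine ⟨symbolConst⁻¹ * C, by positivity, fun φ hφ x => ?_⟩
  have hK' : ∀ t z, 0 < t → ‖(((t ^ 4)⁻¹ : ℝ) : ℂ) * rieszPiece i j (t⁻¹ • z)‖
      ≤ C * ((t + ‖z‖) ^ 4)⁻¹ := by
    intro t z ht
    have h := hK (t⁻¹ • z)
    rw [norm_smul, norm_inv, Real.norm_of_nonneg ht.le] at h
    rw [norm_mul, Complex.norm_real, Real.norm_of_nonneg (by positivity)]
    have e : (t + ‖z‖) ^ 4 = t ^ 4 * (1 + t⁻¹ * ‖z‖) ^ 4 := by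
      rw [← mul_pow]; congr 1; field_simp
    rw [e, mul_inv, ← mul_assoc, mul_comm C, mul_assoc]
    gcongr
    rw [← div_eq_mul_inv, le_div_iff₀ (by positivity), mul_comm]
    exact h
  have h1 : ‖rieszRieszTest i j φ x‖ₑ ≤ ‖𝓕⁻ (rieszFourier i j φ) x‖ₑ := by
    rw [rieszRieszTest_eq, enorm_le_iff_norm_le]
    exact Complex.abs_re_le_norm _
  have h2 : 𝓕⁻ (rieszFourier i j φ) x = ((symbolConst⁻¹ : ℝ) : ℂ) *
      ∫ t in Ioi (0 : ℝ), ∫ y, (φ y : ℂ) *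
          (((t ^ 4)⁻¹ : ℝ) * rieszPiece i j (t⁻¹ • (x - y))) := by
    rw [← rieszRieszTest_eq_integral hφ, ← mul_assoc]
    have : (symbolConst : ℂ) ≠ 0 := by exact_mod_cast hc.ne'
    push_cast
    rw [inv_mul_cancel₀ this, one_mul]
  have hne : ∀ᵐ y : R3, y ≠ x := by
    rw [ae_iff]; simp
  calc ‖rieszRieszTest i j φ x‖ₑ
      ≤ ENNReal.ofReal symbolConst⁻¹ * ∫⁻ t in Ioi (0 : ℝ), ∫⁻ y, ‖φ y‖ₑ *
          ENNReal.ofReal (C * ((t + ‖x - y‖) ^ 4)⁻¹) := by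
        refine h1.trans ?_
        rw [h2, enorm_mul]
        gcongr
        · rw [← ofReal_norm, Complex.norm_real, Real.norm_of_nonneg (by positivity)]
        · refine (enorm_integral_le_lintegral_enorm _).trans ?_
          apply setLIntegral_mono' measurableSet_Ioi
          intro t ht
          refine (enorm_integral_le_lintegral_enorm _).trans (lintegral_mono fun y => ?_)
          rw [enorm_mul]
          gcongr
          · rw [← ofReal_norm, ← ofReal_norm, Complex.norm_real]
          · rw [← ofReal_norm]
            exact ENNReal.ofReal_le_ofReal (hK' t _ ht)
    _ = ENNReal.ofReal symbolConst⁻¹ * ∫⁻ y, ‖φ y‖ₑ * ∫⁻ t in Ioi (0 : ℝ),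
          ENNReal.ofReal (C * ((t + ‖x - y‖) ^ 4)⁻¹) := by
        congr 1
        have hm : Measurable fun z : ℝ × R3 => ENNReal.ofReal (C * ((z.1 + ‖x - z.2‖) ^ 4)⁻¹) := by
          fun_prop
        have hφm : Measurable fun y => ‖φ y‖ₑ := hφ.1.continuous.measurable.enorm
        rw [lintegral_lintegral_swap]
        · apply lintegral_congr fun y => ?_
          rw [lintegral_const_mul _ (by fun_prop)]
        · exact ((hφm.comp measurable_snd).mul hm).aemeasurable
    _ ≤ ENNReal.ofReal symbolConst⁻¹ * ∫⁻ y, ‖φ y‖ₑ *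
          ENNReal.ofReal (C * (‖x - y‖ ^ 3)⁻¹) := by
        gcongr 1
        apply lintegral_mono_ae
        filter_upwards [hne] with y hy
        gcongr
        exact lintegral_scales_le (norm_pos_iff.2 (sub_ne_zero.2 hy.symm)) hC
    _ = _ := by
        rw [← lintegral_const_mul _ (by have := hφ.1.continuous.measurable; fun_prop)]
        apply lintegral_congr fun y => ?_
        rw [mul_assoc symbolConst⁻¹, ENNReal.ofReal_mul (p := symbolConst⁻¹) (by positivity)]
        ring

/-! ### Weighted estimates for the double Riesz transforms -/

/-- The smooth weight `⟨x⟩ = (1 + |x|²)^(1/2)`. -/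
noncomputable def bracket (x : R3) : ℝ := √(1 + ‖x‖ ^ 2)

theorem one_le_bracket (x : R3) : 1 ≤ bracket x :=
  Real.one_le_sqrt.2 (by nlinarith [sq_nonneg ‖x‖])

theorem bracket_pos (x : R3) : 0 < bracket x := one_pos.trans_le (one_le_bracket x)

theorem sq_bracket (x : R3) : bracket x ^ 2 = 1 + ‖x‖ ^ 2 := Real.sq_sqrt (by positivity)

theorem contDiff_bracket : ContDiff ℝ ∞ bracket := by
  apply ContDiff.sqrt
  · exact contDiff_const.add (contDiff_norm_sq ℝ)
  · intro x; positivity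

theorem contDiff_bracket_rpow (a : ℝ) : ContDiff ℝ ∞ fun x => bracket x ^ a :=
  contDiff_bracket.rpow_const_of_ne fun x => (bracket_pos x).ne'

theorem continuous_bracket : Continuous bracket := contDiff_bracket.continuous

theorem norm_le_bracket (x : R3) : ‖x‖ ≤ bracket x := by
  apply Real.le_sqrt_of_sq_le
  linarith

theorem bracket_le_one_add_norm (x : R3) : bracket x ≤ 1 + ‖x‖ := by
  rw [bracket, Real.sqrt_le_left (by positivity)]
  nlinarith [norm_nonneg x]

theorem one_add_norm_le (x : R3) : 1 + ‖x‖ ≤ 2 * bracket x := by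
  linarith [one_le_bracket x, norm_le_bracket x]

theorem bracket_sub_le (x y : R3) : bracket x - bracket y ≤ ‖x - y‖ := by
  have h1 := norm_sub_norm_le x y
  have hx := sq_bracket x
  have hy := sq_bracket y
  have h2 := norm_le_bracket x
  have h3 := norm_le_bracket y
  have h4 := bracket_pos x
  have h5 := bracket_pos y
  by_contra! h
  have h6 : bracket x ^ 2 - bracket y ^ 2 = ‖x‖ ^ 2 - ‖y‖ ^ 2 := by rw [hx, hy]; ring
  have h7 : (bracket x - bracket y) * (bracket x + bracket y)
      = (‖x‖ - ‖y‖) * (‖x‖ + ‖y‖) := by linarith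
  nlinarith [norm_nonneg x, norm_nonneg y, norm_nonneg (x - y)]

/-- Bernoulli's inequality, as a bound of the increments of `s ^ a`. -/
theorem abs_rpow_sub_rpow_le {a s t : ℝ} (ha : 1 ≤ a) (hs : 0 < s) (ht : 0 < t) :
    |s ^ a - t ^ a| ≤ a * max s t ^ (a - 1) * |s - t| := by
  have key : ∀ {s t : ℝ}, 0 < t → t ≤ s → s ^ a - t ^ a ≤ a * s ^ (a - 1) * (s - t) := by
    intro s t ht hts
    have hs : 0 < s := ht.trans_le hts
    have h := one_add_mul_self_le_rpow_one_add (s := t / s - 1) (p := a)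
      (by have : 0 < t / s := by positivity
          linarith) ha
    have h1 : (1 + (t / s - 1)) ^ a = t ^ a / s ^ a := by
      rw [add_sub_cancel, Real.div_rpow ht.le hs.le]
    have hsa : 0 < s ^ a := Real.rpow_pos_of_pos hs a
    rw [h1, le_div_iff₀ hsa] at h
    have h2 : s ^ a = s ^ (a - 1) * s := by
      rw [← Real.rpow_add_one hs.ne', sub_add_cancel]
    have h3 : (1 + a * (t / s - 1)) * s ^ a = s ^ a - a * s ^ (a - 1) * (s - t) := by
      have : t / s * s ^ a = t * s ^ (a - 1) := by rw [h2]; field_simp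
      linear_combination a * this - a * h2
    linarith
  rcases le_total t s with h | h
  · rw [max_eq_left h, abs_of_nonneg (sub_nonneg.2 h),
      abs_of_nonneg (sub_nonneg.2 (Real.rpow_le_rpow ht.le h (by linarith)))]
    exact key ht h
  · rw [max_eq_right h, abs_sub_comm, abs_sub_comm s t, abs_of_nonneg (sub_nonneg.2 h),
      abs_of_nonneg (sub_nonneg.2 (Real.rpow_le_rpow hs.le h (by linarith)))]
    exact key hs h

/-- The part near the diagonal of the commutator kernel; its integrals in `x` and in `y` are bounded
uniformly in the other variable. -/
noncomputable def nearKernel (x y : R3) : ℝ :=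
  if ‖x - y‖ ≤ bracket y / 2 then (‖x - y‖ ^ 2)⁻¹ * (bracket y)⁻¹ else 0

/-- The left-hand side bounds, up to a constant, the kernel of
`ψ ↦ ⟨·⟩ ^ a R_i R_j (⟨·⟩ ^ (-a) ψ) - R_i R_j ψ`. Near the diagonal the difference of the weights gains
a factor `|x - y| / ⟨y⟩`. Away from the diagonal the kernel is bounded by a product, because
`|x - y|` controls `⟨x⟩` and `⟨y⟩` there. -/
theorem commutator_kernel_le {a : ℝ} (ha : 1 ≤ a) (ha2 : a ≤ 2) (x y : R3) :
    |bracket x ^ a / bracket y ^ a - 1| * (‖x - y‖ ^ 3)⁻¹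
      ≤ 3 * nearKernel x y + 54 * (bracket x ^ a * bracket x ^ (-(a + 3 / 4))) *
          bracket y ^ (-(9 / 4 : ℝ)) := by
  have hx := bracket_pos x
  have hy := bracket_pos y
  have hxa : 0 < bracket x ^ a := Real.rpow_pos_of_pos hx a
  have hya : 0 < bracket y ^ a := Real.rpow_pos_of_pos hy a
  have hlip := bracket_sub_le x y
  have hlip' := bracket_sub_le y x
  rw [norm_sub_rev] at hlip'
  rcases eq_or_ne x y with rfl | hxy
  · rw [div_self hxa.ne', sub_self, abs_zero, zero_mul, nearKernel, sub_self, norm_zero]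
    have : 0 ≤ 54 * (bracket x ^ a * bracket x ^ (-(a + 3 / 4))) *
          bracket x ^ (-(9 / 4 : ℝ)) := by positivity
    simp only [ne_eq, OfNat.ofNat_ne_zero, not_false_eq_true, zero_pow, inv_zero, zero_mul,
      ite_self, mul_zero, zero_add]
    exact this
  have hd : 0 < ‖x - y‖ := norm_pos_iff.2 (sub_ne_zero.2 hxy)
  rw [nearKernel]
  split_ifs with hn
  · have h1 : |bracket x ^ a / bracket y ^ a - 1| ≤ 3 * ‖x - y‖ * (bracket y)⁻¹ := by
      rw [div_sub_one hya.ne', abs_div, abs_of_pos hya, div_le_iff₀ hya]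
      refine (abs_rpow_sub_rpow_le ha hx hy).trans ?_
      have hmax : max (bracket x) (bracket y) ≤ 3 / 2 * bracket y :=
        max_le (by linarith) (by linarith)
      have h2 : max (bracket x) (bracket y) ^ (a - 1) ≤ 3 / 2 * bracket y ^ (a - 1) := by
        calc _ ≤ (3 / 2 * bracket y) ^ (a - 1) :=
              Real.rpow_le_rpow (le_max_of_le_left hx.le) hmax (by linarith)
          _ = (3 / 2 : ℝ) ^ (a - 1) * bracket y ^ (a - 1) :=
              Real.mul_rpow (by norm_num) hy.le
          _ ≤ (3 / 2 : ℝ) ^ (1 : ℝ) * bracket y ^ (a - 1) := by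
              gcongr
              · norm_num
              · linarith
          _ = _ := by rw [Real.rpow_one]
      have h3 : bracket y ^ a = bracket y ^ (a - 1) * bracket y := by
        rw [← Real.rpow_add_one hy.ne', sub_add_cancel]
      have h4 : |bracket x - bracket y| ≤ ‖x - y‖ := abs_le.2 ⟨by linarith, hlip⟩
      calc a * max (bracket x) (bracket y) ^ (a - 1) * |bracket x - bracket y|
          ≤ 2 * (3 / 2 * bracket y ^ (a - 1)) * ‖x - y‖ := by gcongr
        _ = _ := by rw [h3]; field_simp
    have h5 : 0 ≤ 54 * (bracket x ^ a * bracket x ^ (-(a + 3 / 4))) *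
          bracket y ^ (-(9 / 4 : ℝ)) := by positivity
    calc _ ≤ 3 * ‖x - y‖ * (bracket y)⁻¹ * (‖x - y‖ ^ 3)⁻¹ := by gcongr
      _ = 3 * ((‖x - y‖ ^ 2)⁻¹ * (bracket y)⁻¹) := by field_simp
      _ ≤ _ := by linarith
  · rw [not_le] at hn
    have hbx : bracket x ≤ 3 * ‖x - y‖ := by linarith
    have hby : bracket y ≤ 3 * ‖x - y‖ := by linarith
    -- the decay of the kernel is distributed over `x` and `y`; `θ = 3/4` and `θ = a + 3/4` leave
    -- `⟨y⟩ ^ (-9/4)` in both terms, which is square integrable because `9/2 > 3`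
    have hprod : ∀ θ : ℝ, 0 ≤ θ → θ ≤ 3 →
        (‖x - y‖ ^ 3)⁻¹ ≤ 27 * (bracket x ^ (-θ) * bracket y ^ (-(3 - θ))) := by
      intro θ h0 h3
      have h1 : bracket x ^ θ * bracket y ^ (3 - θ) ≤ 27 * ‖x - y‖ ^ 3 := by
        calc _ ≤ (3 * ‖x - y‖) ^ θ * (3 * ‖x - y‖) ^ (3 - θ) := by
              gcongr
          _ = (3 * ‖x - y‖) ^ (3 : ℝ) := by
              rw [← Real.rpow_add (by positivity)]; congr 1; ring
          _ = 27 * ‖x - y‖ ^ 3 := by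
              rw [show (3 : ℝ) = (3 : ℕ) by norm_num, Real.rpow_natCast, mul_pow]; norm_num
      rw [Real.rpow_neg hx.le, Real.rpow_neg hy.le, ← mul_inv, ← div_eq_mul_inv,
        le_div_iff₀ (by positivity), inv_mul_le_iff₀ (by positivity)]
      linarith
    have h6 : |bracket x ^ a / bracket y ^ a - 1| ≤ 1 + bracket x ^ a * bracket y ^ (-a) := by
      rw [Real.rpow_neg hy.le, ← div_eq_mul_inv]
      have : 0 < bracket x ^ a / bracket y ^ a := by positivity
      rw [abs_le]; constructor <;> linarith
    have e1 : bracket x ^ (-(3 / 4 : ℝ)) = bracket x ^ a * bracket x ^ (-(a + 3 / 4)) := by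
      rw [← Real.rpow_add hx]; congr 1; ring
    have e2 : bracket y ^ (-a) * bracket y ^ (-(3 - (a + 3 / 4))) = bracket y ^ (-(9 / 4 : ℝ)) := by
      rw [← Real.rpow_add hy]; congr 1; ring
    have e3 : bracket y ^ (-(3 - 3 / 4 : ℝ)) = bracket y ^ (-(9 / 4 : ℝ)) := by
      congr 1; norm_num
    have h7 := hprod (3 / 4) (by norm_num) (by norm_num)
    have h8 := hprod (a + 3 / 4) (by linarith) (by linarith)
    rw [e3, e1] at h7
    have hya' : 0 < bracket y ^ (-a) := Real.rpow_pos_of_pos hy _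
    calc |bracket x ^ a / bracket y ^ a - 1| * (‖x - y‖ ^ 3)⁻¹
        ≤ (1 + bracket x ^ a * bracket y ^ (-a)) * (‖x - y‖ ^ 3)⁻¹ := by gcongr
      _ = (‖x - y‖ ^ 3)⁻¹ + bracket x ^ a * bracket y ^ (-a) * (‖x - y‖ ^ 3)⁻¹ := by ring
      _ ≤ 27 * (bracket x ^ a * bracket x ^ (-(a + 3 / 4)) * bracket y ^ (-(9 / 4 : ℝ)))
          + bracket x ^ a * bracket y ^ (-a) *
            (27 * (bracket x ^ (-(a + 3 / 4)) * bracket y ^ (-(3 - (a + 3 / 4))))) := by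
          gcongr
      _ = _ := by rw [← e2]; ring

/-- Schur's test in `L²`. -/
theorem lintegral_lintegral_schur_le {f g : R3 → ℝ≥0∞} {κ : R3 → R3 → ℝ≥0∞} {C : ℝ≥0∞}
    (hf : AEMeasurable f volume) (hg : AEMeasurable g volume)
    (hκ : Measurable (Function.uncurry κ))
    (h1 : ∀ x, ∫⁻ y, κ x y ≤ C) (h2 : ∀ y, ∫⁻ x, κ x y ≤ C) :
    ∫⁻ x, f x * ∫⁻ y, g y * κ x y
      ≤ C * ((∫⁻ x, f x ^ 2) ^ (1 / 2 : ℝ) * (∫⁻ x, g x ^ 2) ^ (1 / 2 : ℝ)) := by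
  set μ : Measure (R3 × R3) := volume.prod volume
  have hk : Measurable fun z : R3 × R3 => κ z.1 z.2 := hκ
  have hk2 : AEMeasurable (fun z : R3 × R3 => κ z.1 z.2 ^ (1 / 2 : ℝ)) μ :=
    (hk.pow_const _).aemeasurable
  have hF : AEMeasurable (fun z : R3 × R3 => f z.1 * κ z.1 z.2 ^ (1 / 2 : ℝ)) μ :=
    hf.comp_fst.mul hk2
  have hG : AEMeasurable (fun z : R3 × R3 => g z.2 * κ z.1 z.2 ^ (1 / 2 : ℝ)) μ :=
    hg.comp_snd.mul hk2
  have hcs := ENNReal.lintegral_mul_le_Lp_mul_Lq μ Real.HolderConjugate.two_two hF hG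
  have hsq : ∀ a b : ℝ≥0∞, (a * b ^ (1 / 2 : ℝ)) ^ (2 : ℝ) = a ^ 2 * b := by
    intro a b
    rw [ENNReal.mul_rpow_of_nonneg _ _ (by norm_num), ← ENNReal.rpow_mul]
    norm_num
  have hmul : ∀ z : R3 × R3, ((fun z : R3 × R3 => f z.1 * κ z.1 z.2 ^ (1 / 2 : ℝ)) *
      fun z : R3 × R3 => g z.2 * κ z.1 z.2 ^ (1 / 2 : ℝ)) z = f z.1 * (g z.2 * κ z.1 z.2) := by
    intro z
    simp only [Pi.mul_apply]
    have : κ z.1 z.2 ^ (1 / 2 : ℝ) * κ z.1 z.2 ^ (1 / 2 : ℝ) = κ z.1 z.2 := by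
      rw [← ENNReal.rpow_add_of_nonneg _ _ (by norm_num) (by norm_num)]; norm_num
    calc _ = f z.1 * g z.2 * (κ z.1 z.2 ^ (1 / 2 : ℝ) * κ z.1 z.2 ^ (1 / 2 : ℝ)) := by ring
      _ = _ := by rw [this, mul_assoc]
  simp only [hmul, hsq] at hcs
  have hgk : AEMeasurable (fun z : R3 × R3 => g z.2 * κ z.1 z.2) μ :=
    hg.comp_snd.mul hk.aemeasurable
  have hI : ∫⁻ z, f z.1 * (g z.2 * κ z.1 z.2) ∂μ = ∫⁻ x, f x * ∫⁻ y, g y * κ x y := by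
    have hm : AEMeasurable (fun z : R3 × R3 => f z.1 * (g z.2 * κ z.1 z.2)) μ :=
      hf.comp_fst.mul hgk
    rw [lintegral_prod _ hm]
    apply lintegral_congr_ae
    filter_upwards [] with x
    rw [lintegral_const_mul'']
    exact hg.mul (hk.comp (measurable_const.prodMk measurable_id)).aemeasurable
  have hI1 : ∫⁻ z, f z.1 ^ 2 * κ z.1 z.2 ∂μ ≤ C * ∫⁻ x, f x ^ 2 := by
    have hm : AEMeasurable (fun z : R3 × R3 => f z.1 ^ 2 * κ z.1 z.2) μ :=
      (hf.comp_fst.pow_const 2).mul hk.aemeasurable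
    rw [lintegral_prod _ hm,
      ← lintegral_const_mul'' _ (hf.pow_const 2)]
    apply lintegral_mono fun x => ?_
    have hx : Measurable fun y => κ x y := hk.comp (measurable_const.prodMk measurable_id)
    simp only
    rw [lintegral_const_mul _ hx, mul_comm]
    gcongr
    exact h1 x
  have hI2 : ∫⁻ z, g z.2 ^ 2 * κ z.1 z.2 ∂μ ≤ C * ∫⁻ x, g x ^ 2 := by
    have hm : AEMeasurable (fun z : R3 × R3 => g z.2 ^ 2 * κ z.1 z.2) μ :=
      (hg.comp_snd.pow_const 2).mul hk.aemeasurable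
    rw [lintegral_prod_symm _ hm,
      ← lintegral_const_mul'' _ (hg.pow_const 2)]
    apply lintegral_mono fun y => ?_
    have hy : Measurable fun x => κ x y := hk.comp (measurable_id.prodMk measurable_const)
    simp only
    rw [lintegral_const_mul _ hy, mul_comm]
    gcongr
    exact h2 y
  rw [hI] at hcs
  refine hcs.trans ?_
  calc _ ≤ (C * ∫⁻ x, f x ^ 2) ^ (1 / 2 : ℝ) * (C * ∫⁻ x, g x ^ 2) ^ (1 / 2 : ℝ) := by
        gcongr
    _ = (C ^ (1 / 2 : ℝ) * C ^ (1 / 2 : ℝ)) *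
          ((∫⁻ x, f x ^ 2) ^ (1 / 2 : ℝ) * (∫⁻ x, g x ^ 2) ^ (1 / 2 : ℝ)) := by
        rw [ENNReal.mul_rpow_of_nonneg _ _ (by norm_num),
          ENNReal.mul_rpow_of_nonneg _ _ (by norm_num)]
        ring
    _ = _ := by
        rw [← ENNReal.rpow_add_of_nonneg _ _ (by norm_num) (by norm_num)]; norm_num

theorem eLpNorm_two_eq {α E : Type*} [MeasurableSpace α] [NormedAddCommGroup E] {μ : Measure α}
    (f : α → E) : eLpNorm f 2 μ = (∫⁻ x, ‖f x‖ₑ ^ 2 ∂μ) ^ (1 / 2 : ℝ) := by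
  rw [← sq_eLpNorm_two, ← ENNReal.rpow_natCast, ← ENNReal.rpow_mul]
  norm_num

theorem lintegral_inv_sq_norm_le : ∃ c : ℝ, 0 ≤ c ∧ ∀ r : ℝ, 0 ≤ r →
    ∫⁻ z : R3, ENNReal.ofReal (if ‖z‖ ≤ r then (‖z‖ ^ 2)⁻¹ else 0) ≤ ENNReal.ofReal (c * r) := by
  refine ⟨3 * (volume : Measure R3).real (Metric.ball 0 1), by positivity, fun r hr => ?_⟩
  set f : ℝ → ℝ := fun s => if s ≤ r then (s ^ 2)⁻¹ else 0 with hf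
  have hfr : EqOn (fun s : ℝ => s ^ (Module.finrank ℝ R3 - 1) • f s)
      ((Iic r).indicator fun _ => (1 : ℝ)) (Ioi 0) := by
    intro s hs
    have hs0 : s ≠ 0 := ne_of_gt hs
    simp only [finrank_euclideanSpace_fin, hf, smul_eq_mul, indicator_apply, mem_Iic]
    split_ifs
    · field_simp
    · simp
  have hvol : (volume : Measure ℝ) (Ioi 0 ∩ Iic r) = ENNReal.ofReal r := by
    rw [Ioi_inter_Iic, Real.volume_Ioc, sub_zero]
  have hi : Integrable (fun z : R3 => f ‖z‖) volume := by
    rw [integrable_fun_norm_addHaar volume]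
    refine IntegrableOn.congr_fun ?_ hfr.symm measurableSet_Ioi
    rw [IntegrableOn, integrable_indicator_iff measurableSet_Iic, IntegrableOn,
      Measure.restrict_restrict measurableSet_Iic, inter_comm]
    exact integrableOn_const (by rw [hvol]; exact ENNReal.ofReal_ne_top)
  have h0 : ∀ z : R3, 0 ≤ f ‖z‖ := by
    intro z
    simp only [hf]
    split_ifs <;> positivity
  rw [← ofReal_integral_eq_lintegral_ofReal hi (Eventually.of_forall h0)]
  apply ENNReal.ofReal_le_ofReal
  rw [integral_fun_norm_addHaar volume f, setIntegral_congr_fun measurableSet_Ioi hfr,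
    setIntegral_indicator measurableSet_Iic, setIntegral_const,
    measureReal_def (s := Ioi 0 ∩ Iic r), hvol, ENNReal.toReal_ofReal hr, finrank_euclideanSpace_fin]
  simp only [nsmul_eq_mul, smul_eq_mul]
  push_cast
  linarith

theorem measurable_nearKernel : Measurable (Function.uncurry nearKernel) := by
  have := continuous_bracket.measurable
  unfold nearKernel
  simp only [Function.uncurry_def]
  apply Measurable.ite
  · exact measurableSet_le (by fun_prop) (by fun_prop)
  · fun_prop
  · fun_prop

/-- The two hypotheses of Schur's test for `nearKernel`. On its support `⟨x⟩` and `⟨y⟩` are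
comparable, so that each integral is scale invariant. -/
theorem exists_lintegral_nearKernel_le : ∃ C : ℝ≥0,
    (∀ x, ∫⁻ y, ENNReal.ofReal (nearKernel x y) ≤ C) ∧
      ∀ y, ∫⁻ x, ENNReal.ofReal (nearKernel x y) ≤ C := by
  obtain ⟨c, hc, h⟩ := lintegral_inv_sq_norm_le
  have hm : ∀ r : ℝ, Measurable fun z : R3 =>
      ENNReal.ofReal (if ‖z‖ ≤ r then (‖z‖ ^ 2)⁻¹ else 0) := by
    intro r
    apply Measurable.ennreal_ofReal
    apply Measurable.ite
    · exact measurableSet_le (by fun_prop) (by fun_prop)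
    · fun_prop
    · fun_prop
  refine ⟨(2 * c).toNNReal, fun x => ?_, fun y => ?_⟩
  · have hx := bracket_pos x
    calc ∫⁻ y, ENNReal.ofReal (nearKernel x y)
        ≤ ∫⁻ y, ENNReal.ofReal (2 * (bracket x)⁻¹) *
            ENNReal.ofReal (if ‖x - y‖ ≤ bracket x then (‖x - y‖ ^ 2)⁻¹ else 0) := by
          apply lintegral_mono fun y => ?_
          rw [← ENNReal.ofReal_mul (by positivity)]
          apply ENNReal.ofReal_le_ofReal
          rw [nearKernel]
          split_ifs with h1 h2 h2
          · have hlip := bracket_sub_le x y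
            have hy := bracket_pos y
            rw [mul_comm]
            gcongr
            rw [← div_eq_mul_inv, inv_eq_one_div, div_le_div_iff₀ hy hx]
            linarith
          · have hlip := bracket_sub_le y x
            rw [norm_sub_rev] at hlip
            exact absurd (by linarith) h2
          · positivity
          · simp
      _ = ENNReal.ofReal (2 * (bracket x)⁻¹) *
            ∫⁻ z : R3, ENNReal.ofReal (if ‖z‖ ≤ bracket x then (‖z‖ ^ 2)⁻¹ else 0) := by
          rw [← lintegral_sub_left_eq_self (fun z : R3 =>
            ENNReal.ofReal (if ‖z‖ ≤ bracket x then (‖z‖ ^ 2)⁻¹ else 0)) x, lintegral_const_mul]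
          exact (hm (bracket x)).comp (measurable_const.sub measurable_id)
      _ ≤ ENNReal.ofReal (2 * (bracket x)⁻¹) * ENNReal.ofReal (c * bracket x) := by
          gcongr; exact h _ hx.le
      _ = ENNReal.ofReal (2 * c) := by
          rw [← ENNReal.ofReal_mul (by positivity)]
          congr 1
          field_simp
  · have hy := bracket_pos y
    calc ∫⁻ x, ENNReal.ofReal (nearKernel x y)
        = ∫⁻ x, ENNReal.ofReal (bracket y)⁻¹ *
            ENNReal.ofReal (if ‖x - y‖ ≤ bracket y / 2 then (‖x - y‖ ^ 2)⁻¹ else 0) := by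
          apply lintegral_congr fun x => ?_
          rw [← ENNReal.ofReal_mul (by positivity), nearKernel]
          split_ifs
          · rw [mul_comm]
          · rw [mul_zero]
      _ = ENNReal.ofReal (bracket y)⁻¹ *
            ∫⁻ z : R3, ENNReal.ofReal (if ‖z‖ ≤ bracket y / 2 then (‖z‖ ^ 2)⁻¹ else 0) := by
          rw [← lintegral_sub_right_eq_self (fun z : R3 =>
            ENNReal.ofReal (if ‖z‖ ≤ bracket y / 2 then (‖z‖ ^ 2)⁻¹ else 0)) y,
            lintegral_const_mul]
          exact (hm (bracket y / 2)).comp (measurable_id.sub measurable_const)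
      _ ≤ ENNReal.ofReal (bracket y)⁻¹ * ENNReal.ofReal (c * (bracket y / 2)) := by
          gcongr; exact h _ (by positivity)
      _ ≤ ENNReal.ofReal (2 * c) := by
          rw [← ENNReal.ofReal_mul (by positivity)]
          apply ENNReal.ofReal_le_ofReal
          have : (bracket y)⁻¹ * (c * (bracket y / 2)) = c / 2 := by field_simp
          linarith

theorem memLp_one_add_norm_rpow {θ : ℝ} {p : ℝ≥0} (hp : p ≠ 0) (hθ : 3 < θ * p) :
    MemLp (fun x : R3 => (1 + ‖x‖) ^ (-θ)) p volume := by
  have hm : AEStronglyMeasurable (fun x : R3 => (1 + ‖x‖) ^ (-θ)) volume := by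
    apply Continuous.aestronglyMeasurable
    exact Continuous.rpow_const (by fun_prop) fun x => Or.inl (by positivity)
  rw [← integrable_norm_rpow_iff hm (by exact_mod_cast hp) ENNReal.coe_ne_top]
  have h := integrable_one_add_norm (E := R3) (μ := volume) (r := θ * p)
    (by rw [finrank_euclideanSpace_fin]; exact_mod_cast hθ)
  refine h.congr (Eventually.of_forall fun x => ?_)
  simp only [ENNReal.coe_toReal]
  rw [Real.norm_of_nonneg (by positivity), ← Real.rpow_mul (by positivity)]
  congr 1
  ring

theorem bracket_rpow_neg_le {θ : ℝ} (hθ : 0 ≤ θ) (x : R3) :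
    bracket x ^ (-θ) ≤ 2 ^ θ * (1 + ‖x‖) ^ (-θ) := by
  have h0 := bracket_pos x
  have h1 : (0 : ℝ) < 1 + ‖x‖ := by positivity
  rw [Real.rpow_neg h0.le, Real.rpow_neg h1.le, ← div_eq_mul_inv, ← one_div,
    div_le_div_iff₀ (by positivity) (by positivity), one_mul, ← Real.mul_rpow (by norm_num) h0.le]
  exact Real.rpow_le_rpow h1.le (one_add_norm_le x) hθ

theorem memLp_bracket_rpow {θ : ℝ} {p : ℝ≥0} (hp : p ≠ 0) (hθ0 : 0 ≤ θ) (hθ : 3 < θ * p) :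
    MemLp (fun x : R3 => bracket x ^ (-θ)) p volume := by
  refine ((memLp_one_add_norm_rpow hp hθ).const_mul (2 ^ θ)).mono
    (contDiff_bracket_rpow _).continuous.aestronglyMeasurable (Eventually.of_forall fun x => ?_)
  have := bracket_pos x
  rw [Real.norm_of_nonneg (by positivity), Real.norm_of_nonneg (by positivity)]
  exact bracket_rpow_neg_le hθ0 x

theorem IsTest.bracket_mul {ψ : R3 → ℝ} (hψ : IsTest ψ) (a : ℝ) :
    IsTest fun y => bracket y ^ a * ψ y :=
  hψ.contDiff_mul (contDiff_bracket_rpow a)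

/-- The weighted estimate for the bilinear form of `R_i R_j`: the main part is the `L²` bound for
`A / ⟨x⟩ ^ a`, and the commutator with the weight is bounded by Schur's test near the diagonal and
by a product of two norms away from it. -/
theorem exists_enorm_integral_mul_rieszRieszTest_le (i j : Fin 3) :
    ∃ C : ℝ≥0, ∀ (a : ℝ) (A ψ : R3 → ℝ), 1 ≤ a → a ≤ 2 → AEStronglyMeasurable A volume →
      IsTest ψ → ‖∫ x, A x * rieszRieszTest i j (fun y => bracket y ^ (-a) * ψ y) x‖ₑ
        ≤ C * (eLpNorm (fun x => bracket x ^ (-a) * A x) 2 volume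
          + ∫⁻ x, ‖A x‖ₑ * ENNReal.ofReal (bracket x ^ (-(a + 3 / 4)))) * eLpNorm ψ 2 volume := by
  obtain ⟨C, hC, hker⟩ := exists_enorm_rieszRieszTest_le i j
  obtain ⟨c, hc1, hc2⟩ := exists_lintegral_nearKernel_le
  set K : ℝ≥0∞ := eLpNorm (fun x : R3 => bracket x ^ (-(9 / 4 : ℝ))) 2 volume with hK
  have hKfin : K ≠ ⊤ := (memLp_bracket_rpow (p := 2) two_ne_zero (by norm_num)
    (by norm_num)).2.ne
  refine ⟨(C * 3).toNNReal * c + (C * 54).toNNReal * K.toNNReal + 1,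
    fun a A ψ ha ha2 hA hψ => ?_⟩
  set f : R3 → ℝ := fun x => bracket x ^ (-a) * A x with hf
  set φ : R3 → ℝ := fun y => bracket y ^ (-a) * ψ y with hφ
  have hφt : IsTest φ := hψ.bracket_mul (-a)
  have hbm : ∀ θ : ℝ, Measurable fun x : R3 => bracket x ^ θ := fun θ =>
    (contDiff_bracket_rpow θ).continuous.measurable
  have hψm : Measurable ψ := hψ.1.continuous.measurable
  have hfm : AEStronglyMeasurable f volume := (hbm (-a)).aestronglyMeasurable.mul hA
  have hinv : ∀ x, bracket x ^ a * bracket x ^ (-a) = 1 := fun x => by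
    rw [← Real.rpow_add (bracket_pos x), add_neg_cancel, Real.rpow_zero]
  set N : ℝ≥0∞ := ∫⁻ x, ‖A x‖ₑ * ENNReal.ofReal (bracket x ^ (-(a + 3 / 4))) with hN
  -- the kernel bound applied to the test function `⟨x⟩ ^ a φ - ψ`, with `x` frozen in the weight
  have hcomm : ∀ x, ‖bracket x ^ a * rieszRieszTest i j φ x - rieszRieszTest i j ψ x‖ₑ
      ≤ (ENNReal.ofReal (C * 3) * ∫⁻ y, ‖ψ y‖ₑ * ENNReal.ofReal (nearKernel x y))
        + ENNReal.ofReal (C * 54) * ENNReal.ofReal (bracket x ^ a * bracket x ^ (-(a + 3 / 4))) *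
          ∫⁻ y, ‖ψ y‖ₑ * ENNReal.ofReal (bracket y ^ (-(9 / 4 : ℝ))) := by
    intro x
    have hx := bracket_pos x
    have ht : IsTest fun y => bracket x ^ a * φ y - ψ y :=
      ⟨(contDiff_const.mul hφt.1).sub hψ.1, (hφt.2.mul_left).sub hψ.2⟩
    rw [← rieszRieszTest_const_mul_sub hφt hψ]
    refine (hker _ ht x).trans ?_
    have hnm : Measurable fun y => ENNReal.ofReal (nearKernel x y) :=
      (measurable_nearKernel.comp (measurable_const.prodMk measurable_id)).ennreal_ofReal
    have hm1 : Measurable fun y => ‖ψ y‖ₑ * ENNReal.ofReal (nearKernel x y) := hψm.enorm.mul hnm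
    have hm2 : Measurable fun y => ‖ψ y‖ₑ * ENNReal.ofReal (bracket y ^ (-(9 / 4 : ℝ))) :=
      hψm.enorm.mul (hbm _).ennreal_ofReal
    rw [← lintegral_const_mul _ hm1, ← lintegral_const_mul _ hm2,
      ← lintegral_add_left (hm1.const_mul _)]
    apply lintegral_mono fun y => ?_
    have hy := bracket_pos y
    have hnk : 0 ≤ nearKernel x y := by
      rw [nearKernel]; split_ifs <;> positivity
    have e : bracket x ^ a * φ y - ψ y = (bracket x ^ a / bracket y ^ a - 1) * ψ y := by
      simp only [hφ]
      rw [Real.rpow_neg hy.le]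
      ring
    calc ‖bracket x ^ a * φ y - ψ y‖ₑ * ENNReal.ofReal (C * (‖x - y‖ ^ 3)⁻¹)
        = ‖ψ y‖ₑ * ENNReal.ofReal
            (C * (|bracket x ^ a / bracket y ^ a - 1| * (‖x - y‖ ^ 3)⁻¹)) := by
          rw [e, enorm_mul, ← ofReal_norm (bracket x ^ a / bracket y ^ a - 1), Real.norm_eq_abs,
            mul_comm (ENNReal.ofReal _), mul_assoc, ← ENNReal.ofReal_mul (abs_nonneg _)]
          congr 2
          ring
      _ ≤ ‖ψ y‖ₑ * ENNReal.ofReal (C * (3 * nearKernel x y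
            + 54 * (bracket x ^ a * bracket x ^ (-(a + 3 / 4))) * bracket y ^ (-(9 / 4 : ℝ)))) := by
          gcongr
          exact commutator_kernel_le ha ha2 x y
      _ = _ := by
          rw [mul_add, ENNReal.ofReal_add (by positivity) (by positivity), ← mul_assoc C 3,
            ENNReal.ofReal_mul (p := C * 3) (by positivity),
            show C * (54 * (bracket x ^ a * bracket x ^ (-(a + 3 / 4)))
              * bracket y ^ (-(9 / 4 : ℝ))) = C * 54 *
              (bracket x ^ a * bracket x ^ (-(a + 3 / 4))) * bracket y ^ (-(9 / 4 : ℝ)) by ring,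
            ENNReal.ofReal_mul (p := C * 54 * _) (by positivity),
            ENNReal.ofReal_mul (p := C * 54) (by positivity)]
          ring
  have hschur : ∫⁻ x, ‖f x‖ₑ * ∫⁻ y, ‖ψ y‖ₑ * ENNReal.ofReal (nearKernel x y)
      ≤ c * (eLpNorm f 2 volume * eLpNorm ψ 2 volume) := by
    rw [eLpNorm_two_eq, eLpNorm_two_eq]
    exact lintegral_lintegral_schur_le hfm.enorm hψm.enorm.aemeasurable
      measurable_nearKernel.ennreal_ofReal hc1 hc2
  have hψK : ∫⁻ y, ‖ψ y‖ₑ * ENNReal.ofReal (bracket y ^ (-(9 / 4 : ℝ)))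
      ≤ eLpNorm ψ 2 volume * K := by
    have h := lintegral_enorm_mul_le (μ := volume) hψm.aestronglyMeasurable
      (hbm (-(9 / 4 : ℝ))).aestronglyMeasurable
    refine le_trans (lintegral_mono fun y => ?_) h
    have := bracket_pos y
    rw [Real.enorm_eq_ofReal (by positivity : 0 ≤ bracket y ^ (-(9 / 4 : ℝ)))]
  have hAf : ∫⁻ x, ‖f x‖ₑ * ENNReal.ofReal (bracket x ^ a * bracket x ^ (-(a + 3 / 4))) = N := by
    apply lintegral_congr fun x => ?_
    have hx := bracket_pos x
    simp only [hf]
    rw [ENNReal.ofReal_mul (by positivity), ← mul_assoc]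
    congr 1
    rw [enorm_mul, Real.enorm_eq_ofReal (by positivity), mul_right_comm,
      ← ENNReal.ofReal_mul (by positivity), mul_comm (bracket x ^ (-a)), hinv, ENNReal.ofReal_one,
      one_mul]
  have hdec : ∀ x, A x * rieszRieszTest i j φ x
      = f x * (bracket x ^ a * rieszRieszTest i j φ x - rieszRieszTest i j ψ x)
        + f x * rieszRieszTest i j ψ x := by
    intro x
    simp only [hf]
    linear_combination -(A x * rieszRieszTest i j φ x) * hinv x
  have hRm : AEStronglyMeasurable (rieszRieszTest i j ψ) volume :=
    (hψ.continuous_rieszRieszTest i j).aestronglyMeasurable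
  have hcomb : ∫⁻ x, ‖f x‖ₑ * ‖bracket x ^ a * rieszRieszTest i j φ x - rieszRieszTest i j ψ x‖ₑ
      ≤ ENNReal.ofReal (C * 3) * (c * (eLpNorm f 2 volume * eLpNorm ψ 2 volume))
        + ENNReal.ofReal (C * 54) * (eLpNorm ψ 2 volume * K) * N := by
    have hm1 : Measurable fun x => ∫⁻ y, ‖ψ y‖ₑ * ENNReal.ofReal (nearKernel x y) := by
      apply Measurable.lintegral_prod_right'
        (f := fun z : R3 × R3 => ‖ψ z.2‖ₑ * ENNReal.ofReal (nearKernel z.1 z.2))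
      exact (hψm.comp measurable_snd).enorm.mul measurable_nearKernel.ennreal_ofReal
    calc _ ≤ ∫⁻ x, (ENNReal.ofReal (C * 3) *
            (‖f x‖ₑ * ∫⁻ y, ‖ψ y‖ₑ * ENNReal.ofReal (nearKernel x y))
          + ENNReal.ofReal (C * 54) * (eLpNorm ψ 2 volume * K) *
            (‖f x‖ₑ * ENNReal.ofReal (bracket x ^ a * bracket x ^ (-(a + 3 / 4))))) := by
          apply lintegral_mono fun x => ?_
          refine (mul_le_mul_right (hcomm x) _).trans ?_
          rw [mul_add]
          gcongr ?_ + ?_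
          · rw [mul_left_comm]
          · calc _ = ENNReal.ofReal (C * 54) *
                  (∫⁻ y, ‖ψ y‖ₑ * ENNReal.ofReal (bracket y ^ (-(9 / 4 : ℝ)))) *
                  (‖f x‖ₑ * ENNReal.ofReal (bracket x ^ a * bracket x ^ (-(a + 3 / 4)))) := by ring
              _ ≤ _ := by gcongr
      _ ≤ _ := by
          have hm2 : AEMeasurable (fun x => ‖f x‖ₑ *
              ∫⁻ y, ‖ψ y‖ₑ * ENNReal.ofReal (nearKernel x y)) volume :=
            hfm.enorm.mul hm1.aemeasurable
          have hm3 : AEMeasurable (fun x => ‖f x‖ₑ *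
              ENNReal.ofReal (bracket x ^ a * bracket x ^ (-(a + 3 / 4)))) volume :=
            hfm.enorm.mul ((hbm _).mul (hbm _)).ennreal_ofReal.aemeasurable
          rw [lintegral_add_left' (hm2.const_mul _), lintegral_const_mul'' _ hm2,
            lintegral_const_mul'' _ hm3, hAf]
          gcongr
  calc ‖∫ x, A x * rieszRieszTest i j φ x‖ₑ
      ≤ ∫⁻ x, ‖A x * rieszRieszTest i j φ x‖ₑ := enorm_integral_le_lintegral_enorm _
    _ ≤ ∫⁻ x, (‖f x‖ₑ * ‖bracket x ^ a * rieszRieszTest i j φ x - rieszRieszTest i j ψ x‖ₑ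
          + ‖f x‖ₑ * ‖rieszRieszTest i j ψ x‖ₑ) := by
        apply lintegral_mono fun x => ?_
        rw [hdec x, ← enorm_mul, ← enorm_mul]
        exact enorm_add_le _ _
    _ = (∫⁻ x, ‖f x‖ₑ * ‖bracket x ^ a * rieszRieszTest i j φ x - rieszRieszTest i j ψ x‖ₑ)
          + ∫⁻ x, ‖f x‖ₑ * ‖rieszRieszTest i j ψ x‖ₑ :=
        lintegral_add_right' _ (hfm.enorm.mul hRm.enorm)
    _ ≤ (ENNReal.ofReal (C * 3) * (c * (eLpNorm f 2 volume * eLpNorm ψ 2 volume))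
        + ENNReal.ofReal (C * 54) * (eLpNorm ψ 2 volume * K) * N)
          + eLpNorm f 2 volume * eLpNorm ψ 2 volume := by
        gcongr
        exact (lintegral_enorm_mul_le hfm hRm).trans
          (by gcongr; exact hψ.eLpNorm_rieszRieszTest_le i j)
    _ ≤ _ := by
        push_cast
        rw [ENNReal.coe_toNNReal hKfin]
        change (ENNReal.ofReal (C * 3) * (c * (eLpNorm f 2 volume * eLpNorm ψ 2 volume))
          + ENNReal.ofReal (C * 54) * (eLpNorm ψ 2 volume * K) * N)
          + eLpNorm f 2 volume * eLpNorm ψ 2 volume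
          ≤ (ENNReal.ofReal (C * 3) * c + ENNReal.ofReal (C * 54) * K + 1)
            * (eLpNorm f 2 volume + N) * eLpNorm ψ 2 volume
        calc _ = (ENNReal.ofReal (C * 3) * c) * eLpNorm f 2 volume * eLpNorm ψ 2 volume
              + (ENNReal.ofReal (C * 54) * K) * N * eLpNorm ψ 2 volume
              + 1 * eLpNorm f 2 volume * eLpNorm ψ 2 volume := by ring
          _ ≤ (ENNReal.ofReal (C * 3) * c) * (eLpNorm f 2 volume + N) * eLpNorm ψ 2 volume
              + (ENNReal.ofReal (C * 54) * K) * (eLpNorm f 2 volume + N) * eLpNorm ψ 2 volume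
              + 1 * (eLpNorm f 2 volume + N) * eLpNorm ψ 2 volume := by
              gcongr
              · exact le_self_add
              · exact le_add_self
              · exact le_self_add
          _ = _ := by ring

/-- The weighted `L²` estimate for a pressure given by the Riesz transforms, by duality from the
estimate of the bilinear form. No membership of `q` in a weighted space is needed. -/
theorem exists_eLpNorm_le_of_isRieszSum :
    ∃ C : ℝ≥0, ∀ (a : ℝ) (A : Fin 3 → Fin 3 → R3 → ℝ) (q : R3 → ℝ), 1 ≤ a → a ≤ 2 →
      (∀ i j, AEStronglyMeasurable (A i j) volume) → LocallyIntegrable q volume →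
      IsRieszSum A q →
      eLpNorm (fun x => bracket x ^ (-a) * q x) 2 volume
        ≤ C * ∑ i, ∑ j, (eLpNorm (fun x => bracket x ^ (-a) * A i j x) 2 volume
          + ∫⁻ x, ‖A i j x‖ₑ * ENNReal.ofReal (bracket x ^ (-(a + 3 / 4)))) := by
  choose C hC using exists_enorm_integral_mul_rieszRieszTest_le
  refine ⟨∑ i, ∑ j, C i j, fun a A q ha ha2 hA hq hR => ?_⟩
  apply eLpNorm_le_of_forall_isTest
  · have := hq.smul_continuous (contDiff_bracket_rpow (-a)).continuous
    simpa [mul_comm] using this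
  intro ψ hψ
  have e : ∫ x, bracket x ^ (-a) * q x * ψ x = ∫ x, q x * (bracket x ^ (-a) * ψ x) := by
    congr 1; ext x; ring
  rw [e, hR _ (hψ.bracket_mul (-a))]
  refine (enorm_sum_le _ _).trans ?_
  rw [Finset.mul_sum, Finset.sum_mul]
  gcongr with i _
  refine (enorm_sum_le _ _).trans ?_
  rw [Finset.mul_sum, Finset.sum_mul]
  gcongr with j _
  refine (hC i j a (A i j) ψ ha ha2 (hA i j) hψ).trans ?_
  gcongr
  refine (Finset.single_le_sum (f := fun j => C i j) (fun _ _ => zero_le) (Finset.mem_univ j)).trans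
    (Finset.single_le_sum (f := fun i => ∑ j, C i j) (fun _ _ => zero_le) (Finset.mem_univ i))

/-! ### Weak gradients -/

theorem gradient_apply (φ : R3 → ℝ) (x : R3) (i : Fin 3) :
    gradient φ x i = fderiv ℝ φ x (EuclideanSpace.single i 1) := by
  rw [gradient, ← InnerProductSpace.toDual_symm_apply (y := fderiv ℝ φ x), real_inner_comm,
    EuclideanSpace.inner_single_left]
  simp

theorem norm_gradient (φ : R3 → ℝ) (x : R3) : ‖gradient φ x‖ = ‖fderiv ℝ φ x‖ := by
  rw [gradient, LinearIsometryEquiv.norm_map]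

theorem gradient_mul {f g : R3 → ℝ} {x : R3} (hf : DifferentiableAt ℝ f x)
    (hg : DifferentiableAt ℝ g x) :
    gradient (fun y => f y * g y) x = f x • gradient g x + g x • gradient f x := by
  simp only [gradient]
  rw [fderiv_fun_mul hf hg, map_add]
  simp

theorem contDiff_gradient {φ : R3 → ℝ} (hφ : ContDiff ℝ ∞ φ) : ContDiff ℝ ∞ (gradient φ) := by
  have h : ContDiff ℝ ∞ (fderiv ℝ φ) := hφ.fderiv_right (by simp)
  exact ((InnerProductSpace.toDual ℝ R3).symm.contDiff (n := ∞)).comp h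

theorem contDiff_gradient_apply {φ : R3 → ℝ} (hφ : ContDiff ℝ ∞ φ) (i : Fin 3) :
    ContDiff ℝ ∞ fun x => gradient φ x i :=
  (contDiff_coord i).comp (contDiff_gradient hφ)

theorem hasCompactSupport_gradient {φ : R3 → ℝ} (hφ : HasCompactSupport φ) :
    HasCompactSupport (gradient φ) := by
  have h := hφ.fderiv (𝕜 := ℝ)
  exact h.comp_left (g := (InnerProductSpace.toDual ℝ R3).symm) (map_zero _)

theorem IsTest.gradient_apply {φ : R3 → ℝ} (hφ : IsTest φ) (i : Fin 3) :
    IsTest fun x => gradient φ x i :=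
  ⟨contDiff_gradient_apply hφ.1 i,
    (hasCompactSupport_gradient hφ.2).comp_left (g := fun v : R3 => v i) rfl⟩

theorem LocallyIntegrable.integrable_mul_isTest {f φ : R3 → ℝ} (hf : LocallyIntegrable f volume)
    (hφ : IsTest φ) : Integrable (fun x => f x * φ x) volume := by
  have h := hf.integrable_smul_left_of_hasCompactSupport hφ.1.continuous hφ.2
  simpa [mul_comm] using h

theorem locallyIntegrable_apply {V : R3 → R3} (hV : LocallyIntegrable V volume) (i : Fin 3) :
    LocallyIntegrable (fun x => V x i) volume := by
  intro x
  obtain ⟨s, hs, h⟩ := hV x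
  exact ⟨s, hs, (EuclideanSpace.proj (𝕜 := ℝ) i).integrable_comp h⟩

theorem locallyIntegrable_continuous_smul {E : Type*} [NormedAddCommGroup E] [NormedSpace ℝ E]
    {f : R3 → E} {g : R3 → ℝ} (hf : LocallyIntegrable f volume) (hg : Continuous g) :
    LocallyIntegrable (fun x => g x • f x) volume := by
  rw [← locallyIntegrableOn_univ] at hf ⊢
  exact hf.continuousOn_smul isOpen_univ.isLocallyClosed hg.continuousOn

theorem locallyIntegrable_smul_continuous {f : R3 → ℝ} {g : R3 → R3}
    (hf : LocallyIntegrable f volume) (hg : Continuous g) :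
    LocallyIntegrable (fun x => f x • g x) volume := by
  rw [← locallyIntegrableOn_univ] at hf ⊢
  exact hf.smul_continuousOn isOpen_univ.isLocallyClosed hg.continuousOn

theorem IsWeakGradient.contDiff_mul {f : R3 → ℝ} {V : R3 → R3} (h : IsWeakGradient f V)
    {g : R3 → ℝ} (hg : ContDiff ℝ ∞ g) :
    IsWeakGradient (fun x => g x * f x) (fun x => g x • V x + f x • gradient g x) := by
  obtain ⟨hf, hV, hw⟩ := h
  refine ⟨by simpa using locallyIntegrable_continuous_smul hf hg.continuous,
    (locallyIntegrable_continuous_smul hV hg.continuous).add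
      (locallyIntegrable_smul_continuous hf (contDiff_gradient hg).continuous), ?_⟩
  intro φ hφ i
  have hgφ : IsTest fun x => g x * φ x := hφ.contDiff_mul hg
  have h1 := hw _ hgφ i
  have hgrad : ∀ x, gradient (fun y => g y * φ y) x i
      = g x * gradient φ x i + φ x * gradient g x i := by
    intro x
    rw [gradient_mul (hg.differentiable (by simp) x) (hφ.1.differentiable (by simp) x)]
    simp
  have hφg : IsTest fun x => gradient g x i * φ x :=
    hφ.contDiff_mul (contDiff_gradient_apply hg i)
  have hgφ' : IsTest fun x => g x * gradient φ x i := (hφ.gradient_apply i).contDiff_mul hg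
  have e1 : ∫ x, f x * gradient (fun y => g y * φ y) x i
      = (∫ x, f x * (g x * gradient φ x i)) + ∫ x, f x * (gradient g x i * φ x) := by
    rw [← integral_add (LocallyIntegrable.integrable_mul_isTest hf hgφ')
      (LocallyIntegrable.integrable_mul_isTest hf hφg)]
    congr 1; ext x; rw [hgrad]; ring
  have e2 : ∫ x, (g x • V x + f x • gradient g x) i * φ x
      = (∫ x, V x i * (g x * φ x)) + ∫ x, f x * (gradient g x i * φ x) := by
    rw [← integral_add (LocallyIntegrable.integrable_mul_isTest (locallyIntegrable_apply hV i) hgφ)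
      (LocallyIntegrable.integrable_mul_isTest hf hφg)]
    congr 1; ext x
    simp only [PiLp.add_apply, PiLp.smul_apply, smul_eq_mul]
    ring
  have e3 : ∫ x, g x * f x * gradient φ x i = ∫ x, f x * (g x * gradient φ x i) := by
    congr 1; ext x; ring
  rw [e2, e3]
  rw [e1] at h1
  linarith

theorem IsWeakGradient.add {f g : R3 → ℝ} {V W : R3 → R3} (hf : IsWeakGradient f V)
    (hg : IsWeakGradient g W) : IsWeakGradient (fun x => f x + g x) (fun x => V x + W x) := by
  refine ⟨hf.1.add hg.1, hf.2.1.add hg.2.1, fun φ hφ i => ?_⟩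
  have hi := fun {f : R3 → ℝ} (hf : LocallyIntegrable f volume) =>
    LocallyIntegrable.integrable_mul_isTest hf hφ
  have hi' := fun {f : R3 → ℝ} (hf : LocallyIntegrable f volume) =>
    LocallyIntegrable.integrable_mul_isTest hf (hφ.gradient_apply i)
  simp only [PiLp.add_apply, add_mul]
  rw [integral_add (hi' hf.1) (hi' hg.1), integral_add (hi (locallyIntegrable_apply hf.2.1 i))
    (hi (locallyIntegrable_apply hg.2.1 i)), hf.2.2 φ hφ i, hg.2.2 φ hφ i]
  ring

theorem moll_coord {V : R3 → R3} (hV : LocallyIntegrable V volume) (k : ℕ) (x : R3) (i : Fin 3) :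
    moll k V x i = moll k (fun y => V y i) x := by
  have h := (EuclideanSpace.proj (𝕜 := ℝ) i).integral_comp_comm
    (integrable_moll_integrand (k := k) hV x)
  rw [moll_apply, moll_apply]
  simpa using h.symm

/-- Mollification commutes with the gradient. -/
theorem IsWeakGradient.gradient_moll {f : R3 → ℝ} {V : R3 → R3} (h : IsWeakGradient f V) (k : ℕ)
    (x : R3) : gradient (moll k f) x = moll k V x := by
  obtain ⟨hf, hV, hw⟩ := h
  set ρ := (mollBump k).normed volume with hρ
  have hρs : ContDiff ℝ ∞ ρ := (mollBump k).contDiff_normed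
  have hρc : HasCompactSupport ρ := (mollBump k).hasCompactSupport_normed
  have hd := (hρc.hasFDerivAt_convolution_left (ContinuousLinearMap.lsmul ℝ ℝ)
    (hρs.of_le (by simp)) hf x).fderiv
  have hτ : IsTest fun y => ρ (x - y) :=
    ⟨hρs.comp (contDiff_const.sub contDiff_id), hρc.comp_homeomorph (Homeomorph.subLeft x)⟩
  ext i
  have hgτ : ∀ y, gradient (fun y => ρ (x - y)) y i
      = -(fderiv ℝ ρ (x - y) (EuclideanSpace.single i 1)) := by
    intro y
    rw [gradient_apply]
    have h1 : HasFDerivAt (fun y => ρ (x - y)) ((fderiv ℝ ρ (x - y)).comp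
        (-ContinuousLinearMap.id ℝ R3)) y :=
      HasFDerivAt.comp (g := ρ) (f := fun y => x - y) y
        (hρs.differentiable (by simp) _).hasFDerivAt ((hasFDerivAt_id y).const_sub x)
    rw [h1.fderiv]
    simp
  have hint : Integrable (fun y => (ContinuousLinearMap.precompL R3
      (ContinuousLinearMap.lsmul ℝ ℝ : ℝ →L[ℝ] ℝ →L[ℝ] ℝ)) (fderiv ℝ ρ (x - y)) (f y)) volume := by
    have h1 := hf.integrable_smul_right_of_hasCompactSupport
      (g := fun y => fderiv ℝ ρ (x - y))
      (((hρs.fderiv_right (m := ∞) (by simp)).continuous).comp (continuous_const.sub continuous_id))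
      ((hρc.fderiv (𝕜 := ℝ)).comp_homeomorph (Homeomorph.subLeft x))
    refine h1.congr (Eventually.of_forall fun y => ?_)
    ext v
    simp [ContinuousLinearMap.precompL_apply, mul_comm]
  calc gradient (moll k f) x i
      = ∫ y, fderiv ℝ ρ (x - y) (EuclideanSpace.single i 1) * f y := by
        rw [gradient_apply]
        change fderiv ℝ (convolution ρ f _ _) x _ = _
        rw [hd, convolution_eq_swap, ContinuousLinearMap.integral_apply hint]
        simp [ContinuousLinearMap.precompL_apply]
    _ = -∫ y, f y * gradient (fun y => ρ (x - y)) y i := by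
        rw [← integral_neg]
        congr 1; ext y; rw [hgτ]; ring
    _ = ∫ y, V y i * ρ (x - y) := by rw [hw _ hτ i, neg_neg]
    _ = moll k V x i := by
        rw [moll_coord hV, moll_apply]
        congr 1; ext y; rw [smul_eq_mul, mul_comm]

theorem memLp_apply {V : R3 → R3} {p : ℝ≥0∞} (hV : MemLp V p volume) (i : Fin 3) :
    MemLp (fun x => V x i) p volume :=
  (EuclideanSpace.proj (𝕜 := ℝ) i).comp_memLp' hV

theorem memLp_two_mul_isTest {f φ : R3 → ℝ} (hf : MemLp f 2 volume) (hφ : IsTest φ) :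
    MemLp (fun x => f x * φ x) 2 volume := by
  have h := hf.mul (r := 2) (hφ.memLp ⊤)
  refine h.ae_eq (Eventually.of_forall fun x => ?_)
  simp [mul_comm]

/-- The chain rule `∇ (f²) = 2 f ∇f`. It is obtained by testing the definition of `∇f` against the
product of a test function with a mollification of `f`. -/
theorem IsWeakGradient.sq_of_memLp {f : R3 → ℝ} {V : R3 → R3} (h : IsWeakGradient f V)
    (hf : MemLp f 2 volume) (hV : MemLp V 2 volume) :
    IsWeakGradient (fun x => f x ^ 2) (fun x => (2 * f x) • V x) := by
  refine ⟨hf.integrable_sq.locallyIntegrable, ?_, ?_⟩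
  · have h1 : Integrable (fun x => f x • V x) volume :=
      memLp_one_iff_integrable.1 (hV.smul hf)
    have h2 : Integrable (fun x => (2 * f x) • V x) volume :=
      (h1.smul (2 : ℝ)).congr (Eventually.of_forall fun x => by
        simp only [Pi.smul_apply, smul_smul])
    exact h2.locallyIntegrable
  intro φ hφ i
  have hVi := memLp_apply hV i
  have key : ∀ k, (∫ x, (f x * gradient φ x i) * moll k f x)
      + ∫ x, (f x * φ x) * moll k (fun y => V y i) x = -∫ x, (V x i * φ x) * moll k f x := by
    intro k
    have hm : ContDiff ℝ ∞ (moll k f) := contDiff_moll h.1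
    have hmV : ContDiff ℝ ∞ (moll k fun y => V y i) :=
      contDiff_moll (locallyIntegrable_apply h.2.1 i)
    have h1 := h.2.2 _ (hφ.contDiff_mul hm) i
    have e1 : ∫ x, f x * gradient (fun y => moll k f y * φ y) x i
        = (∫ x, (f x * gradient φ x i) * moll k f x)
          + ∫ x, (f x * φ x) * moll k (fun y => V y i) x := by
      rw [← integral_add]
      · congr 1; ext x
        rw [gradient_mul (hm.differentiable (by simp) x) (hφ.1.differentiable (by simp) x),
          h.gradient_moll]
        simp only [PiLp.add_apply, PiLp.smul_apply, smul_eq_mul, moll_coord h.2.1]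
        ring
      · have := LocallyIntegrable.integrable_mul_isTest h.1
          ((hφ.gradient_apply i).contDiff_mul hm)
        refine this.congr (Eventually.of_forall fun x => ?_)
        simp only; ring
      · have := LocallyIntegrable.integrable_mul_isTest h.1 (hφ.contDiff_mul hmV)
        refine this.congr (Eventually.of_forall fun x => ?_)
        simp only; ring
    rw [← e1, h1]
    congr 2; ext x; ring
  have hl1 := tendsto_integral_mul_moll (memLp_two_mul_isTest hf (hφ.gradient_apply i)) hf
  have hl2 := tendsto_integral_mul_moll (memLp_two_mul_isTest hf hφ) hVi
  have hl3 := tendsto_integral_mul_moll (memLp_two_mul_isTest hVi hφ) hf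
  have hlim := tendsto_nhds_unique ((hl1.add hl2).congr key) hl3.neg
  have e2 : ∫ x, f x ^ 2 * gradient φ x i = ∫ x, f x * gradient φ x i * f x := by
    congr 1; ext x; ring
  have e3 : ∫ x, ((2 * f x) • V x) i * φ x = 2 * ∫ x, V x i * φ x * f x := by
    rw [← integral_const_mul]
    congr 1; ext x
    simp only [PiLp.smul_apply, smul_eq_mul]
    ring
  have e4 : ∫ x, f x * φ x * V x i = ∫ x, V x i * φ x * f x := by
    congr 1; ext x; ring
  rw [e2, e3]
  rw [e4] at hlim
  linarith

/-- The Sobolev inequality for compactly supported functions with a weak gradient in `L²`. -/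
theorem exists_eLpNorm_six_le : ∃ C : ℝ≥0, ∀ (f : R3 → ℝ) (V : R3 → R3), IsWeakGradient f V →
    HasCompactSupport f → AEStronglyMeasurable V volume →
    eLpNorm f 6 volume ≤ C * eLpNorm V 2 volume := by
  refine ⟨SNormLESNormFDerivOfEqConst ℝ (volume : Measure R3) (2 : ℝ≥0), fun f V h hc hVm => ?_⟩
  have hk : ∀ k, eLpNorm (moll k f) 6 volume
      ≤ SNormLESNormFDerivOfEqConst ℝ (volume : Measure R3) (2 : ℝ≥0) * eLpNorm V 2 volume := by
    intro k
    have h1 := eLpNorm_le_eLpNorm_fderiv_of_eq (volume : Measure R3) (u := moll k f)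
      ((contDiff_moll h.1).of_le (by simp)) (hasCompactSupport_moll hc) (p := 2) (p' := 6)
      one_le_two (by simp) (by
        rw [finrank_euclideanSpace_fin]; norm_num)
    refine h1.trans ?_
    gcongr
    have e : eLpNorm (fderiv ℝ (moll k f)) 2 volume = eLpNorm (moll k V) 2 volume := by
      apply eLpNorm_congr_norm_ae
      refine Eventually.of_forall fun x => ?_
      rw [← norm_gradient, h.gradient_moll]
    exact e.le.trans (eLpNorm_moll_le hVm)
  refine (Lp.eLpNorm_lim_le_liminf_eLpNorm
    (fun k => (contDiff_moll h.1).continuous.aestronglyMeasurable) f (ae_tendsto_moll h.1)).trans ?_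
  exact Filter.liminf_le_of_le (by isBoundedDefault) fun b hb => by
    obtain ⟨k, hk'⟩ := hb.exists
    exact hk'.trans (hk k)

/-! ### Weights and their regularizations -/

theorem weight_pos (δ : ℝ) (x : R3) : 0 < weight δ x := by
  unfold weight; positivity

theorem weight_nonneg (δ : ℝ) (x : R3) : 0 ≤ weight δ x := (weight_pos δ x).le

theorem continuous_weight (δ : ℝ) : Continuous (weight δ) := by
  unfold weight
  exact (continuous_const.add continuous_norm).rpow_const fun x =>
    Or.inl (add_pos_of_pos_of_nonneg one_pos (norm_nonneg x)).ne'

theorem weight_mul_weight (δ ε : ℝ) (x : R3) : weight δ x * weight ε x = weight (δ + ε) x := by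
  unfold weight
  rw [← Real.rpow_add (by positivity)]
  congr 1; ring

theorem weight_zero (x : R3) : weight 0 x = 1 := by simp [weight]

theorem weight_anti {δ ε : ℝ} (h : δ ≤ ε) (x : R3) : weight ε x ≤ weight δ x :=
  Real.rpow_le_rpow_of_exponent_le (by linarith [norm_nonneg x]) (by linarith)

theorem weight_le_one {δ : ℝ} (h : 0 ≤ δ) (x : R3) : weight δ x ≤ 1 :=
  (weight_anti h x).trans_eq (weight_zero x)

/-- The function `(1 + √(ε² + |x|²))^(-s)`, which is smooth for `ε ≠ 0` and is the weight `w_s`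
for `ε = 0`. -/
noncomputable def regWeight (ε s : ℝ) (x : R3) : ℝ := (1 + √(ε ^ 2 + ‖x‖ ^ 2)) ^ (-s)

theorem regWeight_zero (s : ℝ) : regWeight 0 s = weight s := by
  ext x
  simp [regWeight, weight]

theorem regWeight_pos (ε s : ℝ) (x : R3) : 0 < regWeight ε s x := by
  unfold regWeight; positivity

theorem norm_le_sqrt (ε : ℝ) (x : R3) : ‖x‖ ≤ √(ε ^ 2 + ‖x‖ ^ 2) :=
  Real.le_sqrt_of_sq_le (by nlinarith [sq_nonneg ε])

theorem regWeight_le_weight (ε : ℝ) {s : ℝ} (hs : 0 ≤ s) (x : R3) :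
    regWeight ε s x ≤ weight s x :=
  Real.rpow_le_rpow_of_nonpos (by positivity) (by linarith [norm_le_sqrt ε x]) (by linarith)

theorem weight_le_regWeight {s : ℝ} (hs : 0 ≤ s) (hs' : s ≤ 1) (x : R3) :
    weight s x ≤ 2 * regWeight 1 s x := by
  have h1 : √((1 : ℝ) ^ 2 + ‖x‖ ^ 2) ≤ 1 + ‖x‖ := by
    rw [Real.sqrt_le_left (by positivity)]
    nlinarith [norm_nonneg x]
  have h2 : (2 * (1 + ‖x‖)) ^ (-s) ≤ regWeight 1 s x :=
    Real.rpow_le_rpow_of_nonpos (by positivity) (by linarith [norm_nonneg x]) (by linarith)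
  rw [Real.mul_rpow (by norm_num) (by positivity)] at h2
  have h3 : (2 : ℝ)⁻¹ ≤ 2 ^ (-s) := by
    rw [← Real.rpow_neg_one]
    exact Real.rpow_le_rpow_of_exponent_le (by norm_num) (by linarith)
  have h4 := weight_pos s x
  unfold weight at h4 ⊢
  nlinarith

theorem contDiff_regWeight {ε : ℝ} (hε : ε ≠ 0) (s : ℝ) : ContDiff ℝ ∞ (regWeight ε s) := by
  have h : ∀ x : R3, ε ^ 2 + ‖x‖ ^ 2 ≠ 0 := fun x => by positivity
  unfold regWeight
  exact (contDiff_const.add ((contDiff_const.add (contDiff_norm_sq ℝ)).sqrt h)).rpow_const_of_ne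
    fun x => by positivity

/-- The case `ε = 0`, `x ≠ 0` gives the gradient of the weight itself. -/
theorem gradient_regWeight {ε : ℝ} (s : ℝ) {x : R3} (h : 0 < ε ^ 2 + ‖x‖ ^ 2) :
    gradient (regWeight ε s) x
      = (-s * (1 + √(ε ^ 2 + ‖x‖ ^ 2)) ^ (-s - 1) * (√(ε ^ 2 + ‖x‖ ^ 2))⁻¹) • x := by
  apply HasGradientAt.gradient
  rw [hasGradientAt_iff_hasFDerivAt]
  have h1 : HasFDerivAt (fun y : R3 => ε ^ 2 + ‖y‖ ^ 2) (2 • innerSL ℝ x) x := by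
    have := ((hasFDerivAt_id x).norm_sq).const_add (ε ^ 2)
    exact this.congr_fderiv (by ext; simp)
  have h2 := ((h1.sqrt h.ne').const_add 1).rpow_const (p := -s)
    (Or.inl (by positivity))
  refine h2.congr_fderiv ?_
  have h3 : √(ε ^ 2 + ‖x‖ ^ 2) ≠ 0 := (Real.sqrt_pos.2 h).ne'
  ext v
  simp only [smul_apply, innerSL_apply_apply, smul_eq_mul, map_smul,
    InnerProductSpace.toDual_apply_apply, nsmul_eq_mul]
  field_simp
  push_cast
  ring

theorem norm_gradient_regWeight_le {ε s : ℝ} (hs : 0 ≤ s) {x : R3} (h : 0 < ε ^ 2 + ‖x‖ ^ 2) :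
    ‖gradient (regWeight ε s) x‖ ≤ s * (1 + √(ε ^ 2 + ‖x‖ ^ 2)) ^ (-s - 1) := by
  have h3 : 0 < √(ε ^ 2 + ‖x‖ ^ 2) := Real.sqrt_pos.2 h
  have h4 : 0 < (1 + √(ε ^ 2 + ‖x‖ ^ 2)) ^ (-s - 1) := by positivity
  rw [gradient_regWeight s h, norm_smul, norm_mul, norm_mul, norm_neg, norm_inv,
    Real.norm_of_nonneg hs, Real.norm_of_nonneg h4.le, Real.norm_of_nonneg h3.le, mul_assoc]
  refine mul_le_of_le_one_right (by positivity) ?_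
  rw [inv_mul_le_one₀ h3]
  exact norm_le_sqrt ε x

theorem norm_gradient_regWeight_le_weight {ε s : ℝ} (hs : 0 ≤ s) {x : R3}
    (h : 0 < ε ^ 2 + ‖x‖ ^ 2) : ‖gradient (regWeight ε s) x‖ ≤ s * weight (s + 1) x := by
  refine (norm_gradient_regWeight_le hs h).trans ?_
  refine mul_le_mul_of_nonneg_left ?_ hs
  unfold weight
  rw [show -(s + 1) = -s - 1 by ring]
  exact Real.rpow_le_rpow_of_nonpos (by positivity) (by linarith [norm_le_sqrt ε x])
    (by linarith)

theorem norm_gradient_weight_le {s : ℝ} (hs : 0 ≤ s) {x : R3} (hx : x ≠ 0) :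
    ‖gradient (weight s) x‖ ≤ s * weight (s + 1) x := by
  rw [← regWeight_zero]
  exact norm_gradient_regWeight_le_weight hs (by positivity)

theorem norm_gradient_regWeight_one_le {s : ℝ} (hs : 0 ≤ s) (hs' : s ≤ 1) (x : R3) :
    ‖gradient (regWeight 1 s) x‖ ≤ regWeight 1 s x := by
  refine (norm_gradient_regWeight_le hs (by positivity)).trans ?_
  unfold regWeight
  refine (mul_le_of_le_one_left (by positivity) hs').trans ?_
  exact Real.rpow_le_rpow_of_exponent_le
    (by linarith [Real.sqrt_nonneg ((1 : ℝ) ^ 2 + ‖x‖ ^ 2)]) (by linarith)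

/-! ### Cutoff functions -/

/-- A smooth function equal to `1` on the ball of radius `n + 1`, with support in the ball of
twice that radius. -/
noncomputable def cutoff (n : ℕ) (x : R3) : ℝ :=
  (⟨1, 2, one_pos, one_lt_two⟩ : ContDiffBump (0 : R3)) (((n : ℝ) + 1)⁻¹ • x)

theorem contDiff_cutoff (n : ℕ) : ContDiff ℝ ∞ (cutoff n) :=
  (ContDiffBump.contDiff _).comp (contDiff_const_smul _)

theorem cutoff_nonneg (n : ℕ) (x : R3) : 0 ≤ cutoff n x := ContDiffBump.nonneg _

theorem cutoff_le_one (n : ℕ) (x : R3) : cutoff n x ≤ 1 := ContDiffBump.le_one _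

theorem cutoff_eq_one {n : ℕ} {x : R3} (h : ‖x‖ ≤ n + 1) : cutoff n x = 1 := by
  apply ContDiffBump.one_of_mem_closedBall
  rw [mem_closedBall_zero_iff, norm_smul, norm_inv, Real.norm_of_nonneg (by positivity),
    inv_mul_le_one₀ (by positivity)]
  exact h

theorem eventually_cutoff_eq_one (x : R3) : ∀ᶠ n in atTop, ∀ᶠ y in 𝓝 x, cutoff n y = 1 := by
  filter_upwards [eventually_ge_atTop ⌈‖x‖⌉₊] with n hn
  have h : ‖x‖ < n + 1 := ((Nat.le_ceil _).trans (Nat.cast_le.2 hn)).trans_lt (lt_add_one _)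
  filter_upwards [(continuous_norm.continuousAt (x := x)).eventually (gt_mem_nhds h)] with y hy
  exact cutoff_eq_one hy.le

theorem hasCompactSupport_cutoff (n : ℕ) : HasCompactSupport (cutoff n) :=
  (ContDiffBump.hasCompactSupport _).comp_smul (by positivity)

theorem exists_norm_gradient_cutoff_le :
    ∃ K : ℝ, 0 ≤ K ∧ ∀ n x, ‖gradient (cutoff n) x‖ ≤ K * weight 1 x := by
  set f : ContDiffBump (0 : R3) := ⟨1, 2, one_pos, one_lt_two⟩ with hf
  have hfd : Continuous (fderiv ℝ f) := (f.contDiff (n := 1)).continuous_fderiv (by simp)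
  obtain ⟨K, hK⟩ := (f.hasCompactSupport.fderiv (𝕜 := ℝ)).exists_bound_of_continuous hfd
  have hK0 : 0 ≤ K := (norm_nonneg _).trans (hK 0)
  refine ⟨3 * K, by positivity, fun n x => ?_⟩
  have hn : (0 : ℝ) < n + 1 := by positivity
  have h1 : fderiv ℝ (cutoff n) x
      = ((n : ℝ) + 1)⁻¹ • fderiv ℝ f (((n : ℝ) + 1)⁻¹ • x) := by
    have h2 : HasFDerivAt (cutoff n) ((fderiv ℝ f (((n : ℝ) + 1)⁻¹ • x)).comp
        (((n : ℝ) + 1)⁻¹ • ContinuousLinearMap.id ℝ R3)) x :=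
      HasFDerivAt.comp (g := f) (f := fun y : R3 => ((n : ℝ) + 1)⁻¹ • y) x
        ((f.contDiff (n := 1)).differentiable (by simp) _).hasFDerivAt
        ((((n : ℝ) + 1)⁻¹ • ContinuousLinearMap.id ℝ R3).hasFDerivAt (x := x))
    rw [h2.fderiv]
    ext v; simp
  rw [norm_gradient, h1, norm_smul, norm_inv, Real.norm_of_nonneg hn.le]
  have hw : weight 1 x = (1 + ‖x‖)⁻¹ := by rw [weight, Real.rpow_neg_one]
  rw [hw]
  by_cases hx : ‖x‖ ≤ 2 * (n + 1)
  · calc ((n : ℝ) + 1)⁻¹ * ‖fderiv ℝ f (((n : ℝ) + 1)⁻¹ • x)‖ ≤ ((n : ℝ) + 1)⁻¹ * K := by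
          gcongr; exact hK _
      _ = 3 * K * (3 * ((n : ℝ) + 1))⁻¹ := by field_simp
      _ ≤ 3 * K * (1 + ‖x‖)⁻¹ := by
          gcongr
          have : (0 : ℝ) ≤ n := by positivity
          linarith
  · have h0 : fderiv ℝ f (((n : ℝ) + 1)⁻¹ • x) = 0 := by
      by_contra h
      have h3 := tsupport_fderiv_subset ℝ (f := f) (subset_tsupport _ h)
      rw [f.tsupport_eq, mem_closedBall_zero_iff, norm_smul, norm_inv,
        Real.norm_of_nonneg hn.le, inv_mul_le_iff₀ hn] at h3
      apply hx
      rw [mul_comm]; exact h3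
    rw [h0]
    simp only [norm_zero, mul_zero]
    positivity

/-! ### Weighted Sobolev inequality and chain rule -/

/-- Weighted Sobolev inequality: `‖w_s f‖₆ ≤ C (‖w_s f‖₂ + ‖w_s ∇f‖₂)`. It is the unweighted one for
`f` times a cutoff and the smooth weight `regWeight 1 s`, whose gradient is at most the weight. -/
theorem exists_eLpNorm_weight_six_le : ∃ C : ℝ≥0, ∀ (s : ℝ) (f : R3 → ℝ) (V : R3 → R3), 0 ≤ s →
    s ≤ 1 → IsWeakGradient f V →
    eLpNorm (fun x => weight s x * f x) 6 volume
      ≤ C * (eLpNorm (fun x => weight s x * f x) 2 volume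
        + eLpNorm (fun x => weight s x • V x) 2 volume) := by
  obtain ⟨C, hC⟩ := exists_eLpNorm_six_le
  obtain ⟨K, hK0, hK⟩ := exists_norm_gradient_cutoff_le
  refine ⟨2 * C * (Real.toNNReal (K + 1)), fun s f V hs hs' h => ?_⟩
  set w := regWeight 1 s with hw
  have hwc : ContDiff ℝ ∞ w := contDiff_regWeight one_ne_zero s
  have hVm : AEStronglyMeasurable V volume := h.2.1.aestronglyMeasurable
  have hfm : AEStronglyMeasurable f volume := h.1.aestronglyMeasurable
  set N := eLpNorm (fun x => weight s x * f x) 2 volume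
    + eLpNorm (fun x => weight s x • V x) 2 volume with hN
  have hgw : ∀ n x, ‖gradient (fun y => cutoff n y * w y) x‖ ≤ (K + 1) * weight s x := by
    intro n x
    rw [gradient_mul ((contDiff_cutoff n).differentiable (by simp) x)
      (hwc.differentiable (by simp) x)]
    refine (norm_add_le _ _).trans ?_
    rw [norm_smul, norm_smul, Real.norm_of_nonneg (cutoff_nonneg n x),
      Real.norm_of_nonneg (regWeight_pos 1 s x).le]
    have h1 := cutoff_nonneg n x
    have h2 := cutoff_le_one n x
    have h3 := norm_gradient_regWeight_one_le hs hs' x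
    have h4 := regWeight_le_weight 1 hs x
    have h5 := (hK n x).trans (mul_le_of_le_one_right hK0 (weight_le_one zero_le_one x))
    have h6 := regWeight_pos 1 s x
    have h7 : cutoff n x * ‖gradient w x‖ ≤ 1 * weight s x :=
      mul_le_mul h2 (h3.trans h4) (norm_nonneg _) zero_le_one
    have h8 : w x * ‖gradient (cutoff n) x‖ ≤ weight s x * K :=
      mul_le_mul h4 h5 (norm_nonneg _) (weight_nonneg _ _)
    linarith
  have hk : ∀ n, eLpNorm (fun x => (cutoff n x * w x) * f x) 6 volume
      ≤ C * (Real.toNNReal (K + 1) * N) := by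
    intro n
    have hg := h.contDiff_mul ((contDiff_cutoff n).mul hwc)
    refine (hC _ _ hg ((hasCompactSupport_cutoff n).mul_right.mul_right)
      hg.2.1.aestronglyMeasurable).trans ?_
    gcongr
    refine (eLpNorm_add_le (f := fun x => (cutoff n x * w x) • V x)
      (g := fun x => f x • gradient (fun y => cutoff n y * w y) x)
      (((contDiff_cutoff n).mul hwc).continuous.aestronglyMeasurable.smul hVm)
      (hfm.smul (contDiff_gradient ((contDiff_cutoff n).mul hwc)).continuous.aestronglyMeasurable)
      one_le_two).trans ?_
    rw [hN, mul_add, add_comm]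
    gcongr
    · refine eLpNorm_le_nnreal_smul_eLpNorm_of_ae_le_mul (Eventually.of_forall fun x => ?_) 2
      rw [← NNReal.coe_le_coe]
      push_cast
      rw [Real.coe_toNNReal _ (by positivity), norm_smul, norm_mul,
        Real.norm_of_nonneg (weight_nonneg s x)]
      have := mul_le_mul_of_nonneg_left (hgw n x) (norm_nonneg (f x))
      linarith
    · refine eLpNorm_le_nnreal_smul_eLpNorm_of_ae_le_mul (Eventually.of_forall fun x => ?_) 2
      rw [← NNReal.coe_le_coe]
      push_cast
      rw [Real.coe_toNNReal _ (by positivity), norm_smul, norm_smul, norm_mul,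
        Real.norm_of_nonneg (weight_nonneg s x), Real.norm_of_nonneg (cutoff_nonneg n x),
        Real.norm_of_nonneg (regWeight_pos 1 s x).le]
      have h1 : cutoff n x * regWeight 1 s x ≤ 1 * weight s x :=
        mul_le_mul (cutoff_le_one n x) (regWeight_le_weight 1 hs x) (regWeight_pos 1 s x).le
          zero_le_one
      have h2 : cutoff n x * regWeight 1 s x ≤ (K + 1) * weight s x :=
        h1.trans (mul_le_mul_of_nonneg_right (by linarith) (weight_nonneg s x))
      have := mul_le_mul_of_nonneg_right h2 (norm_nonneg (V x))
      linarith
  have hlim : eLpNorm (fun x => w x * f x) 6 volume ≤ C * (Real.toNNReal (K + 1) * N) := by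
    refine (Lp.eLpNorm_lim_le_liminf_eLpNorm (f := fun n x => (cutoff n x * w x) * f x)
      (fun n => ((contDiff_cutoff n).mul hwc).continuous.aestronglyMeasurable.mul hfm)
      (fun x => w x * f x) (Eventually.of_forall fun x => ?_)).trans ?_
    · refine tendsto_const_nhds.congr' ?_
      filter_upwards [eventually_cutoff_eq_one x] with n hn
      rw [hn.self_of_nhds, one_mul]
    · exact Filter.liminf_le_of_le (by isBoundedDefault) fun b hb => by
        obtain ⟨k, hk'⟩ := hb.exists
        exact hk'.trans (hk k)
  have hle : eLpNorm (fun x => weight s x * f x) 6 volume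
      ≤ (2 : ℝ≥0) • eLpNorm (fun x => w x * f x) 6 volume := by
    refine eLpNorm_le_nnreal_smul_eLpNorm_of_ae_le_mul (Eventually.of_forall fun x => ?_) 6
    rw [← NNReal.coe_le_coe]
    push_cast
    rw [norm_mul, norm_mul, Real.norm_of_nonneg (weight_nonneg s x),
      Real.norm_of_nonneg (regWeight_pos 1 s x).le, ← mul_assoc]
    exact mul_le_mul_of_nonneg_right (weight_le_regWeight hs hs' x) (norm_nonneg _)
  refine hle.trans ?_
  rw [ENNReal.smul_def, smul_eq_mul]
  refine (mul_le_mul_right hlim _).trans_eq ?_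
  push_cast
  ring

/-- The chain rule `∇ (f²) = 2 f ∇f` when `f` and `∇f` are in a weighted `L²` space: apply the
unweighted chain rule to `w f`, with `w` a smooth weight, and multiply `(w f)²` by `w⁻²`. -/
theorem IsWeakGradient.sq {s : ℝ} (hs : 0 ≤ s) (hs' : s ≤ 1) {f : R3 → ℝ} {V : R3 → R3}
    (h : IsWeakGradient f V) (hf : MemLp (fun x => weight s x * f x) 2 volume)
    (hV : MemLp (fun x => weight s x • V x) 2 volume) :
    IsWeakGradient (fun x => f x ^ 2) (fun x => (2 * f x) • V x) := by
  set w := regWeight 1 s with hw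
  have hwc : ContDiff ℝ ∞ w := contDiff_regWeight one_ne_zero s
  have hVm : AEStronglyMeasurable V volume := h.2.1.aestronglyMeasurable
  have hfm : AEStronglyMeasurable f volume := h.1.aestronglyMeasurable
  have hwp : ∀ x, 0 < w x := regWeight_pos 1 s
  have hg := h.contDiff_mul hwc
  have h1 : MemLp (fun x => w x * f x) 2 volume := by
    refine hf.mono (hwc.continuous.aestronglyMeasurable.mul hfm) (Eventually.of_forall fun x => ?_)
    rw [norm_mul, norm_mul, Real.norm_of_nonneg (weight_nonneg s x),
      Real.norm_of_nonneg (hwp x).le]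
    exact mul_le_mul_of_nonneg_right (regWeight_le_weight 1 hs x) (norm_nonneg _)
  have h2 : MemLp (fun x => w x • V x) 2 volume := by
    refine hV.mono (hwc.continuous.aestronglyMeasurable.smul hVm) (Eventually.of_forall fun x => ?_)
    rw [norm_smul, norm_smul, Real.norm_of_nonneg (weight_nonneg s x),
      Real.norm_of_nonneg (hwp x).le]
    exact mul_le_mul_of_nonneg_right (regWeight_le_weight 1 hs x) (norm_nonneg _)
  have h3 : MemLp (fun x => f x • gradient w x) 2 volume := by
    refine hf.mono (hfm.smul (contDiff_gradient hwc).continuous.aestronglyMeasurable)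
      (Eventually.of_forall fun x => ?_)
    rw [norm_smul, norm_mul, Real.norm_of_nonneg (weight_nonneg s x), mul_comm]
    exact mul_le_mul_of_nonneg_right
      ((norm_gradient_regWeight_one_le hs hs' x).trans (regWeight_le_weight 1 hs x)) (norm_nonneg _)
  have h4 := hg.sq_of_memLp h1 (h2.add h3)
  have hvc : ContDiff ℝ ∞ fun x => ((w x) ^ 2)⁻¹ :=
    (hwc.pow 2).inv fun x => (pow_pos (hwp x) 2).ne'
  have h5 := h4.contDiff_mul hvc
  have hgv : ∀ x, gradient (fun x => ((w x) ^ 2)⁻¹) x = (-2 * ((w x) ^ 3)⁻¹) • gradient w x := by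
    intro x
    apply HasGradientAt.gradient
    rw [hasGradientAt_iff_hasFDerivAt]
    have h6 : HasFDerivAt w (fderiv ℝ w x) x := (hwc.differentiable (by simp) x).hasFDerivAt
    have h7 := (hasDerivAt_inv (pow_pos (hwp x) 2).ne').comp_hasFDerivAt x (h6.pow 2)
    refine h7.congr_fderiv ?_
    ext v
    have := (hwp x).ne'
    simp [gradient]
    field_simp
  convert h5 using 2 with x x
  · have := (hwp x).ne'
    field_simp
  · have := (hwp x).ne'
    rw [hgv, smul_add, smul_add, smul_smul, smul_smul, smul_smul, smul_smul,
      smul_smul, add_assoc, ← add_smul]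
    have e : ((w x ^ 2)⁻¹ * (2 * (w x * f x)) * f x) + (w x * f x) ^ 2 * (-2 * (w x ^ 3)⁻¹) = 0 := by
      field_simp
      ring
    have e' : (w x ^ 2)⁻¹ * (2 * (w x * f x)) * w x = 2 * f x := by field_simp
    rw [e', e, zero_smul, add_zero]

/-! ### Estimates at a fixed time -/

theorem enorm_weight (δ : ℝ) (x : R3) : ‖weight δ x‖ₑ = ENNReal.ofReal (weight δ x) :=
  Real.enorm_eq_ofReal (weight_nonneg δ x)

theorem measurable_ofReal_weight (δ : ℝ) :
    Measurable fun x => ENNReal.ofReal (weight δ x) :=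
  (continuous_weight δ).measurable.ennreal_ofReal

theorem lintegral_weightMeasure (δ : ℝ) (f : R3 → ℝ≥0∞) :
    ∫⁻ x, f x ∂(weightMeasure δ) = ∫⁻ x, ENNReal.ofReal (weight δ x) * f x := by
  rw [weightMeasure, lintegral_withDensity_eq_lintegral_mul_non_measurable _
    (measurable_ofReal_weight δ) (Eventually.of_forall fun x => ENNReal.ofReal_lt_top)]
  rfl

theorem volume_absolutelyContinuous (δ : ℝ) :
    (volume : Measure R3) ≪ weightMeasure δ :=
  withDensity_absolutelyContinuous' (measurable_ofReal_weight δ).aemeasurable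
    (Eventually.of_forall fun x => by simpa using weight_pos δ x)

theorem absolutelyContinuous_volume (δ : ℝ) :
    weightMeasure δ ≪ (volume : Measure R3) :=
  withDensity_absolutelyContinuous _ _

/-- Absorbing the weight into the function turns weighted norms into unweighted ones. -/
theorem eLpNorm_weightMeasure {E : Type*} [NormedAddCommGroup E] [NormedSpace ℝ E] (f : R3 → E)
    {p : ℝ≥0∞} (hp : p ≠ 0) (hp' : p ≠ ⊤) (δ : ℝ) :
    eLpNorm f p (weightMeasure δ)
      = eLpNorm (fun x => weight (δ / p.toReal) x • f x) p volume := by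
  have hpos : 0 < p.toReal := ENNReal.toReal_pos hp hp'
  rw [eLpNorm_eq_lintegral_rpow_enorm_toReal hp hp', eLpNorm_eq_lintegral_rpow_enorm_toReal hp hp',
    lintegral_weightMeasure]
  congr 2
  ext x
  rw [enorm_smul, ENNReal.mul_rpow_of_nonneg _ _ hpos.le, enorm_weight,
    ENNReal.ofReal_rpow_of_pos (weight_pos _ _)]
  congr 2
  rw [weight, weight, ← Real.rpow_mul (by positivity)]
  congr 1
  field_simp

theorem eLpNorm_two_weightMeasure {E : Type*} [NormedAddCommGroup E] [NormedSpace ℝ E]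
    (f : R3 → E) (δ : ℝ) :
    eLpNorm f 2 (weightMeasure δ) = eLpNorm (fun x => weight (δ / 2) x • f x) 2 volume := by
  simpa using eLpNorm_weightMeasure f two_ne_zero ENNReal.ofNat_ne_top δ

theorem eLpNorm_three_weightMeasure {E : Type*} [NormedAddCommGroup E] [NormedSpace ℝ E]
    (f : R3 → E) (γ : ℝ) :
    eLpNorm f 3 (weightMeasure (3 * γ / 2))
      = eLpNorm (fun x => weight (γ / 2) x • f x) 3 volume := by
  have h := eLpNorm_weightMeasure f three_ne_zero ENNReal.ofNat_ne_top (3 * γ / 2)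
  rw [h]
  congr 3
  simp
  ring_nf

theorem aestronglyMeasurable_weight_smul {E : Type*} [NormedAddCommGroup E] [NormedSpace ℝ E]
    {f : R3 → E} (hf : AEStronglyMeasurable f volume) (δ : ℝ) :
    AEStronglyMeasurable (fun x => weight δ x • f x) volume :=
  (continuous_weight δ).aestronglyMeasurable.smul hf

instance holderTriple_three_six_two : ENNReal.HolderTriple 3 6 2 where
  inv_add_inv_eq_inv := by
    rw [← ENNReal.toReal_eq_toReal_iff' (by simp) (by simp), ENNReal.toReal_add (by simp) (by simp)]
    norm_num

theorem eLpNorm_norm_smul_two_le {E E' : Type*} [NormedAddCommGroup E] [NormedSpace ℝ E]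
    [NormedAddCommGroup E'] {f : R3 → E'} {g : R3 → E} (hf : AEStronglyMeasurable f volume)
    (hg : AEStronglyMeasurable g volume) :
    eLpNorm (fun x => ‖f x‖ • g x) 2 volume ≤ eLpNorm f 3 volume * eLpNorm g 6 volume := by
  rw [← eLpNorm_norm f]
  exact eLpNorm_smul_le_mul_eLpNorm (p := 3) (q := 6) hg hf.norm

theorem norm_le_sum_norm_apply (v : R3) : ‖v‖ ≤ ∑ i, ‖v i‖ := by
  rw [EuclideanSpace.norm_eq, Real.sqrt_le_left (Finset.sum_nonneg fun i _ => norm_nonneg _)]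
  simp only [Fin.sum_univ_three]
  nlinarith [mul_nonneg (norm_nonneg (v 0)) (norm_nonneg (v 1)),
    mul_nonneg (norm_nonneg (v 0)) (norm_nonneg (v 2)),
    mul_nonneg (norm_nonneg (v 1)) (norm_nonneg (v 2))]

theorem norm_column_le (A : Tensor3) (j : Fin 3) :
    ‖(WithLp.toLp 2 fun i => A (i, j) : R3)‖ ≤ ‖A‖ := by
  rw [EuclideanSpace.norm_eq, EuclideanSpace.norm_eq]
  refine Real.sqrt_le_sqrt ?_
  rw [Fintype.sum_prod_type]
  refine Finset.sum_le_sum fun i _ => ?_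
  exact Finset.single_le_sum (f := fun j => ‖A (i, j)‖ ^ 2) (fun j _ => by positivity)
    (Finset.mem_univ j)

theorem eLpNorm_weight_mono {E E' : Type*} [NormedAddCommGroup E] [NormedSpace ℝ E]
    [NormedAddCommGroup E'] [NormedSpace ℝ E'] {f : R3 → E} {g : R3 → E'}
    (h : ∀ x, ‖f x‖ ≤ ‖g x‖) (δ : ℝ) (p : ℝ≥0∞) :
    eLpNorm (fun x => weight δ x • f x) p volume
      ≤ eLpNorm (fun x => weight δ x • g x) p volume := by
  refine eLpNorm_mono fun x => ?_
  rw [norm_smul, norm_smul]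
  exact mul_le_mul_of_nonneg_left (h x) (norm_nonneg _)

theorem exists_eLpNorm_weight_smul_six_le : ∃ C : ℝ≥0, ∀ (γ : ℝ) (v : R3 → R3) (D : R3 → Tensor3),
    0 < γ → γ ≤ 2 → IsWeakJacobian v D →
    eLpNorm (fun x => weight (γ / 2) x • v x) 6 volume
      ≤ C * (eLpNorm v 2 (weightMeasure γ) + eLpNorm D 2 (weightMeasure γ)) := by
  obtain ⟨C, hC⟩ := exists_eLpNorm_weight_six_le
  refine ⟨3 * C, fun γ v D hγ hγ' h => ?_⟩
  have h1 : eLpNorm (fun x => weight (γ / 2) x • v x) 6 volume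
      ≤ ∑ j, eLpNorm (fun x => weight (γ / 2) x * v x j) 6 volume := by
    have h2 : eLpNorm (fun x => weight (γ / 2) x • v x) 6 volume
        ≤ eLpNorm (∑ j, fun x => ‖weight (γ / 2) x * v x j‖) 6 volume := by
      refine eLpNorm_mono_real fun x => ?_
      refine (norm_le_sum_norm_apply _).trans_eq ?_
      simp
    refine h2.trans ((eLpNorm_sum_le (fun j _ => ?_) (by norm_num)).trans_eq ?_)
    · exact (aestronglyMeasurable_weight_smul (h j).1.aestronglyMeasurable _).norm
    · simp only [eLpNorm_norm]
  refine h1.trans ?_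
  have h3 : ∀ j, eLpNorm (fun x => weight (γ / 2) x * v x j) 6 volume
      ≤ C * (eLpNorm v 2 (weightMeasure γ) + eLpNorm D 2 (weightMeasure γ)) := by
    intro j
    refine (hC (γ / 2) _ _ (by linarith) (by linarith) (h j)).trans ?_
    rw [eLpNorm_two_weightMeasure, eLpNorm_two_weightMeasure]
    gcongr
    · exact eLpNorm_weight_mono (f := fun x => v x j) (fun x => PiLp.norm_apply_le _ _) _ _
    · exact eLpNorm_weight_mono (fun x => norm_column_le _ _) _ _
  refine (Finset.sum_le_sum fun j _ => h3 j).trans_eq ?_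
  simp [mul_assoc]

theorem lintegral_weight_mul_le {E E' : Type*} [NormedAddCommGroup E] [NormedSpace ℝ E]
    [NormedAddCommGroup E'] [NormedSpace ℝ E'] {f : R3 → E} {g : R3 → E'}
    (hf : AEStronglyMeasurable f volume) (hg : AEStronglyMeasurable g volume) (γ : ℝ) :
    ∫⁻ x, ENNReal.ofReal (weight γ x) * (‖f x‖ₑ * ‖g x‖ₑ)
      ≤ eLpNorm f 2 (weightMeasure γ) * eLpNorm g 2 (weightMeasure γ) := by
  rw [← lintegral_weightMeasure γ fun x => ‖f x‖ₑ * ‖g x‖ₑ]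
  exact lintegral_enorm_mul_le (hf.mono_ac (absolutelyContinuous_volume γ))
    (hg.mono_ac (absolutelyContinuous_volume γ))

/-- The transport term `∫ |v|² |b| w_{γ+1}`, by Hölder's inequality with exponents `2`, `3`, `6`. -/
theorem exists_lintegral_drift_le : ∃ C : ℝ≥0, ∀ (γ : ℝ) (v b : R3 → R3) (D : R3 → Tensor3),
    0 < γ → γ ≤ 2 → IsWeakJacobian v D → AEStronglyMeasurable v volume →
    AEStronglyMeasurable b volume →
    ∫⁻ x, ENNReal.ofReal (weight (γ + 1) x) * (‖v x‖ₑ ^ 2 * ‖b x‖ₑ)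
      ≤ C * (eLpNorm v 2 (weightMeasure γ) * (eLpNorm b 3 (weightMeasure (3 * γ / 2))
        * (eLpNorm v 2 (weightMeasure γ) + eLpNorm D 2 (weightMeasure γ)))) := by
  obtain ⟨C, hC⟩ := exists_eLpNorm_weight_smul_six_le
  refine ⟨C, fun γ v b D hγ hγ' h hv hb => ?_⟩
  have hv' := aestronglyMeasurable_weight_smul hv (γ / 2)
  have hb' := aestronglyMeasurable_weight_smul hb (γ / 2)
  have hH := eLpNorm_norm_smul_two_le hb' hv'
  have hB := eLpNorm_three_weightMeasure b γ
  have hU := eLpNorm_two_weightMeasure v γ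
  have hS := hC γ v D hγ hγ' h
  calc ∫⁻ x, ENNReal.ofReal (weight (γ + 1) x) * (‖v x‖ₑ ^ 2 * ‖b x‖ₑ)
      ≤ ∫⁻ x, ‖weight (γ / 2) x • v x‖ₑ
          * ‖‖weight (γ / 2) x • b x‖ • weight (γ / 2) x • v x‖ₑ := by
        refine lintegral_mono fun x => ?_
        have e : ‖weight (γ / 2) x • v x‖ₑ * ‖‖weight (γ / 2) x • b x‖ • weight (γ / 2) x • v x‖ₑ
            = (ENNReal.ofReal (weight (γ / 2) x) * (ENNReal.ofReal (weight (γ / 2) x)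
              * ENNReal.ofReal (weight (γ / 2) x))) * (‖v x‖ₑ ^ 2 * ‖b x‖ₑ) := by
          rw [enorm_smul, enorm_smul, enorm_norm, enorm_smul, enorm_smul, enorm_weight]
          ring
        have h1 : weight (γ + 1) x
            ≤ weight (γ / 2) x * (weight (γ / 2) x * weight (γ / 2) x) := by
          rw [weight_mul_weight, weight_mul_weight]
          exact weight_anti (by linarith) x
        have h2 := ENNReal.ofReal_le_ofReal h1
        rw [ENNReal.ofReal_mul (weight_nonneg _ _), ENNReal.ofReal_mul (weight_nonneg _ _)] at h2
        exact (mul_le_mul_left h2 (‖v x‖ₑ ^ 2 * ‖b x‖ₑ)).trans_eq e.symm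
    _ ≤ eLpNorm (fun x => weight (γ / 2) x • v x) 2 volume
          * eLpNorm (fun x => ‖weight (γ / 2) x • b x‖ • weight (γ / 2) x • v x) 2 volume :=
        lintegral_enorm_mul_le hv' (hb'.norm.smul hv')
    _ ≤ eLpNorm (fun x => weight (γ / 2) x • v x) 2 volume
          * (eLpNorm (fun x => weight (γ / 2) x • b x) 3 volume
            * eLpNorm (fun x => weight (γ / 2) x • v x) 6 volume) := mul_le_mul_right hH _
    _ ≤ eLpNorm v 2 (weightMeasure γ) * (eLpNorm b 3 (weightMeasure (3 * γ / 2))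
          * (C * (eLpNorm v 2 (weightMeasure γ) + eLpNorm D 2 (weightMeasure γ)))) := by
        rw [← hB, ← hU]
        exact mul_le_mul_right (mul_le_mul_right hS _) _
    _ = C * (eLpNorm v 2 (weightMeasure γ) * (eLpNorm b 3 (weightMeasure (3 * γ / 2))
        * (eLpNorm v 2 (weightMeasure γ) + eLpNorm D 2 (weightMeasure γ)))) := by
        rw [mul_left_comm _ (C : ℝ≥0∞), mul_left_comm _ (C : ℝ≥0∞)]

theorem bracket_rpow_le_weight {θ : ℝ} (hθ : 0 ≤ θ) (hθ' : θ ≤ 3) (x : R3) :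
    bracket x ^ (-θ) ≤ 8 * weight θ x := by
  refine (bracket_rpow_neg_le hθ x).trans ?_
  have h1 : (2 : ℝ) ^ θ ≤ 2 ^ (3 : ℝ) := Real.rpow_le_rpow_of_exponent_le (by norm_num) hθ'
  have h2 : (2 : ℝ) ^ (3 : ℝ) = 8 := by norm_num
  exact mul_le_mul_of_nonneg_right (h1.trans_eq h2) (weight_nonneg θ x)

theorem weight_le_bracket_rpow {θ : ℝ} (hθ : 0 ≤ θ) (x : R3) :
    weight θ x ≤ bracket x ^ (-θ) :=
  Real.rpow_le_rpow_of_nonpos (bracket_pos x) (bracket_le_one_add_norm x) (by linarith)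

/-- The pressure estimate for the transport part `∑ R_i R_j (b_i u_j)`. The weighted `L¹` norm of
`b_i u_j` is bounded by Hölder's inequality with exponents `3`, `2`, `6`, the last factor being
`w_{3/4}`, which is in `L⁶` because `9/2 > 3`. -/
theorem exists_eLpNorm_pressure_drift_le : ∃ C : ℝ≥0, ∀ (γ : ℝ) (v b : R3 → R3) (D : R3 → Tensor3)
    (q : R3 → ℝ), 0 < γ → γ ≤ 2 → IsWeakJacobian v D → AEStronglyMeasurable v volume →
    AEStronglyMeasurable b volume → LocallyIntegrable q volume →
    IsRieszSum (fun i j x => b x i * v x j) q →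
    eLpNorm (fun x => bracket x ^ (-(γ / 2 + 1)) * q x) 2 volume
      ≤ C * (eLpNorm b 3 (weightMeasure (3 * γ / 2))
        * (eLpNorm v 2 (weightMeasure γ) + eLpNorm D 2 (weightMeasure γ))) := by
  obtain ⟨C, hC⟩ := exists_eLpNorm_weight_smul_six_le
  obtain ⟨C', hC'⟩ := exists_eLpNorm_le_of_isRieszSum
  have hK : MemLp (weight (3 / 4)) 6 volume :=
    memLp_one_add_norm_rpow (θ := 3 / 4) (p := 6) (by norm_num) (by norm_num)
  set K := (eLpNorm (weight (3 / 4)) 6 volume).toNNReal with hKd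
  have hK' : eLpNorm (weight (3 / 4)) 6 volume = K := (ENNReal.coe_toNNReal hK.2.ne).symm
  refine ⟨C' * (9 * (8 * C + 8 * K)), fun γ v b D q hγ hγ' h hv hb hq hR => ?_⟩
  have hv' := aestronglyMeasurable_weight_smul hv (γ / 2)
  have hb' := aestronglyMeasurable_weight_smul hb (γ / 2)
  have hA : ∀ i j x, ‖b x i * v x j‖ ≤ ‖b x‖ * ‖v x‖ := fun i j x => by
    rw [norm_mul]
    exact mul_le_mul (PiLp.norm_apply_le _ _) (PiLp.norm_apply_le _ _) (norm_nonneg _)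
      (norm_nonneg _)
  have hAm : ∀ i j, AEStronglyMeasurable (fun x => b x i * v x j) volume := fun i j =>
    ((EuclideanSpace.proj (𝕜 := ℝ) i).continuous.comp_aestronglyMeasurable hb).mul
      ((EuclideanSpace.proj (𝕜 := ℝ) j).continuous.comp_aestronglyMeasurable hv)
  set U := eLpNorm v 2 (weightMeasure γ) with hU
  set N := eLpNorm D 2 (weightMeasure γ) with hN
  set B := eLpNorm b 3 (weightMeasure (3 * γ / 2)) with hB
  have hBe : eLpNorm (fun x => weight (γ / 2) x • b x) 3 volume = B :=
    (eLpNorm_three_weightMeasure b γ).symm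
  refine (hC' (γ / 2 + 1) _ q (by linarith) (by linarith) hAm hq hR).trans ?_
  have key : ∀ i j : Fin 3,
      eLpNorm (fun x => bracket x ^ (-(γ / 2 + 1)) * (b x i * v x j)) 2 volume
        + ∫⁻ x, ‖b x i * v x j‖ₑ * ENNReal.ofReal (bracket x ^ (-(γ / 2 + 1 + 3 / 4)))
      ≤ (8 * C + 8 * K) * (B * (U + N)) := by
    intro i j
    have e1 : eLpNorm (fun x => bracket x ^ (-(γ / 2 + 1)) * (b x i * v x j)) 2 volume
        ≤ (8 : ℝ≥0) • eLpNorm (fun x => ‖weight (γ / 2) x • b x‖ • weight (γ / 2) x • v x) 2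
          volume := by
      refine eLpNorm_le_nnreal_smul_eLpNorm_of_ae_le_mul (Eventually.of_forall fun x => ?_) 2
      rw [← NNReal.coe_le_coe]
      push_cast
      have h1 := bracket_rpow_le_weight (θ := γ / 2 + 1) (by linarith) (by linarith) x
      have h2 : weight (γ / 2 + 1) x ≤ weight (γ / 2) x * weight (γ / 2) x := by
        rw [weight_mul_weight]
        exact weight_anti (by linarith) x
      have h3 : 0 < bracket x ^ (-(γ / 2 + 1)) := Real.rpow_pos_of_pos (bracket_pos x) _
      rw [norm_mul, Real.norm_of_nonneg h3.le]
      rw [norm_smul, norm_norm, norm_smul, norm_smul, Real.norm_of_nonneg (weight_nonneg (γ / 2) x)]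
      calc bracket x ^ (-(γ / 2 + 1)) * ‖b x i * v x j‖
          ≤ (8 * (weight (γ / 2) x * weight (γ / 2) x)) * (‖b x‖ * ‖v x‖) :=
            mul_le_mul (h1.trans (by linarith)) (hA i j x) (norm_nonneg _)
              (by have := weight_nonneg (γ / 2) x; positivity)
        _ = _ := by ring
    have e2 : eLpNorm (fun x => ‖weight (γ / 2) x • b x‖ • weight (γ / 2) x • v x) 2 volume
        ≤ B * (C * (U + N)) := by
      refine (eLpNorm_norm_smul_two_le hb' hv').trans ?_
      rw [hBe]
      gcongr
      exact hC γ v D hγ hγ' h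
    have e3 : ∫⁻ x, ‖b x i * v x j‖ₑ * ENNReal.ofReal (bracket x ^ (-(γ / 2 + 1 + 3 / 4)))
        ≤ ∫⁻ x, 8 * (‖weight (γ / 2) x • v x‖ₑ
          * ‖‖weight (γ / 2) x • b x‖ • weight (3 / 4) x‖ₑ) := by
      refine lintegral_mono fun x => ?_
      have h1 := bracket_rpow_le_weight (θ := γ / 2 + 1 + 3 / 4) (by linarith) (by linarith) x
      have h2 : weight (γ / 2 + 1 + 3 / 4) x
          ≤ weight (γ / 2) x * (weight (γ / 2) x * weight (3 / 4) x) := by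
        rw [weight_mul_weight, weight_mul_weight]
        exact weight_anti (by linarith) x
      have h3 := ENNReal.ofReal_le_ofReal (h1.trans (mul_le_mul_of_nonneg_left h2 (by norm_num)))
      rw [ENNReal.ofReal_mul (by norm_num), ENNReal.ofReal_mul (weight_nonneg _ _),
        ENNReal.ofReal_mul (weight_nonneg _ _), ENNReal.ofReal_ofNat] at h3
      have h4 : ‖b x i * v x j‖ₑ ≤ ‖b x‖ₑ * ‖v x‖ₑ := by
        simpa only [← ofReal_norm, ENNReal.ofReal_mul (norm_nonneg (b x))] using
          ENNReal.ofReal_le_ofReal (hA i j x)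
      simp only [enorm_smul, enorm_norm, enorm_weight]
      refine (mul_le_mul' h4 h3).trans_eq ?_
      ring
    have e4 : ∫⁻ x, 8 * (‖weight (γ / 2) x • v x‖ₑ
          * ‖‖weight (γ / 2) x • b x‖ • weight (3 / 4) x‖ₑ) ≤ 8 * (U * (B * K)) := by
      rw [lintegral_const_mul' _ _ (by simp)]
      gcongr
      refine (lintegral_enorm_mul_le hv' (hb'.norm.smul hK.1)).trans ?_
      rw [← eLpNorm_two_weightMeasure]
      gcongr
      refine (eLpNorm_norm_smul_two_le hb' hK.1).trans ?_
      rw [hBe, hK']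
    calc _ ≤ (8 : ℝ≥0) • (B * (C * (U + N))) + 8 * (U * (B * K)) := by
          gcongr
          · exact e1.trans (by gcongr)
          · exact e3.trans e4
      _ ≤ 8 * (B * (C * (U + N))) + 8 * ((U + N) * (B * K)) := by
          rw [ENNReal.smul_def, smul_eq_mul]
          gcongr
          · simp
          · exact le_self_add
      _ = _ := by ring
  calc _ ≤ (C' : ℝ≥0∞) * ∑ _i : Fin 3, ∑ _j : Fin 3, (8 * C + 8 * K) * (B * (U + N)) := by
        gcongr with i _ j _
        exact key i j
    _ = _ := by
        simp only [Finset.sum_const, Finset.card_univ, Fintype.card_fin, nsmul_eq_mul]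
        push_cast
        ring

/-- The pressure estimate for the forcing part `∑ R_i R_j F_{i,j}`. The weighted `L¹` norm of
`F_{i,j}` is bounded by the Cauchy–Schwarz inequality, as `w_{7/4}` is in `L²`. -/
theorem exists_eLpNorm_pressure_force_le : ∃ C : ℝ≥0, ∀ (γ : ℝ) (F : R3 → Tensor3)
    (q : R3 → ℝ), 0 < γ → γ ≤ 2 → AEStronglyMeasurable F volume → LocallyIntegrable q volume →
    IsRieszSum (fun i j x => F x (i, j)) q →
    eLpNorm (fun x => bracket x ^ (-(γ / 2 + 1)) * q x) 2 volume
      ≤ C * eLpNorm F 2 (weightMeasure γ) := by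
  obtain ⟨C', hC'⟩ := exists_eLpNorm_le_of_isRieszSum
  have hK : MemLp (weight (7 / 4)) 2 volume :=
    memLp_one_add_norm_rpow (θ := 7 / 4) (p := 2) (by norm_num) (by norm_num)
  set K := (eLpNorm (weight (7 / 4)) 2 volume).toNNReal with hKd
  have hK' : eLpNorm (weight (7 / 4)) 2 volume = K := (ENNReal.coe_toNNReal hK.2.ne).symm
  refine ⟨C' * (9 * (8 + 8 * K)), fun γ F q hγ hγ' hF hq hR => ?_⟩
  have hF' := aestronglyMeasurable_weight_smul hF (γ / 2)
  have hAm : ∀ i j, AEStronglyMeasurable (fun x => F x (i, j)) volume := fun i j =>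
    (EuclideanSpace.proj (𝕜 := ℝ) (i, j)).continuous.comp_aestronglyMeasurable hF
  refine (hC' (γ / 2 + 1) _ q (by linarith) (by linarith) hAm hq hR).trans ?_
  have hN := eLpNorm_two_weightMeasure F γ
  set N := eLpNorm F 2 (weightMeasure γ) with hNd
  have key : ∀ i j : Fin 3,
      eLpNorm (fun x => bracket x ^ (-(γ / 2 + 1)) * F x (i, j)) 2 volume
        + ∫⁻ x, ‖F x (i, j)‖ₑ * ENNReal.ofReal (bracket x ^ (-(γ / 2 + 1 + 3 / 4)))
      ≤ (8 + 8 * K) * N := by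
    intro i j
    have e1 : eLpNorm (fun x => bracket x ^ (-(γ / 2 + 1)) * F x (i, j)) 2 volume
        ≤ (8 : ℝ≥0) • N := by
      rw [hN]
      refine eLpNorm_le_nnreal_smul_eLpNorm_of_ae_le_mul (Eventually.of_forall fun x => ?_) 2
      rw [← NNReal.coe_le_coe]
      push_cast
      have h1 := bracket_rpow_le_weight (θ := γ / 2 + 1) (by linarith) (by linarith) x
      have h2 : weight (γ / 2 + 1) x ≤ weight (γ / 2) x := weight_anti (by linarith) x
      have h3 : 0 < bracket x ^ (-(γ / 2 + 1)) := Real.rpow_pos_of_pos (bracket_pos x) _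
      rw [norm_mul, Real.norm_of_nonneg h3.le, norm_smul, Real.norm_of_nonneg (weight_nonneg _ x),
        ← mul_assoc]
      exact mul_le_mul (h1.trans (by linarith)) (PiLp.norm_apply_le _ _) (norm_nonneg _)
        (by have := weight_nonneg (γ / 2) x; positivity)
    have e3 : ∫⁻ x, ‖F x (i, j)‖ₑ * ENNReal.ofReal (bracket x ^ (-(γ / 2 + 1 + 3 / 4)))
        ≤ ∫⁻ x, 8 * (‖weight (γ / 2) x • F x‖ₑ * ‖weight (7 / 4) x‖ₑ) := by
      refine lintegral_mono fun x => ?_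
      have h1 := bracket_rpow_le_weight (θ := γ / 2 + 1 + 3 / 4) (by linarith) (by linarith) x
      have h2 : weight (γ / 2 + 1 + 3 / 4) x = weight (γ / 2) x * weight (7 / 4) x := by
        rw [weight_mul_weight]
        congr 1; ring
      have h3 := ENNReal.ofReal_le_ofReal (h1.trans_eq (congrArg _ h2))
      rw [ENNReal.ofReal_mul (by norm_num), ENNReal.ofReal_mul (weight_nonneg _ _),
        ENNReal.ofReal_ofNat] at h3
      have h4 : ‖F x (i, j)‖ₑ ≤ ‖F x‖ₑ := by
        simpa only [← ofReal_norm] using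
          ENNReal.ofReal_le_ofReal (PiLp.norm_apply_le (F x) (i, j))
      simp only [enorm_smul, enorm_weight]
      refine (mul_le_mul' h4 h3).trans_eq ?_
      ring
    have e4 : ∫⁻ x, 8 * (‖weight (γ / 2) x • F x‖ₑ * ‖weight (7 / 4) x‖ₑ) ≤ 8 * (N * K) := by
      rw [lintegral_const_mul' _ _ (by simp), hN, ← hK']
      gcongr
      exact lintegral_enorm_mul_le hF' hK.1
    calc _ ≤ (8 : ℝ≥0) • N + 8 * (N * K) := add_le_add e1 (e3.trans e4)
      _ = _ := by
          rw [ENNReal.smul_def, smul_eq_mul]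
          push_cast
          ring
  calc _ ≤ (C' : ℝ≥0∞) * ∑ _i : Fin 3, ∑ _j : Fin 3, (8 + 8 * K) * N := by
        gcongr with i _ j _
        exact key i j
    _ = _ := by
        simp only [Finset.sum_const, Finset.card_univ, Fintype.card_fin, nsmul_eq_mul]
        push_cast
        ring

/-- The pressure term `∫ |p| |v| w_{γ+1}`. -/
theorem exists_lintegral_pressure_le : ∃ C : ℝ≥0, ∀ (γ : ℝ) (v b : R3 → R3) (D F : R3 → Tensor3)
    (p p₁ p₂ : R3 → ℝ), 0 < γ → γ ≤ 2 → IsWeakJacobian v D → AEStronglyMeasurable v volume →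
    AEStronglyMeasurable b volume → AEStronglyMeasurable F volume →
    LocallyIntegrable p₁ volume → LocallyIntegrable p₂ volume →
    IsRieszSum (fun i j x => b x i * v x j) p₁ → IsRieszSum (fun i j x => F x (i, j)) p₂ →
    p =ᵐ[volume] (fun x => p₁ x - p₂ x) →
    ∫⁻ x, ENNReal.ofReal (weight (γ + 1) x) * (‖p x‖ₑ * ‖v x‖ₑ)
      ≤ C * ((eLpNorm b 3 (weightMeasure (3 * γ / 2))
          * (eLpNorm v 2 (weightMeasure γ) + eLpNorm D 2 (weightMeasure γ))
          + eLpNorm F 2 (weightMeasure γ)) * eLpNorm v 2 (weightMeasure γ)) := by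
  obtain ⟨C₁, hC₁⟩ := exists_eLpNorm_pressure_drift_le
  obtain ⟨C₂, hC₂⟩ := exists_eLpNorm_pressure_force_le
  refine ⟨C₁ + C₂, fun γ v b D F p p₁ p₂ hγ hγ' h hv hb hF h₁ h₂ hR₁ hR₂ hp => ?_⟩
  have hc : AEStronglyMeasurable (fun x : R3 => bracket x ^ (-(γ / 2 + 1))) volume :=
    (contDiff_bracket_rpow _).continuous.aestronglyMeasurable
  have e1 := hC₁ γ v b D p₁ hγ hγ' h hv hb h₁ hR₁
  have e2 := hC₂ γ F p₂ hγ hγ' hF h₂ hR₂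
  set U := eLpNorm v 2 (weightMeasure γ) with hU
  set N := eLpNorm D 2 (weightMeasure γ) with hN
  set B := eLpNorm b 3 (weightMeasure (3 * γ / 2)) with hB
  set G := eLpNorm F 2 (weightMeasure γ) with hG
  have m1 : AEStronglyMeasurable (fun x => bracket x ^ (-(γ / 2 + 1)) * p₁ x) volume :=
    hc.mul h₁.aestronglyMeasurable
  have m2 : AEStronglyMeasurable (fun x => bracket x ^ (-(γ / 2 + 1)) * p₂ x) volume :=
    hc.mul h₂.aestronglyMeasurable
  calc ∫⁻ x, ENNReal.ofReal (weight (γ + 1) x) * (‖p x‖ₑ * ‖v x‖ₑ)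
      ≤ ∫⁻ x, ‖bracket x ^ (-(γ / 2 + 1)) * p₁ x - bracket x ^ (-(γ / 2 + 1)) * p₂ x‖ₑ
          * ‖weight (γ / 2) x • v x‖ₑ := by
        refine lintegral_mono_ae ?_
        filter_upwards [hp] with x hx
        rw [hx, ← mul_sub, enorm_mul, enorm_smul, enorm_weight,
          Real.enorm_eq_ofReal (Real.rpow_nonneg (bracket_pos x).le _)]
        have h2 : weight (γ + 1) x ≤ bracket x ^ (-(γ / 2 + 1)) * weight (γ / 2) x := by
          have h3 : weight (γ + 1) x = weight (γ / 2 + 1) x * weight (γ / 2) x := by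
            rw [weight_mul_weight]
            congr 1; ring
          rw [h3]
          exact mul_le_mul_of_nonneg_right (weight_le_bracket_rpow (by linarith) x)
            (weight_nonneg _ _)
        have h4 := ENNReal.ofReal_le_ofReal h2
        rw [ENNReal.ofReal_mul (Real.rpow_nonneg (bracket_pos x).le _)] at h4
        refine (mul_le_mul_left h4 _).trans_eq ?_
        ring
    _ ≤ eLpNorm (fun x => bracket x ^ (-(γ / 2 + 1)) * p₁ x - bracket x ^ (-(γ / 2 + 1)) * p₂ x) 2
          volume * U := by
        rw [hU, eLpNorm_two_weightMeasure]
        exact lintegral_enorm_mul_le (m1.sub m2) (aestronglyMeasurable_weight_smul hv _)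
    _ ≤ (C₁ * (B * (U + N)) + C₂ * G) * U := by
        gcongr
        exact (eLpNorm_sub_le m1 m2 one_le_two).trans (add_le_add e1 e2)
    _ ≤ ((C₁ + C₂) * (B * (U + N)) + (C₁ + C₂) * G) * U := by
        gcongr
        · exact le_self_add
        · exact le_add_self
    _ = _ := by
        push_cast
        ring

/-! ### Integrability on the strip -/

theorem aemeasurable_eLpNorm_slice {E : Type*} [NormedAddCommGroup E] {T : ℝ}
    {f : ℝ → R3 → E} (hf : AEStronglyMeasurable (fun z : ℝ × R3 => f z.1 z.2) (stripMeasure T))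
    {p : ℝ≥0∞} (hp : p ≠ 0) (hp' : p ≠ ⊤) (δ : ℝ) :
    AEMeasurable (fun t => eLpNorm (f t) p (weightMeasure δ))
      ((volume : Measure ℝ).restrict (Ioo 0 T)) := by
  have e : ∀ t, eLpNorm (f t) p (weightMeasure δ)
      = (∫⁻ x, ENNReal.ofReal (weight δ x) * ‖f t x‖ₑ ^ p.toReal) ^ (1 / p.toReal) := fun t => by
    rw [eLpNorm_eq_lintegral_rpow_enorm_toReal hp hp', lintegral_weightMeasure]
  simp only [e]
  have h : AEMeasurable (fun z : ℝ × R3 => ENNReal.ofReal (weight δ z.2) * ‖f z.1 z.2‖ₑ ^ p.toReal)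
      (((volume : Measure ℝ).restrict (Ioo 0 T)).prod (volume : Measure R3)) :=
    ((measurable_ofReal_weight δ).comp measurable_snd).aemeasurable.mul (hf.enorm.pow_const _)
  exact h.lintegral_prod_right'.pow_const _

theorem ae_lt_top_of_eLpNorm_lt_top {α : Type*} [MeasurableSpace α] {μ : Measure α}
    {g : α → ℝ≥0∞} (hg : AEMeasurable g μ) {q : ℝ≥0∞} (hq : q ≠ 0) (h : eLpNorm g q μ < ⊤) :
    ∀ᵐ t ∂μ, g t < ⊤ := by
  by_cases hq' : q = ⊤
  · subst hq'
    rw [eLpNorm_exponent_top] at h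
    filter_upwards [ae_le_eLpNormEssSup (f := g) (μ := μ)] with t ht
    exact (ht.trans_lt h)
  · have hpos := ENNReal.toReal_pos hq hq'
    have h1 := lintegral_rpow_enorm_lt_top_of_eLpNorm_lt_top hq hq' h
    filter_upwards [ae_lt_top' (hg.enorm.pow_const q.toReal) h1.ne] with t ht
    exact (ENNReal.rpow_lt_top_iff_of_pos hpos).1 ht

theorem MemMixed.ae_memLp {E : Type*} [NormedAddCommGroup E] {T δ : ℝ} {q r : ℝ≥0∞}
    {f : ℝ → R3 → E} (h : MemMixed T q r δ f) (hq : q ≠ 0) (hr : r ≠ 0) (hr' : r ≠ ⊤) :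
    ∀ᵐ t ∂((volume : Measure ℝ).restrict (Ioo 0 T)), MemLp (f t) r (weightMeasure δ) := by
  have h1 := ae_lt_top_of_eLpNorm_lt_top (aemeasurable_eLpNorm_slice h.1 hr hr' δ) hq h.2
  have h2 : ∀ᵐ t ∂((volume : Measure ℝ).restrict (Ioo 0 T)),
      AEStronglyMeasurable (fun x => f t x) (volume : Measure R3) :=
    AEStronglyMeasurable.prodMk_left (f := fun z : ℝ × R3 => f z.1 z.2) h.1
  filter_upwards [h1, h2] with t ht ht'
  exact ⟨ht'.mono_ac (absolutelyContinuous_volume δ), ht⟩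

theorem locallyIntegrable_of_memLp_weightMeasure {f : R3 → ℝ} {p : ℝ≥0∞} {δ : ℝ} (hp : 1 ≤ p)
    (hp' : p ≠ ⊤) (h : MemLp f p (weightMeasure δ)) : LocallyIntegrable f volume := by
  have h1 : MemLp (fun x => weight (δ / p.toReal) x • f x) p volume := by
    refine ⟨aestronglyMeasurable_weight_smul (h.1.mono_ac (volume_absolutelyContinuous δ)) _, ?_⟩
    rw [← eLpNorm_weightMeasure f (zero_lt_one.trans_le hp).ne' hp']
    exact h.2
  have h2 := locallyIntegrable_continuous_smul (h1.locallyIntegrable hp)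
    ((continuous_weight (δ / p.toReal)).inv₀ fun x => (weight_pos _ x).ne')
  refine h2.congr (Eventually.of_forall fun x => ?_)
  have := (weight_pos (δ / p.toReal) x).ne'
  simp only [smul_eq_mul, Pi.inv_apply]
  field_simp

/-- The quantity controlling all the terms of the energy balance at a fixed time, in terms of
the weighted norms `U`, `N`, `B` and `G` of `u`, `∇u`, `b` and `F`. -/
noncomputable def sliceBound (U N B G : ℝ≥0∞) : ℝ≥0∞ :=
  U * N + U * (B * (U + N)) + (B * (U + N) + G) * U + G * N + G * U

theorem ENNReal.mul_le_sq_add_sq (x y : ℝ≥0∞) : x * y ≤ x ^ 2 + y ^ 2 := by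
  rcases le_total x y with h | h
  · exact (mul_le_mul_left h y).trans ((sq y).symm.le.trans le_add_self)
  · exact (mul_le_mul_right h x).trans ((sq x).symm.le.trans le_self_add)

theorem sliceBound_le (U N B G : ℝ≥0∞) :
    sliceBound U N B G ≤ 8 * (U ^ 2 + N ^ 2 + G ^ 2 + (B * U) ^ 2) := by
  have h1 := ENNReal.mul_le_sq_add_sq U N
  have h2 := ENNReal.mul_le_sq_add_sq (B * U) U
  have h3 := ENNReal.mul_le_sq_add_sq (B * U) N
  have h4 := ENNReal.mul_le_sq_add_sq G N
  have h5 := ENNReal.mul_le_sq_add_sq G U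
  calc sliceBound U N B G = U * N + 2 * (B * U * U) + 2 * (B * U * N) + G * N + 2 * (G * U) := by
        unfold sliceBound; ring
    _ ≤ (U ^ 2 + N ^ 2) + 2 * ((B * U) ^ 2 + U ^ 2) + 2 * ((B * U) ^ 2 + N ^ 2)
        + (G ^ 2 + N ^ 2) + 2 * (G ^ 2 + U ^ 2) := by gcongr
    _ = 5 * U ^ 2 + 4 * N ^ 2 + 3 * G ^ 2 + 4 * (B * U) ^ 2 := by ring
    _ ≤ 8 * U ^ 2 + 8 * N ^ 2 + 8 * G ^ 2 + 8 * (B * U) ^ 2 := by gcongr <;> norm_num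
    _ = _ := by ring

/-- The information available at almost every time `t`, with `v`, `b`, `D`, `F`, `p` the values at
time `t` of the velocity, the drift, the gradient, the forcing and the pressure. -/
structure SliceBounds (C : ℝ≥0) (γ : ℝ) (v b : R3 → R3) (D F : R3 → Tensor3) (p : R3 → ℝ) :
    Prop where
  memLp_v : MemLp v 2 (weightMeasure γ)
  memLp_D : MemLp D 2 (weightMeasure γ)
  memLp_F : MemLp F 2 (weightMeasure γ)
  memLp_b : MemLp b 3 (weightMeasure (3 * γ / 2))
  drift : ∫⁻ x, ENNReal.ofReal (weight (γ + 1) x) * (‖v x‖ₑ ^ 2 * ‖b x‖ₑ)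
    ≤ C * sliceBound (eLpNorm v 2 (weightMeasure γ)) (eLpNorm D 2 (weightMeasure γ))
      (eLpNorm b 3 (weightMeasure (3 * γ / 2))) (eLpNorm F 2 (weightMeasure γ))
  pressure : ∫⁻ x, ENNReal.ofReal (weight (γ + 1) x) * (‖p x‖ₑ * ‖v x‖ₑ)
    ≤ C * sliceBound (eLpNorm v 2 (weightMeasure γ)) (eLpNorm D 2 (weightMeasure γ))
      (eLpNorm b 3 (weightMeasure (3 * γ / 2))) (eLpNorm F 2 (weightMeasure γ))

theorem exists_ae_sliceBounds : ∃ C : ℝ≥0, ∀ (γ T : ℝ) (u₀ : R3 → R3)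
    (F : ℝ → R3 → Tensor3) (b u : ℝ → R3 → R3) (D : ℝ → R3 → Tensor3) (p : ℝ → R3 → ℝ),
    0 < γ → γ ≤ 2 → MemMixed T 2 2 γ F → MemMixed T 3 3 (3 * γ / 2) b →
    IsSolution γ T u₀ F b u D p →
    ∀ᵐ t ∂((volume : Measure ℝ).restrict (Ioo 0 T)),
      SliceBounds C γ (u t) (b t) (D t) (F t) (p t) := by
  obtain ⟨C₁, hC₁⟩ := exists_lintegral_drift_le
  obtain ⟨C₂, hC₂⟩ := exists_lintegral_pressure_le
  refine ⟨C₁ + C₂, fun γ T u₀ F b u D p hγ hγ' hF hb hs => ?_⟩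
  obtain ⟨p₁, p₂, hp₁, hp₂, hR₁, hR₂, hp⟩ := hs.pressure
  have h65 : (1 : ℝ≥0∞) ≤ 6 / 5 := by
    rw [ENNReal.le_div_iff_mul_le (by simp) (by simp)]; norm_num
  have h65' : (6 / 5 : ℝ≥0∞) ≠ ⊤ := ENNReal.div_ne_top (by simp) (by simp)
  filter_upwards [hs.isWeakJacobian, hs.memMixed.ae_memLp (by simp) two_ne_zero (by simp),
    hs.memMixed_grad.ae_memLp two_ne_zero two_ne_zero (by simp),
    hF.ae_memLp two_ne_zero two_ne_zero (by simp),
    hb.ae_memLp three_ne_zero three_ne_zero (by simp),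
    hp₁.ae_memLp three_ne_zero (zero_lt_one.trans_le h65).ne' h65',
    hp₂.ae_memLp two_ne_zero two_ne_zero (by simp), hR₁, hR₂, Measure.ae_ae_of_ae_prod hp]
    with t hj hu hD hF hb hp₁ hp₂ hR₁ hR₂ hp
  have hum := hu.1.mono_ac (volume_absolutelyContinuous _)
  have hbm := hb.1.mono_ac (volume_absolutelyContinuous _)
  have hFm := hF.1.mono_ac (volume_absolutelyContinuous _)
  refine ⟨hu, hD, hF, hb, (hC₁ γ _ _ _ hγ hγ' hj hum hbm).trans ?_,
    (hC₂ γ _ _ _ _ _ _ _ hγ hγ' hj hum hbm hFm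
      (locallyIntegrable_of_memLp_weightMeasure h65 h65' hp₁)
      (locallyIntegrable_of_memLp_weightMeasure one_le_two (by simp) hp₂) hR₁ hR₂ hp).trans ?_⟩
  · refine mul_le_mul' ?_ ?_
    · push_cast
      exact le_self_add
    · unfold sliceBound
      exact le_add_right (le_add_right (le_add_right le_add_self))
  · refine mul_le_mul' ?_ ?_
    · push_cast
      exact le_add_self
    · unfold sliceBound
      exact le_add_right (le_add_right le_add_self)

theorem lintegral_sq_lt_top {α : Type*} [MeasurableSpace α] {μ : Measure α} {g : α → ℝ≥0∞}
    (h : eLpNorm g 2 μ < ⊤) : ∫⁻ t, g t ^ 2 ∂μ < ⊤ := by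
  have h1 := lintegral_rpow_enorm_lt_top_of_eLpNorm_lt_top two_ne_zero (by simp) h
  simpa using h1

theorem lintegral_sq_lt_top_of_three {α : Type*} [MeasurableSpace α] {μ : Measure α}
    [IsFiniteMeasure μ] {g : α → ℝ≥0∞} (h : eLpNorm g 3 μ < ⊤) : ∫⁻ t, g t ^ 2 ∂μ < ⊤ := by
  have h1 := lintegral_rpow_enorm_lt_top_of_eLpNorm_lt_top three_ne_zero (by simp) h
  have h2 : ∀ x : ℝ≥0∞, x ^ 2 ≤ 1 + x ^ 3 := by
    intro x
    rcases le_total x 1 with h | h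
    · exact (pow_le_one' h 2).trans le_self_add
    · exact (pow_le_pow_right₀ h (by norm_num)).trans le_add_self
  refine (lintegral_mono fun t => h2 (g t)).trans_lt ?_
  rw [lintegral_add_left measurable_const]
  refine ENNReal.add_lt_top.2 ⟨by simp, ?_⟩
  simpa using h1

theorem lintegral_add_lt_top {α : Type*} [MeasurableSpace α] {μ : Measure α} {f g : α → ℝ≥0∞}
    (hm : AEMeasurable f μ) (hf : ∫⁻ t, f t ∂μ < ⊤) (hg : ∫⁻ t, g t ∂μ < ⊤) :
    ∫⁻ t, (f t + g t) ∂μ < ⊤ := by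
  rw [lintegral_add_left' hm]
  exact ENNReal.add_lt_top.2 ⟨hf, hg⟩

/-- The squares of the norms controlling `sliceBound` are integrable in time. For the product
`B U` this uses `b ∈ L³ ⊆ L²` in time, on a bounded interval, and `u ∈ L^∞` in time. -/
theorem lintegral_sq_terms_lt_top {γ T : ℝ} {u₀ : R3 → R3}
    {F : ℝ → R3 → Tensor3} {b u : ℝ → R3 → R3} {D : ℝ → R3 → Tensor3} {p : ℝ → R3 → ℝ}
    (hF : MemMixed T 2 2 γ F) (hb : MemMixed T 3 3 (3 * γ / 2) b)
    (hs : IsSolution γ T u₀ F b u D p) :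
    ∫⁻ t in Ioo 0 T, (eLpNorm (u t) 2 (weightMeasure γ) ^ 2
      + eLpNorm (D t) 2 (weightMeasure γ) ^ 2 + eLpNorm (F t) 2 (weightMeasure γ) ^ 2
      + (eLpNorm (b t) 3 (weightMeasure (3 * γ / 2)) * eLpNorm (u t) 2 (weightMeasure γ)) ^ 2)
      < ⊤ := by
  have hu := hs.memMixed.2
  have mu := aemeasurable_eLpNorm_slice hs.memMixed.1 two_ne_zero (by simp) γ
  have mD := aemeasurable_eLpNorm_slice hs.memMixed_grad.1 two_ne_zero (by simp) γ
  have mF := aemeasurable_eLpNorm_slice hF.1 two_ne_zero (by simp) γ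
  have mb := aemeasurable_eLpNorm_slice hb.1 three_ne_zero (by simp) (3 * γ / 2)
  rw [eLpNorm_exponent_top] at hu
  set K := eLpNormEssSup (fun t => eLpNorm (u t) 2 (weightMeasure γ))
    ((volume : Measure ℝ).restrict (Ioo 0 T)) with hK
  have hle : ∀ᵐ t ∂((volume : Measure ℝ).restrict (Ioo 0 T)),
      eLpNorm (u t) 2 (weightMeasure γ) ≤ K :=
    ae_le_eLpNormEssSup (f := fun t => eLpNorm (u t) 2 (weightMeasure γ))
  refine lintegral_add_lt_top (((mu.pow_const 2).add (mD.pow_const 2)).add (mF.pow_const 2))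
    (lintegral_add_lt_top ((mu.pow_const 2).add (mD.pow_const 2))
      (lintegral_add_lt_top (mu.pow_const 2) ?_ ?_) ?_) ?_
  · refine (lintegral_mono_ae (hle.mono fun t ht => pow_le_pow_left' ht 2)).trans_lt ?_
    rw [lintegral_const]
    exact ENNReal.mul_lt_top (ENNReal.pow_lt_top hu) (measure_lt_top _ _)
  · exact lintegral_sq_lt_top hs.memMixed_grad.2
  · exact lintegral_sq_lt_top hF.2
  · have h1 : ∀ᵐ t ∂((volume : Measure ℝ).restrict (Ioo 0 T)),
        (eLpNorm (b t) 3 (weightMeasure (3 * γ / 2)) * eLpNorm (u t) 2 (weightMeasure γ)) ^ 2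
          ≤ eLpNorm (b t) 3 (weightMeasure (3 * γ / 2)) ^ 2 * K ^ 2 :=
      hle.mono fun t ht => by
        rw [mul_pow]
        gcongr
    refine (lintegral_mono_ae h1).trans_lt ?_
    rw [lintegral_mul_const'' _ (mb.pow_const 2)]
    exact ENNReal.mul_lt_top (lintegral_sq_lt_top_of_three hb.2) (ENNReal.pow_lt_top hu)

/-- Tonelli's theorem, for a function whose `L¹` norm in space is bounded by an integrable function
of time. -/
theorem integrable_strip_of_slice_le {E : Type*} [NormedAddCommGroup E] {T : ℝ}
    {f : ℝ × R3 → E} (hf : AEStronglyMeasurable f (stripMeasure T)) {g : ℝ → ℝ≥0∞} {C : ℝ≥0}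
    (hg : ∫⁻ t in Ioo 0 T, g t < ⊤)
    (h : ∀ᵐ t ∂((volume : Measure ℝ).restrict (Ioo 0 T)), ∫⁻ x, ‖f (t, x)‖ₑ ≤ C * g t) :
    Integrable f (stripMeasure T) := by
  refine ⟨hf, ?_⟩
  rw [hasFiniteIntegral_iff_enorm, stripMeasure, lintegral_prod _ hf.enorm]
  refine (lintegral_mono_ae h).trans_lt ?_
  rw [lintegral_const_mul' _ _ ENNReal.coe_ne_top]
  exact ENNReal.mul_lt_top ENNReal.coe_lt_top hg

/-! ### The gradient of `|u|²` -/

/-- The gradient `2 ∑ j, v_j ∇v_j` of `|v|²`, in terms of the value `v` and the Jacobian `A`. -/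
noncomputable def sqGradVec (v : R3) (A : Tensor3) : R3 :=
  WithLp.toLp 2 fun i => ∑ j, 2 * v j * A (i, j)

theorem continuous_sqGradVec : Continuous fun q : R3 × Tensor3 => sqGradVec q.1 q.2 := by
  unfold sqGradVec
  fun_prop

theorem norm_sqGradVec_le (v : R3) (A : Tensor3) : ‖sqGradVec v A‖ ≤ 18 * (‖v‖ * ‖A‖) := by
  refine (norm_le_sum_norm_apply _).trans ?_
  have h : ∀ i j : Fin 3, ‖2 * v j * A (i, j)‖ ≤ 2 * (‖v‖ * ‖A‖) := by
    intro i j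
    rw [norm_mul, norm_mul, mul_assoc]
    have := mul_le_mul (PiLp.norm_apply_le v j) (PiLp.norm_apply_le A (i, j)) (norm_nonneg _)
      (norm_nonneg _)
    simpa using this
  calc ∑ i, ‖sqGradVec v A i‖ ≤ ∑ _i : Fin 3, ∑ _j : Fin 3, 2 * (‖v‖ * ‖A‖) := by
        refine Finset.sum_le_sum fun i _ => ?_
        exact (norm_sum_le Finset.univ fun j => 2 * v j * A (i, j)).trans
          (Finset.sum_le_sum fun j _ => h i j)
    _ = _ := by simp; ring

theorem memLp_weight_smul {E : Type*} [NormedAddCommGroup E] [NormedSpace ℝ E] {f : R3 → E}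
    {γ : ℝ} (hf : MemLp f 2 (weightMeasure γ)) :
    MemLp (fun x => weight (γ / 2) x • f x) 2 volume :=
  ⟨aestronglyMeasurable_weight_smul (hf.1.mono_ac (volume_absolutelyContinuous γ)) _, by
    rw [← eLpNorm_two_weightMeasure]; exact hf.2⟩

theorem IsWeakJacobian.isWeakGradient_sq {γ : ℝ} (hγ : 0 < γ) (hγ' : γ ≤ 2) {v : R3 → R3}
    {D : R3 → Tensor3} (h : IsWeakJacobian v D) (hv : MemLp v 2 (weightMeasure γ))
    (hD : MemLp D 2 (weightMeasure γ)) :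
    IsWeakGradient (fun x => ‖v x‖ ^ 2) fun x => sqGradVec (v x) (D x) := by
  have hj : ∀ j, IsWeakGradient (fun x => v x j ^ 2)
      fun x => (2 * v x j) • (WithLp.toLp 2 fun i => D x (i, j) : R3) := by
    intro j
    refine (h j).sq (s := γ / 2) (by linarith) (by linarith) ?_ ?_
    · refine (memLp_weight_smul hv).mono
        (aestronglyMeasurable_weight_smul (h j).1.aestronglyMeasurable _)
        (Eventually.of_forall fun x => ?_)
      rw [norm_mul, norm_smul]
      exact mul_le_mul_of_nonneg_left (PiLp.norm_apply_le _ _) (norm_nonneg _)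
    · refine (memLp_weight_smul hD).mono
        (aestronglyMeasurable_weight_smul (h j).2.1.aestronglyMeasurable _)
        (Eventually.of_forall fun x => ?_)
      rw [norm_smul, norm_smul]
      exact mul_le_mul_of_nonneg_left (norm_column_le _ _) (norm_nonneg _)
  convert ((hj 0).add (hj 1)).add (hj 2) using 2 with x x
  · rw [EuclideanSpace.real_norm_sq_eq, Fin.sum_univ_three]
  · ext i
    simp [sqGradVec, Fin.sum_univ_three]

/-! ### The terms of the energy balance -/

/-- Absolute integrability on the strip of the terms of the weighted energy balance. -/
structure StripIntegrable (γ T : ℝ) (F : ℝ → R3 → Tensor3) (b u : ℝ → R3 → R3)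
    (D : ℝ → R3 → Tensor3) (p : ℝ → R3 → ℝ) : Prop where
  meas_u : AEStronglyMeasurable (fun z : ℝ × R3 => u z.1 z.2) (stripMeasure T)
  meas_b : AEStronglyMeasurable (fun z : ℝ × R3 => b z.1 z.2) (stripMeasure T)
  meas_D : AEStronglyMeasurable (fun z : ℝ × R3 => D z.1 z.2) (stripMeasure T)
  meas_F : AEStronglyMeasurable (fun z : ℝ × R3 => F z.1 z.2) (stripMeasure T)
  meas_p : AEStronglyMeasurable (fun z : ℝ × R3 => p z.1 z.2) (stripMeasure T)
  uu : Integrable (fun z : ℝ × R3 => weight γ z.2 * (‖u z.1 z.2‖ * ‖u z.1 z.2‖)) (stripMeasure T)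
  DD : Integrable (fun z : ℝ × R3 => weight γ z.2 * (‖D z.1 z.2‖ * ‖D z.1 z.2‖)) (stripMeasure T)
  uD : Integrable (fun z : ℝ × R3 => weight γ z.2 * (‖u z.1 z.2‖ * ‖D z.1 z.2‖)) (stripMeasure T)
  FD : Integrable (fun z : ℝ × R3 => weight γ z.2 * (‖F z.1 z.2‖ * ‖D z.1 z.2‖)) (stripMeasure T)
  Fu : Integrable (fun z : ℝ × R3 => weight γ z.2 * (‖F z.1 z.2‖ * ‖u z.1 z.2‖)) (stripMeasure T)
  ub : Integrable (fun z : ℝ × R3 => weight (γ + 1) z.2 * (‖u z.1 z.2‖ ^ 2 * ‖b z.1 z.2‖))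
    (stripMeasure T)
  pu : Integrable (fun z : ℝ × R3 => weight (γ + 1) z.2 * (‖p z.1 z.2‖ * ‖u z.1 z.2‖))
    (stripMeasure T)

theorem IsSolution.stripIntegrable {γ T : ℝ} {u₀ : R3 → R3}
    {F : ℝ → R3 → Tensor3} {b u : ℝ → R3 → R3} {D : ℝ → R3 → Tensor3} {p : ℝ → R3 → ℝ}
    (hs : IsSolution γ T u₀ F b u D p) (hγ : 0 < γ) (hγ' : γ ≤ 2)
    (hF : MemMixed T 2 2 γ F) (hb : MemMixed T 3 3 (3 * γ / 2) b) :
    StripIntegrable γ T F b u D p := by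
  obtain ⟨C, hC⟩ := exists_ae_sliceBounds
  have hsl := hC γ T u₀ F b u D p hγ hγ' hF hb hs
  have hfin := lintegral_sq_terms_lt_top hF hb hs
  have mu := hs.memMixed.1
  have mD := hs.memMixed_grad.1
  have mp : AEStronglyMeasurable (fun z : ℝ × R3 => p z.1 z.2) (stripMeasure T) := by
    obtain ⟨p₁, p₂, hp₁, hp₂, -, -, hp⟩ := hs.pressure
    exact (hp₁.1.sub hp₂.1).congr (hp.mono fun z hz => hz.symm)
  have mw : ∀ δ, AEStronglyMeasurable (fun z : ℝ × R3 => weight δ z.2) (stripMeasure T) := fun δ =>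
    ((continuous_weight δ).comp continuous_snd).aestronglyMeasurable
  have hfac : ∀ δ x (r : ℝ), ‖weight δ x * r‖ₑ = ENNReal.ofReal (weight δ x) * ‖r‖ₑ :=
    fun δ x r => by rw [enorm_mul, enorm_weight]
  have two : ∀ x y : ℝ≥0∞, x * y ≤ (1 : ℝ≥0) * (x ^ 2 + y ^ 2) := fun x y => by
    simpa using ENNReal.mul_le_sq_add_sq x y
  have hq : ∀ {E E' : Type} [NormedAddCommGroup E] [NormedSpace ℝ E] [NormedAddCommGroup E']
      [NormedSpace ℝ E'] {f : R3 → E} {g : R3 → E'}, MemLp f 2 (weightMeasure γ) →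
      MemLp g 2 (weightMeasure γ) →
      ∫⁻ x, ‖weight γ x * (‖f x‖ * ‖g x‖)‖ₑ ≤ (1 : ℝ≥0) *
        (eLpNorm f 2 (weightMeasure γ) ^ 2 + eLpNorm g 2 (weightMeasure γ) ^ 2) := by
    intro E E' _ _ _ _ f g hf hg
    refine le_trans ?_ (two _ _)
    simp only [hfac, enorm_mul, enorm_norm]
    exact lintegral_weight_mul_le (hf.1.mono_ac (volume_absolutelyContinuous γ))
      (hg.1.mono_ac (volume_absolutelyContinuous γ)) γ
  have hdom : ∀ {x y : ℝ≥0∞} {Q : ℝ≥0∞}, x ≤ Q → y ≤ Q →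
      ((1 : ℝ≥0) : ℝ≥0∞) * (x + y) ≤ (2 : ℝ≥0) * Q := by
    intro x y Q hx hy
    rw [ENNReal.coe_one, one_mul, ENNReal.coe_ofNat, two_mul]
    exact add_le_add hx hy
  have hS : ∀ {x : ℝ≥0∞} {U N B G : ℝ≥0∞}, x ≤ C * sliceBound U N B G →
      x ≤ ((C * 8 : ℝ≥0) : ℝ≥0∞) * (U ^ 2 + N ^ 2 + G ^ 2 + (B * U) ^ 2) := by
    intro x U N B G h
    refine h.trans ((mul_le_mul_right (sliceBound_le U N B G) _).trans_eq ?_)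
    push_cast
    ring
  have a1 : ∀ x y z w : ℝ≥0∞, x ≤ x + y + z + w := fun x y z w => by
    rw [add_assoc, add_assoc]; exact le_self_add
  have a2 : ∀ x y z w : ℝ≥0∞, y ≤ x + y + z + w := fun x y z w =>
    le_add_right (le_add_right le_add_self)
  have a3 : ∀ x y z w : ℝ≥0∞, z ≤ x + y + z + w := fun x y z w => le_add_right le_add_self
  refine ⟨mu, hb.1, mD, hF.1, mp, ?_, ?_, ?_, ?_, ?_, ?_, ?_⟩
  · refine integrable_strip_of_slice_le ((mw γ).mul (mu.norm.mul mu.norm)) (C := 2) hfin ?_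
    filter_upwards [hsl] with t ht
    exact (hq ht.memLp_v ht.memLp_v).trans (hdom (a1 _ _ _ _) (a1 _ _ _ _))
  · refine integrable_strip_of_slice_le ((mw γ).mul (mD.norm.mul mD.norm)) (C := 2) hfin ?_
    filter_upwards [hsl] with t ht
    exact (hq ht.memLp_D ht.memLp_D).trans (hdom (a2 _ _ _ _) (a2 _ _ _ _))
  · refine integrable_strip_of_slice_le ((mw γ).mul (mu.norm.mul mD.norm)) (C := 2) hfin ?_
    filter_upwards [hsl] with t ht
    exact (hq ht.memLp_v ht.memLp_D).trans (hdom (a1 _ _ _ _) (a2 _ _ _ _))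
  · refine integrable_strip_of_slice_le ((mw γ).mul (hF.1.norm.mul mD.norm)) (C := 2)
      hfin ?_
    filter_upwards [hsl] with t ht
    exact (hq ht.memLp_F ht.memLp_D).trans (hdom (a3 _ _ _ _) (a2 _ _ _ _))
  · refine integrable_strip_of_slice_le ((mw γ).mul (hF.1.norm.mul mu.norm)) (C := 2)
      hfin ?_
    filter_upwards [hsl] with t ht
    exact (hq ht.memLp_F ht.memLp_v).trans (hdom (a3 _ _ _ _) (a1 _ _ _ _))
  · refine integrable_strip_of_slice_le ((mw _).mul ((mu.norm.pow 2).mul hb.1.norm)) (C := C * 8)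
      hfin ?_
    filter_upwards [hsl] with t ht
    simp only [hfac, enorm_mul, enorm_norm, enorm_pow]
    exact hS ht.drift
  · refine integrable_strip_of_slice_le ((mw _).mul (mp.norm.mul mu.norm)) (C := C * 8)
      hfin ?_
    filter_upwards [hsl] with t ht
    simp only [hfac, enorm_mul, enorm_norm]
    exact hS ht.pressure

/-- The density of the weighted energy balance of `|u|²`, with the weight `φ` and its gradient `ξ`;
it is linear in `(φ, ξ)`. -/
noncomputable def energyDensity (v b : R3) (A G : Tensor3) (q φ : ℝ) (ξ : R3) : ℝ :=
  -inner ℝ (sqGradVec v A) ξ - 2 * (‖A‖ ^ 2 * φ) + ‖v‖ ^ 2 * inner ℝ b ξ + 2 * (q * inner ℝ v ξ)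
    - 2 * ∑ i, ∑ j, (G (i, j) * A (i, j) * φ + G (i, j) * v j * ξ i)

theorem energyDensity_smul (v b : R3) (A G : Tensor3) (q φ : ℝ) (ξ : R3) (a : ℝ) :
    energyDensity v b A G q (a * φ) (a • ξ) = a * energyDensity v b A G q φ ξ := by
  simp only [energyDensity, inner_smul_right, PiLp.smul_apply, smul_eq_mul, mul_add, mul_sub,
    Finset.mul_sum]
  congr 1
  · ring
  · refine Finset.sum_congr rfl fun i _ => Finset.sum_congr rfl fun j _ => ?_
    ring

theorem tendsto_energyDensity_apply (v b : R3) (A G : Tensor3) (q : ℝ) {Φ : ℕ → ℝ}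
    {Ξ : ℕ → R3} {φ : ℝ} {ξ : R3} (h₁ : Tendsto Φ atTop (𝓝 φ)) (h₂ : Tendsto Ξ atTop (𝓝 ξ)) :
    Tendsto (fun n => energyDensity v b A G q (Φ n) (Ξ n)) atTop
      (𝓝 (energyDensity v b A G q φ ξ)) := by
  have hin : ∀ a : R3, Tendsto (fun n => inner ℝ a (Ξ n)) atTop (𝓝 (inner ℝ a ξ)) := fun a =>
    tendsto_const_nhds.inner h₂
  have hco : ∀ i, Tendsto (fun n => Ξ n i) atTop (𝓝 (ξ i)) := fun i =>
    ((EuclideanSpace.proj (𝕜 := ℝ) i).continuous.tendsto ξ).comp h₂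
  unfold energyDensity
  exact ((((hin _).neg.sub ((h₁.const_mul _).const_mul 2)).add ((hin b).const_mul _)).add
    (((hin v).const_mul q).const_mul 2)).sub ((tendsto_finsetSum _ fun i _ =>
      tendsto_finsetSum _ fun j _ => (h₁.const_mul _).add ((hco i).const_mul _)).const_mul 2)

/-- Pointwise bounds of the terms of the energy balance when `φ` is bounded by the weight `w` and
`ξ` by the smaller weight `w'`. -/
theorem abs_terms_le {v b : R3} {A G : Tensor3} {q φ : ℝ} {ξ : R3} {w w' : ℝ} (hφ : |φ| ≤ w)
    (hξ : ‖ξ‖ ≤ w') (hw : w' ≤ w) :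
    |inner ℝ (sqGradVec v A) ξ| ≤ 18 * (w * (‖v‖ * ‖A‖)) ∧
    |‖A‖ ^ 2 * φ| ≤ w * (‖A‖ * ‖A‖) ∧ |‖v‖ ^ 2 * inner ℝ b ξ| ≤ w' * (‖v‖ ^ 2 * ‖b‖) ∧
    |q * inner ℝ v ξ| ≤ w' * (‖q‖ * ‖v‖) ∧
    ∀ i j, |G (i, j) * A (i, j) * φ + G (i, j) * v j * ξ i|
      ≤ w * (‖G‖ * ‖A‖) + w * (‖G‖ * ‖v‖) := by
  have hw' : 0 ≤ w' := (norm_nonneg ξ).trans hξ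
  have hin : ∀ a : R3, |inner ℝ a ξ| ≤ ‖a‖ * w' := fun a =>
    (abs_real_inner_le_norm a ξ).trans (mul_le_mul_of_nonneg_left hξ (norm_nonneg a))
  refine ⟨?_, ?_, ?_, ?_, fun i j => ?_⟩
  · refine (hin _).trans ?_
    calc ‖sqGradVec v A‖ * w' ≤ (18 * (‖v‖ * ‖A‖)) * w :=
          mul_le_mul (norm_sqGradVec_le v A) hw hw' (by positivity)
      _ = _ := by ring
  · rw [abs_mul, abs_of_nonneg (by positivity : 0 ≤ ‖A‖ ^ 2)]
    nlinarith [mul_le_mul_of_nonneg_left hφ (by positivity : 0 ≤ ‖A‖ ^ 2)]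
  · rw [abs_mul, abs_of_nonneg (by positivity : 0 ≤ ‖v‖ ^ 2)]
    nlinarith [mul_le_mul_of_nonneg_left (hin b) (by positivity : 0 ≤ ‖v‖ ^ 2)]
  · rw [abs_mul, ← Real.norm_eq_abs q]
    nlinarith [mul_le_mul_of_nonneg_left (hin v) (norm_nonneg q)]
  · have h1 : |G (i, j)| ≤ ‖G‖ := PiLp.norm_apply_le G (i, j)
    have h2 : |A (i, j)| ≤ ‖A‖ := PiLp.norm_apply_le A (i, j)
    have h3 : |v j| ≤ ‖v‖ := PiLp.norm_apply_le v j
    have h4 : |ξ i| ≤ w := ((PiLp.norm_apply_le ξ i).trans hξ).trans hw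
    refine (abs_add_le _ _).trans (add_le_add ?_ ?_)
    · rw [abs_mul, abs_mul, mul_comm w]
      exact mul_le_mul (mul_le_mul h1 h2 (abs_nonneg _) (norm_nonneg _)) hφ (abs_nonneg _)
        (by positivity)
    · rw [abs_mul, abs_mul, mul_comm w]
      exact mul_le_mul (mul_le_mul h1 h3 (abs_nonneg _) (norm_nonneg _)) h4 (abs_nonneg _)
        (by positivity)

theorem abs_energyDensity_le {v b : R3} {A G : Tensor3} {q φ : ℝ} {ξ : R3} {w w' : ℝ}
    (hφ : |φ| ≤ w) (hξ : ‖ξ‖ ≤ w') (hw : w' ≤ w) :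
    |energyDensity v b A G q φ ξ| ≤ 18 * (w * (‖v‖ * ‖A‖)) + 2 * (w * (‖A‖ * ‖A‖))
      + w' * (‖v‖ ^ 2 * ‖b‖) + 2 * (w' * (‖q‖ * ‖v‖))
      + 18 * (w * (‖G‖ * ‖A‖) + w * (‖G‖ * ‖v‖)) := by
  obtain ⟨h1, h2, h3, h4, h5⟩ := abs_terms_le (v := v) (b := b) (A := A) (G := G) (q := q) hφ hξ hw
  have h6 : |∑ i, ∑ j, (G (i, j) * A (i, j) * φ + G (i, j) * v j * ξ i)|
      ≤ 9 * (w * (‖G‖ * ‖A‖) + w * (‖G‖ * ‖v‖)) := by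
    calc _ ≤ ∑ i : Fin 3, ∑ j : Fin 3, (w * (‖G‖ * ‖A‖) + w * (‖G‖ * ‖v‖)) :=
          (Finset.abs_sum_le_sum_abs _ _).trans (Finset.sum_le_sum fun i _ =>
            (Finset.abs_sum_le_sum_abs _ _).trans (Finset.sum_le_sum fun j _ => h5 i j))
      _ = _ := by
          simp only [Finset.sum_const, Finset.card_univ, Fintype.card_fin, nsmul_eq_mul]
          push_cast
          ring
  unfold energyDensity
  rw [abs_le] at *
  constructor <;> linarith [h1.1, h1.2, h2.1, h2.2, h3.1, h3.2, h4.1, h4.2, h6.1, h6.2]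

section

variable {γ T : ℝ} {F : ℝ → R3 → Tensor3} {b u : ℝ → R3 → R3} {D : ℝ → R3 → Tensor3}
  {p : ℝ → R3 → ℝ}

/-- Integrability of the terms of the energy balance for a function `Φ` bounded by the weight, and
a field `Ξ` bounded like the gradient of the weight. -/
theorem StripIntegrable.terms (h : StripIntegrable γ T F b u D p) {Φ : ℝ × R3 → ℝ}
    {Ξ : ℝ × R3 → R3} {K : ℝ} (mΦ : AEStronglyMeasurable Φ (stripMeasure T))
    (mΞ : AEStronglyMeasurable Ξ (stripMeasure T))
    (hΦ : ∀ᵐ z ∂(stripMeasure T), |Φ z| ≤ K * weight γ z.2)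
    (hΞ : ∀ᵐ z ∂(stripMeasure T), ‖Ξ z‖ ≤ K * weight (γ + 1) z.2) :
    Integrable (fun z => ‖u z.1 z.2‖ ^ 2 * Φ z) (stripMeasure T) ∧
    Integrable (fun z => inner ℝ (sqGradVec (u z.1 z.2) (D z.1 z.2)) (Ξ z)) (stripMeasure T) ∧
    Integrable (fun z => ‖D z.1 z.2‖ ^ 2 * Φ z) (stripMeasure T) ∧
    Integrable (fun z => ‖u z.1 z.2‖ ^ 2 * inner ℝ (b z.1 z.2) (Ξ z)) (stripMeasure T) ∧
    Integrable (fun z => p z.1 z.2 * inner ℝ (u z.1 z.2) (Ξ z)) (stripMeasure T) ∧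
    ∀ i j, Integrable (fun z => F z.1 z.2 (i, j) * D z.1 z.2 (i, j) * Φ z
      + F z.1 z.2 (i, j) * u z.1 z.2 j * Ξ z i) (stripMeasure T) := by
  have co : ∀ {f : ℝ × R3 → R3}, AEStronglyMeasurable f (stripMeasure T) → ∀ i,
      AEStronglyMeasurable (fun z => f z i) (stripMeasure T) := fun hf i =>
    (EuclideanSpace.proj (𝕜 := ℝ) i).continuous.comp_aestronglyMeasurable hf
  have co' : ∀ {f : ℝ × R3 → Tensor3}, AEStronglyMeasurable f (stripMeasure T) → ∀ i,
      AEStronglyMeasurable (fun z => f z i) (stripMeasure T) := fun hf i =>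
    (EuclideanSpace.proj (𝕜 := ℝ) i).continuous.comp_aestronglyMeasurable hf
  have key : ∀ᵐ z ∂(stripMeasure T), |Φ z| ≤ K * weight γ z.2 ∧
      ‖Ξ z‖ ≤ K * weight (γ + 1) z.2 ∧ K * weight (γ + 1) z.2 ≤ K * weight γ z.2 := by
    filter_upwards [hΦ, hΞ] with z h1 h2
    have hK : 0 ≤ K := by
      have := (abs_nonneg _).trans h1
      exact nonneg_of_mul_nonneg_left this (weight_pos γ z.2)
    exact ⟨h1, h2, mul_le_mul_of_nonneg_left (weight_anti (by linarith) _) hK⟩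
  have mV : AEStronglyMeasurable (fun z : ℝ × R3 => sqGradVec (u z.1 z.2) (D z.1 z.2))
      (stripMeasure T) :=
    continuous_sqGradVec.comp_aestronglyMeasurable (h.meas_u.prodMk h.meas_D)
  refine ⟨?_, ?_, ?_, ?_, ?_, fun i j => ?_⟩
  · refine (h.uu.const_mul K).mono' ((h.meas_u.norm.pow 2).mul mΦ) ?_
    filter_upwards [hΦ] with z h1
    rw [Real.norm_eq_abs, abs_mul, abs_of_nonneg (by positivity)]
    nlinarith [mul_le_mul_of_nonneg_left h1 (by positivity : 0 ≤ ‖u z.1 z.2‖ ^ 2)]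
  · refine (h.uD.const_mul (18 * K)).mono' (mV.inner mΞ) ?_
    filter_upwards [key] with z ⟨h1, h2, h3⟩
    refine (abs_terms_le (v := u z.1 z.2) (b := 0) (A := D z.1 z.2) (G := 0) (q := 0)
      h1 h2 h3).1.trans_eq ?_
    ring
  · refine (h.DD.const_mul K).mono' ((h.meas_D.norm.pow 2).mul mΦ) ?_
    filter_upwards [key] with z ⟨h1, h2, h3⟩
    refine (abs_terms_le (v := 0) (b := 0) (A := D z.1 z.2) (G := 0) (q := 0)
      h1 h2 h3).2.1.trans_eq ?_
    ring
  · refine (h.ub.const_mul K).mono' ((h.meas_u.norm.pow 2).mul (h.meas_b.inner mΞ)) ?_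
    filter_upwards [key] with z ⟨h1, h2, h3⟩
    refine (abs_terms_le (v := u z.1 z.2) (b := b z.1 z.2) (A := 0) (G := 0) (q := 0)
      h1 h2 h3).2.2.1.trans_eq ?_
    ring
  · refine (h.pu.const_mul K).mono' (h.meas_p.mul (h.meas_u.inner mΞ)) ?_
    filter_upwards [key] with z ⟨h1, h2, h3⟩
    refine (abs_terms_le (v := u z.1 z.2) (b := 0) (A := 0) (G := 0) (q := p z.1 z.2)
      h1 h2 h3).2.2.2.1.trans_eq ?_
    ring
  · refine ((h.FD.const_mul K).add (h.Fu.const_mul K)).mono'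
      ((((co' h.meas_F _).mul (co' h.meas_D _)).mul mΦ).add
        (((co' h.meas_F _).mul (co h.meas_u _)).mul (co mΞ _))) ?_
    filter_upwards [key] with z ⟨h1, h2, h3⟩
    refine ((abs_terms_le (v := u z.1 z.2) (b := 0) (A := D z.1 z.2) (G := F z.1 z.2) (q := 0)
      h1 h2 h3).2.2.2.2 i j).trans_eq ?_
    simp only [Pi.add_apply]
    ring

theorem StripIntegrable.integrable_energyDensity (h : StripIntegrable γ T F b u D p)
    {Φ : ℝ × R3 → ℝ} {Ξ : ℝ × R3 → R3} {K : ℝ} (mΦ : AEStronglyMeasurable Φ (stripMeasure T))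
    (mΞ : AEStronglyMeasurable Ξ (stripMeasure T))
    (hΦ : ∀ᵐ z ∂(stripMeasure T), |Φ z| ≤ K * weight γ z.2)
    (hΞ : ∀ᵐ z ∂(stripMeasure T), ‖Ξ z‖ ≤ K * weight (γ + 1) z.2) :
    Integrable (fun z => energyDensity (u z.1 z.2) (b z.1 z.2) (D z.1 z.2) (F z.1 z.2) (p z.1 z.2)
      (Φ z) (Ξ z)) (stripMeasure T) := by
  obtain ⟨-, h1, h2, h3, h4, h5⟩ := h.terms mΦ mΞ hΦ hΞ
  unfold energyDensity
  exact (((h1.neg.sub (h2.const_mul 2)).add h3).add (h4.const_mul 2)).sub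
    ((integrable_finsetSum _ fun i _ => integrable_finsetSum _ fun j _ => h5 i j).const_mul 2)

theorem StripIntegrable.tendsto_energyDensity (h : StripIntegrable γ T F b u D p)
    {Φ : ℕ → ℝ × R3 → ℝ} {Ξ : ℕ → ℝ × R3 → R3} {Φ' : ℝ × R3 → ℝ} {Ξ' : ℝ × R3 → R3} {K : ℝ}
    (mΦ : ∀ n, AEStronglyMeasurable (Φ n) (stripMeasure T))
    (mΞ : ∀ n, AEStronglyMeasurable (Ξ n) (stripMeasure T))
    (hΦ : ∀ n, ∀ᵐ z ∂(stripMeasure T), |Φ n z| ≤ K * weight γ z.2)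
    (hΞ : ∀ n, ∀ᵐ z ∂(stripMeasure T), ‖Ξ n z‖ ≤ K * weight (γ + 1) z.2)
    (lΦ : ∀ᵐ z ∂(stripMeasure T), Tendsto (fun n => Φ n z) atTop (𝓝 (Φ' z)))
    (lΞ : ∀ᵐ z ∂(stripMeasure T), Tendsto (fun n => Ξ n z) atTop (𝓝 (Ξ' z))) :
    Tendsto (fun n => ∫ z, energyDensity (u z.1 z.2) (b z.1 z.2) (D z.1 z.2) (F z.1 z.2)
      (p z.1 z.2) (Φ n z) (Ξ n z) ∂(stripMeasure T)) atTop
      (𝓝 (∫ z, energyDensity (u z.1 z.2) (b z.1 z.2) (D z.1 z.2) (F z.1 z.2)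
      (p z.1 z.2) (Φ' z) (Ξ' z) ∂(stripMeasure T))) := by
  refine tendsto_integral_of_dominated_convergence (fun z : ℝ × R3 => K * (
    18 * (weight γ z.2 * (‖u z.1 z.2‖ * ‖D z.1 z.2‖))
      + 2 * (weight γ z.2 * (‖D z.1 z.2‖ * ‖D z.1 z.2‖))
      + weight (γ + 1) z.2 * (‖u z.1 z.2‖ ^ 2 * ‖b z.1 z.2‖)
      + 2 * (weight (γ + 1) z.2 * (‖p z.1 z.2‖ * ‖u z.1 z.2‖))
      + 18 * (weight γ z.2 * (‖F z.1 z.2‖ * ‖D z.1 z.2‖)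
        + weight γ z.2 * (‖F z.1 z.2‖ * ‖u z.1 z.2‖))))
    (fun n => (h.integrable_energyDensity (mΦ n) (mΞ n) (hΦ n) (hΞ n)).1) ?_ (fun n => ?_) ?_
  · have s := (((((h.uD.const_mul 18).add (h.DD.const_mul 2)).add h.ub).add
      (h.pu.const_mul 2)).add ((h.FD.add h.Fu).const_mul 18)).const_mul K
    refine s.congr (Eventually.of_forall fun z => ?_)
    simp only [Pi.add_apply]
  · filter_upwards [hΦ n, hΞ n] with z h1 h2
    have hK : 0 ≤ K := by
      have := (abs_nonneg _).trans h1
      exact nonneg_of_mul_nonneg_left this (weight_pos γ z.2)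
    refine (abs_energyDensity_le h1 h2
      (mul_le_mul_of_nonneg_left (weight_anti (by linarith) _) hK)).trans_eq ?_
    ring
  · filter_upwards [lΦ, lΞ] with z h1 h2
    exact tendsto_energyDensity_apply _ _ _ _ _ h1 h2

end

/-! ### The energy inequality against product test functions -/

theorem laplacian_eq_sum {Φ : R3 → ℝ} (hΦ : ContDiff ℝ ∞ Φ) (x : R3) :
    Laplacian.laplacian Φ x = ∑ i, gradient (fun y => gradient Φ y i) x i := by
  rw [InnerProductSpace.laplacian_eq_iteratedFDeriv_orthonormalBasis Φ
    (EuclideanSpace.basisFun (Fin 3) ℝ)]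
  refine Finset.sum_congr rfl fun i _ => ?_
  rw [iteratedFDeriv_two_apply, gradient_apply]
  have h : (fun y => gradient Φ y i) = fun y => fderiv ℝ Φ y (EuclideanSpace.single i 1) := by
    ext y
    rw [gradient_apply]
  have hd : DifferentiableAt ℝ (fderiv ℝ Φ) x :=
    (hΦ.fderiv_right (m := ∞) (by simp)).differentiable (by simp) x
  rw [h, fderiv_clm_apply hd (differentiableAt_const _)]
  simp

/-- Integration by parts of the Laplacian against a weak gradient. -/
theorem IsWeakGradient.integral_mul_laplacian {f : R3 → ℝ} {V : R3 → R3} (h : IsWeakGradient f V)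
    {Φ : R3 → ℝ} (hΦ : IsTest Φ) :
    ∫ x, f x * Laplacian.laplacian Φ x = -∫ x, inner ℝ (V x) (gradient Φ x) := by
  have h1 : ∀ x, f x * Laplacian.laplacian Φ x
      = ∑ i, f x * gradient (fun y => gradient Φ y i) x i := fun x => by
    rw [laplacian_eq_sum hΦ.1, Finset.mul_sum]
  have h2 : ∀ x, inner ℝ (V x) (gradient Φ x) = ∑ i, V x i * gradient Φ x i := fun x => by
    rw [PiLp.inner_apply]
    simp [mul_comm]
  simp only [h1, h2]
  rw [integral_finsetSum _ fun i _ =>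
      LocallyIntegrable.integrable_mul_isTest h.1 ((hΦ.gradient_apply i).gradient_apply i),
    integral_finsetSum _ fun i _ =>
      LocallyIntegrable.integrable_mul_isTest (locallyIntegrable_apply h.2.1 i)
        (hΦ.gradient_apply i), ← Finset.sum_neg_distrib]
  exact Finset.sum_congr rfl fun i _ => h.2.2 _ (hΦ.gradient_apply i) i

theorem integral_energy_comb {X : Type*} [MeasurableSpace X] {μ : Measure X}
    {f₁ f₂ f₃ f₄ f₅ : X → ℝ} (h₁ : Integrable f₁ μ) (h₂ : Integrable f₂ μ) (h₃ : Integrable f₃ μ)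
    (h₄ : Integrable f₄ μ) (h₅ : Integrable f₅ μ) :
    ∫ x, (-f₁ x - 2 * f₂ x + f₃ x + 2 * f₄ x - 2 * f₅ x) ∂μ
      = -(∫ x, f₁ x ∂μ) - 2 * (∫ x, f₂ x ∂μ) + (∫ x, f₃ x ∂μ) + 2 * (∫ x, f₄ x ∂μ)
        - 2 * ∫ x, f₅ x ∂μ := by
  have e : (fun x => -f₁ x - 2 * f₂ x + f₃ x + 2 * f₄ x - 2 * f₅ x)
      = -f₁ - (2 : ℝ) • f₂ + f₃ + (2 : ℝ) • f₄ - (2 : ℝ) • f₅ := by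
    ext x
    simp
  rw [e, integral_sub' (((h₁.neg.sub (h₂.smul 2)).add h₃).add (h₄.smul 2)) (h₅.smul 2),
    integral_add' ((h₁.neg.sub (h₂.smul 2)).add h₃) (h₄.smul 2),
    integral_add' (h₁.neg.sub (h₂.smul 2)) h₃, integral_sub' h₁.neg (h₂.smul 2), integral_neg']
  simp only [Pi.smul_apply, smul_eq_mul, integral_const_mul]

theorem exists_norm_le_weight {E : Type*} [NormedAddCommGroup E] [NormedSpace ℝ E] {g : R3 → E}
    (hg : Continuous g) (hc : HasCompactSupport g) (δ : ℝ) :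
    ∃ K : ℝ, 0 ≤ K ∧ ∀ x, ‖g x‖ ≤ K * weight δ x := by
  have hw : Continuous fun x => (weight δ x)⁻¹ :=
    (continuous_weight δ).inv₀ fun x => (weight_pos δ x).ne'
  obtain ⟨K, hK⟩ := (hc.smul_left (f := fun x => (weight δ x)⁻¹)).exists_bound_of_continuous
    (hw.smul hg)
  refine ⟨K, (norm_nonneg _).trans (hK 0), fun x => ?_⟩
  have h := hK x
  have hp := weight_pos δ x
  rw [Pi.smul_apply', norm_smul, norm_inv, Real.norm_of_nonneg hp.le, inv_mul_le_iff₀ hp] at h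
  linarith

theorem isStripTest_mul {T : ℝ} {α : ℝ → ℝ} (hα : ContDiff ℝ ∞ α) (hαc : HasCompactSupport α)
    (hαs : tsupport α ⊆ Ioo 0 T) {Φ : R3 → ℝ} (hΦ : IsTest Φ) :
    IsStripTest T fun z => α z.1 * Φ z.2 := by
  have hsub : Function.support (fun z : ℝ × R3 => α z.1 * Φ z.2) ⊆ tsupport α ×ˢ tsupport Φ := by
    intro z hz
    exact ⟨subset_tsupport _ (left_ne_zero_of_mul hz), subset_tsupport _ (right_ne_zero_of_mul hz)⟩
  have hts : tsupport (fun z : ℝ × R3 => α z.1 * Φ z.2) ⊆ tsupport α ×ˢ tsupport Φ :=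
    closure_minimal hsub ((isClosed_tsupport _).prod (isClosed_tsupport _))
  refine ⟨(hα.comp contDiff_fst).mul (hΦ.1.comp contDiff_snd), ?_, ?_⟩
  · exact (hαc.isCompact.prod hΦ.2.isCompact).of_isClosed_subset (isClosed_tsupport _) hts
  · exact hts.trans (prod_mono hαs (subset_univ _))

section

variable {γ T : ℝ} {F : ℝ → R3 → Tensor3} {b u : ℝ → R3 → R3} {D : ℝ → R3 → Tensor3}
  {p : ℝ → R3 → ℝ}

/-- The energy balance tested against `α(t) Φ(x)`. The Laplacian has been replaced by first
derivatives, so that only the gradient of `Φ` occurs, and the measure has been dropped. -/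
theorem StripIntegrable.energy_test (h : StripIntegrable γ T F b u D p)
    (hV : ∀ᵐ t ∂((volume : Measure ℝ).restrict (Ioo 0 T)),
      IsWeakGradient (fun x => ‖u t x‖ ^ 2) fun x => sqGradVec (u t x) (D t x))
    (hbal : LocalEnergyBalance T b u D F p) {α : ℝ → ℝ} (hα : ContDiff ℝ ∞ α)
    (hαc : HasCompactSupport α) (hαs : tsupport α ⊆ Ioo 0 T) (hα0 : ∀ t, 0 ≤ α t) {Φ : R3 → ℝ}
    (hΦ : IsTest Φ) (hΦ0 : ∀ x, 0 ≤ Φ x) :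
    -∫ z, ‖u z.1 z.2‖ ^ 2 * (deriv α z.1 * Φ z.2) ∂(stripMeasure T)
      ≤ ∫ z, energyDensity (u z.1 z.2) (b z.1 z.2) (D z.1 z.2) (F z.1 z.2) (p z.1 z.2)
        (α z.1 * Φ z.2) (α z.1 • gradient Φ z.2) ∂(stripMeasure T) := by
  obtain ⟨μ, -, hbal⟩ := hbal
  have hb := hbal _ (isStripTest_mul hα hαc hαs hΦ)
  have ht : ∀ z : ℝ × R3, timeDeriv (fun z => α z.1 * Φ z.2) z = deriv α z.1 * Φ z.2 := fun z =>
    deriv_mul_const_field (u := α) (x := z.1) (Φ z.2)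
  have hg : ∀ z : ℝ × R3, spaceGrad (fun z => α z.1 * Φ z.2) z = α z.1 • gradient Φ z.2 := by
    intro z
    have h1 := gradient_mul (f := fun _ => α z.1) (g := Φ) (x := z.2) (differentiableAt_const _)
      (hΦ.1.differentiable (by simp) z.2)
    have h2 : gradient (fun _ : R3 => α z.1) z.2 = 0 := by simp [gradient]
    rw [spaceGrad, h1, h2, smul_zero, add_zero]
  have hl : ∀ z : ℝ × R3, spaceLaplacian (fun z => α z.1 * Φ z.2) z
      = α z.1 * Laplacian.laplacian Φ z.2 := by
    intro z
    change Laplacian.laplacian (fun y => α z.1 * Φ y) z.2 = _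
    rw [laplacian_eq_sum (contDiff_const.mul hΦ.1), laplacian_eq_sum hΦ.1, Finset.mul_sum]
    refine Finset.sum_congr rfl fun i _ => ?_
    have h1 : ∀ {f : R3 → ℝ} (y : R3), ContDiff ℝ ∞ f →
        gradient (fun x => α z.1 * f x) y = α z.1 • gradient f y := by
      intro f y hf
      have h1 := gradient_mul (f := fun _ => α z.1) (g := f) (x := y) (differentiableAt_const _)
        (hf.differentiable (by simp) y)
      have h2 : gradient (fun _ : R3 => α z.1) y = 0 := by simp [gradient]
      rw [h1, h2, smul_zero, add_zero]
    simp only [h1 _ hΦ.1, PiLp.smul_apply, smul_eq_mul]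
    rw [h1 _ (contDiff_gradient_apply hΦ.1 i)]
    simp
  simp only [ht, hg, hl] at hb
  obtain ⟨A, hA⟩ := hαc.exists_bound_of_continuous hα.continuous
  have hA0 : 0 ≤ A := (norm_nonneg _).trans (hA 0)
  have hLc : IsTest (Laplacian.laplacian Φ) := by
    have e : Laplacian.laplacian Φ = fun x => ∑ i, gradient (fun y => gradient Φ y i) x i :=
      funext fun x => laplacian_eq_sum hΦ.1 x
    rw [e]
    refine ⟨ContDiff.sum fun i _ => ((hΦ.gradient_apply i).gradient_apply i).1, ?_⟩
    have : (fun x => ∑ i, gradient (fun y => gradient Φ y i) x i)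
        = (fun x => gradient (fun y => gradient Φ y 0) x 0)
          + (fun x => gradient (fun y => gradient Φ y 1) x 1)
          + fun x => gradient (fun y => gradient Φ y 2) x 2 := by
      ext x
      simp [Fin.sum_univ_three]
    rw [this]
    exact (((hΦ.gradient_apply 0).gradient_apply 0).2.add
      ((hΦ.gradient_apply 1).gradient_apply 1).2).add ((hΦ.gradient_apply 2).gradient_apply 2).2
  obtain ⟨K₁, hK₁, hΦw⟩ := exists_norm_le_weight hΦ.1.continuous hΦ.2 γ
  obtain ⟨K₂, hK₂, hGw⟩ := exists_norm_le_weight (contDiff_gradient hΦ.1).continuous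
    (hasCompactSupport_gradient hΦ.2) (γ + 1)
  obtain ⟨K₃, hK₃, hLw⟩ := exists_norm_le_weight hLc.1.continuous hLc.2 γ
  have bd : ∀ {a c k K w : ℝ}, a ≤ A → 0 ≤ c → c ≤ k * w → 0 ≤ w → k ≤ K → a * c ≤ A * K * w := by
    intro a c k K w ha hc hck hw hkK
    calc a * c ≤ A * (k * w) := mul_le_mul ha hck hc hA0
      _ ≤ A * (K * w) := by gcongr
      _ = _ := by ring
  have mα : AEStronglyMeasurable (fun z : ℝ × R3 => α z.1) (stripMeasure T) :=
    (hα.continuous.comp continuous_fst).aestronglyMeasurable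
  have mX : ∀ {g : R3 → ℝ}, Continuous g →
      AEStronglyMeasurable (fun z : ℝ × R3 => g z.2) (stripMeasure T) := fun hg =>
    (hg.comp continuous_snd).aestronglyMeasurable
  have mG : AEStronglyMeasurable (fun z : ℝ × R3 => gradient Φ z.2) (stripMeasure T) :=
    ((contDiff_gradient hΦ.1).continuous.comp continuous_snd).aestronglyMeasurable
  obtain ⟨-, i1, i2, i3, i4, i5⟩ := h.terms (Φ := fun z => α z.1 * Φ z.2)
    (Ξ := fun z => α z.1 • gradient Φ z.2) (K := A * (K₁ + K₂)) (mα.mul (mX hΦ.1.continuous))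
    (mα.smul mG)
    (Eventually.of_forall fun z => by
      rw [abs_mul]
      exact bd (hA _) (abs_nonneg _) (hΦw _) (weight_nonneg _ _) (by linarith))
    (Eventually.of_forall fun z => by
      rw [norm_smul]
      exact bd (hA _) (norm_nonneg _) (hGw _) (weight_nonneg _ _) (by linarith))
  obtain ⟨iL, -⟩ := h.terms (Φ := fun z => α z.1 * Laplacian.laplacian Φ z.2)
    (Ξ := fun _ => 0) (K := A * K₃) (mα.mul (mX hLc.1.continuous))
    aestronglyMeasurable_const
    (Eventually.of_forall fun z => by
      rw [abs_mul]
      exact bd (hA _) (abs_nonneg _) (hLw _) (weight_nonneg _ _) le_rfl)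
    (Eventually.of_forall fun z => by
      rw [norm_zero]
      have := weight_nonneg (γ + 1) z.2
      positivity)
  have eL : ∫ z, ‖u z.1 z.2‖ ^ 2 * (α z.1 * Laplacian.laplacian Φ z.2) ∂(stripMeasure T)
      = -∫ z, inner ℝ (sqGradVec (u z.1 z.2) (D z.1 z.2)) (α z.1 • gradient Φ z.2)
        ∂(stripMeasure T) := by
    unfold stripMeasure at iL i1 ⊢
    rw [integral_prod _ iL, integral_prod _ i1, ← integral_neg]
    refine integral_congr_ae ?_
    filter_upwards [hV] with t ht
    have h1 := ht.integral_mul_laplacian hΦ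
    simp only [inner_smul_right]
    rw [integral_const_mul, ← mul_neg, ← h1, ← integral_const_mul]
    congr 1; ext x; ring
  have eD : ∫ z, energyDensity (u z.1 z.2) (b z.1 z.2) (D z.1 z.2) (F z.1 z.2) (p z.1 z.2)
        (α z.1 * Φ z.2) (α z.1 • gradient Φ z.2) ∂(stripMeasure T)
      = -(∫ z, inner ℝ (sqGradVec (u z.1 z.2) (D z.1 z.2)) (α z.1 • gradient Φ z.2)
          ∂(stripMeasure T))
        - 2 * (∫ z, ‖D z.1 z.2‖ ^ 2 * (α z.1 * Φ z.2) ∂(stripMeasure T))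
        + (∫ z, ‖u z.1 z.2‖ ^ 2 * inner ℝ (b z.1 z.2) (α z.1 • gradient Φ z.2) ∂(stripMeasure T))
        + 2 * (∫ z, p z.1 z.2 * inner ℝ (u z.1 z.2) (α z.1 • gradient Φ z.2) ∂(stripMeasure T))
        - 2 * (∫ z, ∑ i, ∑ j, (F z.1 z.2 (i, j) * D z.1 z.2 (i, j) * (α z.1 * Φ z.2)
          + F z.1 z.2 (i, j) * u z.1 z.2 j * (α z.1 • gradient Φ z.2) i) ∂(stripMeasure T)) := by
    have i5' := integrable_finsetSum Finset.univ fun i _ =>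
      integrable_finsetSum Finset.univ fun j _ => i5 i j
    unfold energyDensity
    exact integral_energy_comb i1 i2 i3 i4 i5'
  have e1 : ∫ z, ‖u z.1 z.2‖ ^ 2 / 2 * (deriv α z.1 * Φ z.2) ∂(stripMeasure T)
      = 2⁻¹ * ∫ z, ‖u z.1 z.2‖ ^ 2 * (deriv α z.1 * Φ z.2) ∂(stripMeasure T) := by
    rw [← integral_const_mul]
    congr 1; ext z; ring
  have e2 : ∫ z, ‖u z.1 z.2‖ ^ 2 / 2 * (α z.1 * Laplacian.laplacian Φ z.2) ∂(stripMeasure T)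
      = 2⁻¹ * ∫ z, ‖u z.1 z.2‖ ^ 2 * (α z.1 * Laplacian.laplacian Φ z.2) ∂(stripMeasure T) := by
    rw [← integral_const_mul]
    congr 1; ext z; ring
  have e3 : ∫ z, ‖u z.1 z.2‖ ^ 2 / 2 * inner ℝ (b z.1 z.2) (α z.1 • gradient Φ z.2)
        ∂(stripMeasure T)
      = 2⁻¹ * ∫ z, ‖u z.1 z.2‖ ^ 2 * inner ℝ (b z.1 z.2) (α z.1 • gradient Φ z.2)
        ∂(stripMeasure T) := by
    rw [← integral_const_mul]
    congr 1; ext z; ring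
  have e5 : ∫ z, (∑ i, ∑ j, F z.1 z.2 (i, j) *
        (u z.1 z.2 j * (α z.1 • gradient Φ z.2) i + D z.1 z.2 (i, j) * (α z.1 * Φ z.2)))
        ∂(stripMeasure T)
      = ∫ z, ∑ i, ∑ j, (F z.1 z.2 (i, j) * D z.1 z.2 (i, j) * (α z.1 * Φ z.2)
          + F z.1 z.2 (i, j) * u z.1 z.2 j * (α z.1 • gradient Φ z.2) i) ∂(stripMeasure T) := by
    congr 1; ext z
    refine Finset.sum_congr rfl fun i _ => Finset.sum_congr rfl fun j _ => ?_
    ring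
  have hμ : 0 ≤ ∫ z : ℝ × R3, α z.1 * Φ z.2 ∂μ :=
    integral_nonneg fun z => mul_nonneg (hα0 _) (hΦ0 _)
  rw [e1, e2, e3, e5, eL] at hb
  rw [eD]
  linarith

end

/-! ### Passage from test functions to the weight -/

/-- Test functions bounded by the weight and tending to it as `k → ∞`, whose gradients are
bounded by a multiple of `w_{γ+1}` uniformly in `k`. -/
noncomputable def approxWeight (γ : ℝ) (k : ℕ) (x : R3) : ℝ :=
  cutoff k x * regWeight (1 / ((k : ℝ) + 1)) γ x

theorem isTest_approxWeight (γ : ℝ) (k : ℕ) : IsTest (approxWeight γ k) :=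
  ⟨(contDiff_cutoff k).mul (contDiff_regWeight (by positivity) γ),
    (hasCompactSupport_cutoff k).mul_right⟩

theorem approxWeight_nonneg (γ : ℝ) (k : ℕ) (x : R3) : 0 ≤ approxWeight γ k x :=
  mul_nonneg (cutoff_nonneg k x) (regWeight_pos _ _ _).le

theorem approxWeight_le {γ : ℝ} (hγ : 0 ≤ γ) (k : ℕ) (x : R3) :
    approxWeight γ k x ≤ weight γ x :=
  (mul_le_of_le_one_left (regWeight_pos _ _ _).le (cutoff_le_one k x)).trans
    (regWeight_le_weight _ hγ x)

theorem exists_norm_gradient_approxWeight_le {γ : ℝ} (hγ : 0 ≤ γ) :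
    ∃ K : ℝ, ∀ k x, ‖gradient (approxWeight γ k) x‖ ≤ K * weight (γ + 1) x := by
  obtain ⟨K, hK0, hK⟩ := exists_norm_gradient_cutoff_le
  refine ⟨γ + K, fun k x => ?_⟩
  have hε : (1 / ((k : ℝ) + 1)) ≠ 0 := by positivity
  have h0 : 0 < (1 / ((k : ℝ) + 1)) ^ 2 + ‖x‖ ^ 2 := by positivity
  have h1 := norm_gradient_regWeight_le_weight hγ h0
  have h2 := hK k x
  have h3 := regWeight_le_weight (1 / ((k : ℝ) + 1)) hγ x
  have h4 : weight γ x * weight 1 x = weight (γ + 1) x := weight_mul_weight γ 1 x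
  have e : gradient (approxWeight γ k) x = _ :=
    gradient_mul ((contDiff_cutoff k).differentiable (by simp) x)
      ((contDiff_regWeight hε γ).differentiable (by simp) x)
  rw [e]
  refine (norm_add_le _ _).trans ?_
  rw [norm_smul, norm_smul, Real.norm_of_nonneg (cutoff_nonneg k x),
    Real.norm_of_nonneg (regWeight_pos _ _ _).le, add_mul]
  refine add_le_add ?_ ?_
  · exact (mul_le_of_le_one_left (norm_nonneg _) (cutoff_le_one k x)).trans h1
  · refine (mul_le_mul h3 h2 (norm_nonneg _) (weight_nonneg _ _)).trans_eq ?_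
    rw [← h4]
    ring

theorem tendsto_one_div_succ : Tendsto (fun k : ℕ => 1 / ((k : ℝ) + 1)) atTop (𝓝 0) :=
  tendsto_one_div_add_atTop_nhds_zero_nat

theorem tendsto_approxWeight (γ : ℝ) (x : R3) :
    Tendsto (fun k => approxWeight γ k x) atTop (𝓝 (weight γ x)) := by
  have hc : ContinuousAt (fun ε : ℝ => regWeight ε γ x) 0 := by
    unfold regWeight
    exact ContinuousAt.rpow_const (by fun_prop) (Or.inl (by positivity))
  have h := hc.tendsto.comp tendsto_one_div_succ
  simp only [regWeight_zero] at h
  refine h.congr' ?_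
  filter_upwards [eventually_cutoff_eq_one x] with k hk
  simp [approxWeight, hk.self_of_nhds]

theorem tendsto_gradient_approxWeight (γ : ℝ) {x : R3} (hx : x ≠ 0) :
    Tendsto (fun k => gradient (approxWeight γ k) x) atTop (𝓝 (gradient (weight γ) x)) := by
  have hx' : 0 < ‖x‖ := norm_pos_iff.2 hx
  have h0 : ∀ ε : ℝ, 0 < ε ^ 2 + ‖x‖ ^ 2 := fun ε => by positivity
  have hc : ContinuousAt (fun ε : ℝ => gradient (regWeight ε γ) x) 0 := by
    have e : (fun ε : ℝ => gradient (regWeight ε γ) x) = fun ε : ℝ =>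
        (-γ * (1 + √(ε ^ 2 + ‖x‖ ^ 2)) ^ (-γ - 1) * (√(ε ^ 2 + ‖x‖ ^ 2))⁻¹) • x :=
      funext fun ε => gradient_regWeight γ (h0 ε)
    rw [e]
    have s1 : ContinuousAt (fun ε : ℝ => √(ε ^ 2 + ‖x‖ ^ 2)) 0 := by fun_prop
    have s2 : ContinuousAt (fun ε : ℝ => (1 + √(ε ^ 2 + ‖x‖ ^ 2)) ^ (-γ - 1)) 0 :=
      ContinuousAt.rpow_const (by fun_prop) (Or.inl (by positivity))
    have s3 : ContinuousAt (fun ε : ℝ => (√(ε ^ 2 + ‖x‖ ^ 2))⁻¹) 0 :=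
      s1.inv₀ (Real.sqrt_pos.2 (h0 0)).ne'
    fun_prop
  have h := hc.tendsto.comp tendsto_one_div_succ
  simp only [regWeight_zero] at h
  refine h.congr' ?_
  filter_upwards [eventually_cutoff_eq_one x] with k hk
  have e : approxWeight γ k =ᶠ[𝓝 x] regWeight (1 / ((k : ℝ) + 1)) γ := by
    filter_upwards [hk] with y hy
    simp [approxWeight, hy]
  simp only [Function.comp, gradient, e.fderiv_eq]

theorem ae_strip_ne_zero (T : ℝ) : ∀ᵐ z ∂(stripMeasure T), z.2 ≠ 0 := by
  have h : ∀ᵐ x ∂(volume : Measure R3), x ≠ 0 := by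
    rw [ae_iff]
    simp
  exact Measure.quasiMeasurePreserving_snd.ae h

theorem measurable_gradient (f : R3 → ℝ) : Measurable (gradient f) := by
  have h := measurable_fderiv ℝ f
  exact ((InnerProductSpace.toDual ℝ R3).symm.continuous.measurable).comp h

section

variable {γ T : ℝ} {F : ℝ → R3 → Tensor3} {b u : ℝ → R3 → R3} {D : ℝ → R3 → Tensor3}
  {p : ℝ → R3 → ℝ}

theorem aestronglyMeasurable_gradient_weight (γ T : ℝ) :
    AEStronglyMeasurable (fun z : ℝ × R3 => gradient (weight γ) z.2) (stripMeasure T) :=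
  ((measurable_gradient _).comp measurable_snd).aestronglyMeasurable

theorem aestronglyMeasurable_weight_snd (γ T : ℝ) :
    AEStronglyMeasurable (fun z : ℝ × R3 => weight γ z.2) (stripMeasure T) :=
  ((continuous_weight γ).comp continuous_snd).aestronglyMeasurable

/-- The factor `1 + γ` makes this bound and the next one hold with a common constant. -/
theorem ae_abs_weight_le (hγ : 0 ≤ γ) :
    ∀ᵐ z ∂(stripMeasure T), |weight γ z.2| ≤ (1 + γ) * weight γ z.2 :=
  Eventually.of_forall fun z => by
    rw [abs_of_nonneg (weight_nonneg _ _)]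
    nlinarith [weight_nonneg γ z.2]

theorem ae_norm_gradient_weight_le (hγ : 0 ≤ γ) :
    ∀ᵐ z ∂(stripMeasure T), ‖gradient (weight γ) z.2‖ ≤ (1 + γ) * weight (γ + 1) z.2 := by
  filter_upwards [ae_strip_ne_zero T] with z hz
  refine (norm_gradient_weight_le hγ hz).trans ?_
  nlinarith [weight_nonneg (γ + 1) z.2]

/-- The limit `Φ → w_γ` in the tested energy balance. The gradients converge off the origin only. -/
theorem StripIntegrable.energy_weight (h : StripIntegrable γ T F b u D p) (hγ : 0 ≤ γ)
    (hV : ∀ᵐ t ∂((volume : Measure ℝ).restrict (Ioo 0 T)),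
      IsWeakGradient (fun x => ‖u t x‖ ^ 2) fun x => sqGradVec (u t x) (D t x))
    (hbal : LocalEnergyBalance T b u D F p) {α : ℝ → ℝ} (hα : ContDiff ℝ ∞ α)
    (hαc : HasCompactSupport α) (hαs : tsupport α ⊆ Ioo 0 T) (hα0 : ∀ t, 0 ≤ α t) :
    -∫ z, ‖u z.1 z.2‖ ^ 2 * (deriv α z.1 * weight γ z.2) ∂(stripMeasure T)
      ≤ ∫ z, energyDensity (u z.1 z.2) (b z.1 z.2) (D z.1 z.2) (F z.1 z.2) (p z.1 z.2)
        (α z.1 * weight γ z.2) (α z.1 • gradient (weight γ) z.2) ∂(stripMeasure T) := by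
  obtain ⟨K, hK⟩ := exists_norm_gradient_approxWeight_le hγ
  obtain ⟨A, hA⟩ := hαc.exists_bound_of_continuous hα.continuous
  have hA0 : 0 ≤ A := (norm_nonneg _).trans (hA 0)
  have hα' : Continuous (deriv α) := hα.continuous_deriv (by simp)
  obtain ⟨A', hA'⟩ := (hαc.deriv (𝕜 := ℝ)).exists_bound_of_continuous hα'
  have hA0' : 0 ≤ A' := (norm_nonneg _).trans (hA' 0)
  have mα : AEStronglyMeasurable (fun z : ℝ × R3 => α z.1) (stripMeasure T) :=
    (hα.continuous.comp continuous_fst).aestronglyMeasurable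
  have mα' : AEStronglyMeasurable (fun z : ℝ × R3 => deriv α z.1) (stripMeasure T) :=
    (hα'.comp continuous_fst).aestronglyMeasurable
  have mΦ : ∀ k, AEStronglyMeasurable (fun z : ℝ × R3 => approxWeight γ k z.2) (stripMeasure T) :=
    fun k => ((isTest_approxWeight γ k).1.continuous.comp continuous_snd).aestronglyMeasurable
  have mG : ∀ k, AEStronglyMeasurable (fun z : ℝ × R3 => gradient (approxWeight γ k) z.2)
      (stripMeasure T) := fun k =>
    ((contDiff_gradient (isTest_approxWeight γ k).1).continuous.comp
      continuous_snd).aestronglyMeasurable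
  have hle : ∀ k x, |approxWeight γ k x| ≤ weight γ x := fun k x => by
    rw [abs_of_nonneg (approxWeight_nonneg γ k x)]
    exact approxWeight_le hγ k x
  have hlim := h.tendsto_energyDensity (Φ := fun k z => α z.1 * approxWeight γ k z.2)
    (Ξ := fun k z => α z.1 • gradient (approxWeight γ k) z.2)
    (Φ' := fun z => α z.1 * weight γ z.2) (Ξ' := fun z => α z.1 • gradient (weight γ) z.2)
    (K := A * (1 + |K|)) (fun k => mα.mul (mΦ k)) (fun k => mα.smul (mG k))
    (fun k => Eventually.of_forall fun z => by
      rw [abs_mul]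
      calc |α z.1| * |approxWeight γ k z.2| ≤ A * weight γ z.2 :=
            mul_le_mul (hA _) (hle k _) (abs_nonneg _) hA0
        _ ≤ A * (1 + |K|) * weight γ z.2 := by
            have := weight_nonneg γ z.2
            gcongr
            nlinarith [abs_nonneg K])
    (fun k => Eventually.of_forall fun z => by
      rw [norm_smul]
      calc ‖α z.1‖ * ‖gradient (approxWeight γ k) z.2‖ ≤ A * (K * weight (γ + 1) z.2) :=
            mul_le_mul (hA _) (hK k _) (norm_nonneg _) hA0
        _ ≤ A * ((1 + |K|) * weight (γ + 1) z.2) := by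
            have := weight_nonneg (γ + 1) z.2
            gcongr
            linarith [le_abs_self K]
        _ = _ := by ring)
    (Eventually.of_forall fun z => (tendsto_approxWeight γ z.2).const_mul _)
    (by
      filter_upwards [ae_strip_ne_zero T] with z hz
      exact (tendsto_gradient_approxWeight γ hz).const_smul _)
  have hlim' : Tendsto (fun k => ∫ z, ‖u z.1 z.2‖ ^ 2 * (deriv α z.1 * approxWeight γ k z.2)
      ∂(stripMeasure T)) atTop
      (𝓝 (∫ z, ‖u z.1 z.2‖ ^ 2 * (deriv α z.1 * weight γ z.2) ∂(stripMeasure T))) := by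
    refine tendsto_integral_of_dominated_convergence
      (fun z : ℝ × R3 => A' * (weight γ z.2 * (‖u z.1 z.2‖ * ‖u z.1 z.2‖)))
      (fun k => (h.meas_u.norm.pow 2).mul (mα'.mul (mΦ k))) (h.uu.const_mul A') (fun k => ?_) ?_
    · refine Eventually.of_forall fun z => ?_
      rw [norm_mul, norm_mul, norm_pow, norm_norm]
      have h1 : ‖deriv α z.1‖ * ‖approxWeight γ k z.2‖ ≤ A' * weight γ z.2 :=
        mul_le_mul (hA' _) (hle k _) (norm_nonneg _) hA0'
      nlinarith [mul_le_mul_of_nonneg_left h1 (by positivity : 0 ≤ ‖u z.1 z.2‖ ^ 2)]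
    · exact Eventually.of_forall fun z => ((tendsto_approxWeight γ z.2).const_mul _).const_mul _
  exact le_of_tendsto_of_tendsto' hlim'.neg hlim fun k =>
    h.energy_test hV hbal hα hαc hαs hα0 (isTest_approxWeight γ k) (approxWeight_nonneg γ k)

/-- The weighted energy inequality, integrated over space, against test functions of time. -/
theorem StripIntegrable.energy_time (h : StripIntegrable γ T F b u D p) (hγ : 0 ≤ γ)
    (hV : ∀ᵐ t ∂((volume : Measure ℝ).restrict (Ioo 0 T)),
      IsWeakGradient (fun x => ‖u t x‖ ^ 2) fun x => sqGradVec (u t x) (D t x))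
    (hbal : LocalEnergyBalance T b u D F p) {α : ℝ → ℝ} (hα : ContDiff ℝ ∞ α)
    (hαc : HasCompactSupport α) (hαs : tsupport α ⊆ Ioo 0 T) (hα0 : ∀ t, 0 ≤ α t) :
    -∫ t in Ioo 0 T, (∫ x, ‖u t x‖ ^ 2 * weight γ x) * deriv α t
      ≤ ∫ t in Ioo 0 T, α t * ∫ x, energyDensity (u t x) (b t x) (D t x) (F t x) (p t x)
        (weight γ x) (gradient (weight γ) x) := by
  have key := h.energy_weight hγ hV hbal hα hαc hαs hα0
  have hα' : Continuous (deriv α) := hα.continuous_deriv (by simp)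
  obtain ⟨A', hA'⟩ := (hαc.deriv (𝕜 := ℝ)).exists_bound_of_continuous hα'
  obtain ⟨A, hA⟩ := hαc.exists_bound_of_continuous hα.continuous
  have i1 : Integrable (fun z : ℝ × R3 => ‖u z.1 z.2‖ ^ 2 * (deriv α z.1 * weight γ z.2))
      (stripMeasure T) := by
    have h1 := (h.terms (aestronglyMeasurable_weight_snd γ T)
      (aestronglyMeasurable_gradient_weight γ T) (ae_abs_weight_le hγ)
      (ae_norm_gradient_weight_le hγ)).1
    have h2 := h1.bdd_mul (f := fun z : ℝ × R3 => deriv α z.1) (c := A')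
      (hα'.comp continuous_fst).aestronglyMeasurable (Eventually.of_forall fun z => hA' z.1)
    refine h2.congr (Eventually.of_forall fun z => ?_)
    simp only
    ring
  have i2 : Integrable (fun z : ℝ × R3 => α z.1 * energyDensity (u z.1 z.2) (b z.1 z.2)
      (D z.1 z.2) (F z.1 z.2) (p z.1 z.2) (weight γ z.2) (gradient (weight γ) z.2))
      (stripMeasure T) :=
    (h.integrable_energyDensity (aestronglyMeasurable_weight_snd γ T)
      (aestronglyMeasurable_gradient_weight γ T) (ae_abs_weight_le hγ)
      (ae_norm_gradient_weight_le hγ)).bdd_mul (f := fun z : ℝ × R3 => α z.1) (c := A)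
      (hα.continuous.comp continuous_fst).aestronglyMeasurable
      (Eventually.of_forall fun z => hA z.1)
  simp only [energyDensity_smul] at key
  unfold stripMeasure at key i1 i2
  rw [integral_prod _ i1, integral_prod _ i2] at key
  simp only [integral_const_mul] at key
  convert key using 2
  refine integral_congr_ae (Eventually.of_forall fun t => ?_)
  simp only
  rw [mul_comm, ← integral_const_mul]
  congr 1; ext x; ring

end

/-! ### From test functions of time to pointwise inequalities -/

/-- A smooth step: `0` up to time `a` and `1` from time `a + δ` on. -/
noncomputable def smoothStep (a δ t : ℝ) : ℝ := Real.smoothTransition ((t - a) / δ)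

theorem contDiff_smoothStep (a δ : ℝ) : ContDiff ℝ ∞ (smoothStep a δ) := by
  unfold smoothStep
  exact Real.smoothTransition.contDiff.comp ((contDiff_id.sub contDiff_const).div_const δ)

theorem smoothStep_of_le {a δ t : ℝ} (hδ : 0 < δ) (h : t ≤ a) : smoothStep a δ t = 0 :=
  Real.smoothTransition.zero_of_nonpos (div_nonpos_of_nonpos_of_nonneg (by linarith) hδ.le)

theorem smoothStep_of_ge {a δ t : ℝ} (hδ : 0 < δ) (h : a + δ ≤ t) : smoothStep a δ t = 1 :=
  Real.smoothTransition.one_of_one_le ((one_le_div hδ).2 (by linarith))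

theorem monotone_smoothStep {a δ : ℝ} (hδ : 0 < δ) : Monotone (smoothStep a δ) :=
  fun s t h => Real.smoothTransition.monotone (by gcongr)

theorem deriv_smoothStep_nonneg {a δ : ℝ} (hδ : 0 < δ) (t : ℝ) : 0 ≤ deriv (smoothStep a δ) t :=
  (monotone_smoothStep hδ).deriv_nonneg

theorem deriv_smoothStep_eq_zero {a δ t : ℝ} (hδ : 0 < δ) (h : t < a ∨ a + δ < t) :
    deriv (smoothStep a δ) t = 0 := by
  rcases h with h | h
  · have e : smoothStep a δ =ᶠ[𝓝 t] fun _ => 0 := by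
      filter_upwards [gt_mem_nhds h] with s hs
      exact smoothStep_of_le hδ (le_of_lt hs)
    rw [e.deriv_eq, deriv_const]
  · have e : smoothStep a δ =ᶠ[𝓝 t] fun _ => 1 := by
      filter_upwards [lt_mem_nhds h] with s hs
      exact smoothStep_of_ge hδ (le_of_lt hs)
    rw [e.deriv_eq, deriv_const]

theorem continuous_deriv_smoothStep (a δ : ℝ) : Continuous (deriv (smoothStep a δ)) :=
  (contDiff_smoothStep a δ).continuous_deriv (by simp)

theorem hasCompactSupport_deriv_smoothStep {a δ : ℝ} (hδ : 0 < δ) :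
    HasCompactSupport (deriv (smoothStep a δ)) := by
  refine HasCompactSupport.intro (isCompact_Icc (a := a) (b := a + δ)) fun t ht => ?_
  refine deriv_smoothStep_eq_zero hδ ?_
  by_contra hc
  push Not at hc
  exact ht hc

theorem integral_deriv_smoothStep {a δ T : ℝ} (hδ : 0 < δ) (ha : 0 ≤ a) (hT : a + δ ≤ T) :
    ∫ t in Ioo 0 T, deriv (smoothStep a δ) t = 1 := by
  rw [← integral_Ioc_eq_integral_Ioo, ← intervalIntegral.integral_of_le (by linarith),
    intervalIntegral.integral_deriv_eq_sub
      (fun t _ => (contDiff_smoothStep a δ).differentiable (by simp) t)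
      ((continuous_deriv_smoothStep a δ).intervalIntegrable _ _),
    smoothStep_of_ge hδ hT, smoothStep_of_le hδ ha, sub_zero]

theorem integrable_mul_deriv_smoothStep {a δ T : ℝ} (hδ : 0 < δ) {E : ℝ → ℝ}
    (hE : IntegrableOn E (Ioo 0 T)) :
    IntegrableOn (fun t => E t * deriv (smoothStep a δ) t) (Ioo 0 T) := by
  obtain ⟨A, hA⟩ := (hasCompactSupport_deriv_smoothStep hδ).exists_bound_of_continuous
    (continuous_deriv_smoothStep a δ)
  exact hE.mul_bdd (c := A) (continuous_deriv_smoothStep a δ).aestronglyMeasurable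
    (Eventually.of_forall hA)

theorem le_integral_mul_deriv_smoothStep {a δ T e : ℝ} (hδ : 0 < δ) (ha : 0 ≤ a) (hT : a + δ ≤ T)
    {E : ℝ → ℝ} (hE : IntegrableOn E (Ioo 0 T)) (h : ∀ t ∈ Icc a (a + δ), e ≤ E t) :
    e ≤ ∫ t in Ioo 0 T, E t * deriv (smoothStep a δ) t := by
  have hc : IntegrableOn (fun _ : ℝ => e) (Ioo 0 T) := by simp [integrableOn_const_iff]
  calc e = ∫ t in Ioo 0 T, e * deriv (smoothStep a δ) t := by
        rw [integral_const_mul, integral_deriv_smoothStep hδ ha hT, mul_one]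
    _ ≤ _ := by
        refine integral_mono (integrable_mul_deriv_smoothStep hδ hc)
          (integrable_mul_deriv_smoothStep hδ hE) fun t => ?_
        by_cases ht : t ∈ Icc a (a + δ)
        · exact mul_le_mul_of_nonneg_right (h t ht) (deriv_smoothStep_nonneg hδ t)
        · have h0 : deriv (smoothStep a δ) t = 0 := by
            refine deriv_smoothStep_eq_zero hδ ?_
            by_contra hc
            push Not at hc
            exact ht hc
          simp [h0]

theorem integral_mul_deriv_smoothStep_le {a δ T e : ℝ} (hδ : 0 < δ) (ha : 0 ≤ a) (hT : a + δ ≤ T)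
    {E : ℝ → ℝ} (hE : IntegrableOn E (Ioo 0 T)) (h : ∀ t ∈ Icc a (a + δ), E t ≤ e) :
    ∫ t in Ioo 0 T, E t * deriv (smoothStep a δ) t ≤ e := by
  have h1 := le_integral_mul_deriv_smoothStep (e := -e) hδ ha hT hE.neg
    fun t ht => neg_le_neg (h t ht)
  simp only [Pi.neg_apply, neg_mul, integral_neg] at h1
  linarith

/-- If `E' ≤ g` in the sense of distributions on `(0,T)`, if `E` is lower semicontinuous at `t`
and has the limit `E₀` at `0`, then `E t ≤ E₀ + ∫_0^t g`. -/
theorem le_add_integral_of_distrib {E g : ℝ → ℝ} {T t E₀ : ℝ} (ht : 0 < t) (htT : t < T)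
    (hE : IntegrableOn E (Ioo 0 T)) (hg : IntegrableOn g (Ioo 0 T))
    (key : ∀ α : ℝ → ℝ, ContDiff ℝ ∞ α → HasCompactSupport α → tsupport α ⊆ Ioo 0 T →
      (∀ s, 0 ≤ α s) → -∫ s in Ioo 0 T, E s * deriv α s ≤ ∫ s in Ioo 0 T, α s * g s)
    (hlsc : ∀ e < E t, ∀ᶠ s in 𝓝 t, e < E s) (h0 : Tendsto E (𝓝[>] 0) (𝓝 E₀)) :
    E t ≤ E₀ + ∫ s in (0)..t, g s := by
  -- the test functions rise from `0` to `1` on `[δ, 2δ]` and fall back on `[t - δ, t]`; the last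
  -- interval ends at `t` because lower semicontinuity at `t` bounds `E` from below on it
  set δ : ℕ → ℝ := fun n => t / 4 * (1 / ((n : ℝ) + 1)) with hδd
  have hδ : ∀ n, 0 < δ n := fun n => by positivity
  have hδt : ∀ n, δ n ≤ t / 4 := fun n => by
    refine mul_le_of_le_one_right (by positivity) ?_
    rw [div_le_one (by positivity)]
    have : (0 : ℝ) ≤ n := n.cast_nonneg
    linarith
  have hδ0 : Tendsto δ atTop (𝓝 0) := by
    simpa [hδd] using (tendsto_one_div_add_atTop_nhds_zero_nat (𝕜 := ℝ)).const_mul (t / 4)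
  set α : ℕ → ℝ → ℝ := fun n s => smoothStep (δ n) (δ n) s - smoothStep (t - δ n) (δ n) s with hαd
  have hα0 : ∀ n s, 0 ≤ α n s := fun n s => by
    have h1 : (s - (t - δ n)) / δ n ≤ (s - δ n) / δ n := by
      have := hδ n
      have := hδt n
      gcongr
      linarith
    exact sub_nonneg.2 (Real.smoothTransition.monotone h1)
  have hα1 : ∀ n s, α n s ≤ 1 := fun n s => by
    have h1 : smoothStep (δ n) (δ n) s ≤ 1 := Real.smoothTransition.le_one _
    have h2 : 0 ≤ smoothStep (t - δ n) (δ n) s := Real.smoothTransition.nonneg _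
    simp only [hαd]
    linarith
  have hαs : ∀ n s, s ∉ Icc (δ n) t → α n s = 0 := fun n s hs => by
    rw [mem_Icc, not_and_or, not_le, not_le] at hs
    have h3 := hδt n
    have h4 := hδ n
    rcases hs with hs | hs
    · simp only [hαd]
      rw [smoothStep_of_le (hδ n) hs.le, smoothStep_of_le (hδ n) (by linarith), sub_zero]
    · simp only [hαd]
      rw [smoothStep_of_ge (hδ n) (by linarith), smoothStep_of_ge (hδ n) (by linarith), sub_self]
  have hαd' : ∀ n, ContDiff ℝ ∞ (α n) := fun n =>
    (contDiff_smoothStep _ _).sub (contDiff_smoothStep _ _)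
  have hts : ∀ n, tsupport (α n) ⊆ Icc (δ n) t := fun n =>
    closure_minimal (fun s hs => by
      by_contra hc
      exact hs (hαs n s hc)) isClosed_Icc
  have hineq : ∀ n, (∫ s in Ioo 0 T, E s * deriv (smoothStep (t - δ n) (δ n)) s)
      - (∫ s in Ioo 0 T, E s * deriv (smoothStep (δ n) (δ n)) s)
      ≤ ∫ s in Ioo 0 T, α n s * g s := fun n => by
    have h1 := key (α n) (hαd' n) (HasCompactSupport.intro isCompact_Icc (hαs n))
      ((hts n).trans fun s hs => ⟨(hδ n).trans_le hs.1, hs.2.trans_lt htT⟩) (hα0 n)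
    have h2 : ∀ s, deriv (α n) s
        = deriv (smoothStep (δ n) (δ n)) s - deriv (smoothStep (t - δ n) (δ n)) s := fun s =>
      deriv_fun_sub ((contDiff_smoothStep _ _).differentiable (by simp) s)
        ((contDiff_smoothStep _ _).differentiable (by simp) s)
    simp only [h2, mul_sub] at h1
    rw [integral_sub (integrable_mul_deriv_smoothStep (hδ n) hE)
      (integrable_mul_deriv_smoothStep (hδ n) hE)] at h1
    linarith
  have hlim : Tendsto (fun n => ∫ s in Ioo 0 T, α n s * g s) atTop (𝓝 (∫ s in (0)..t, g s)) := by
    have e : ∫ s in (0)..t, g s = ∫ s in Ioo 0 T, (Ioo 0 t).indicator g s := by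
      rw [setIntegral_indicator measurableSet_Ioo, Ioo_inter_Ioo, sup_idem,
        inf_eq_right.2 htT.le, intervalIntegral.integral_of_le ht.le, integral_Ioc_eq_integral_Ioo]
    rw [e]
    refine tendsto_integral_of_dominated_convergence (fun s => ‖g s‖)
      (fun n => (hαd' n).continuous.aestronglyMeasurable.mul hg.1) hg.norm (fun n => ?_) ?_
    · refine Eventually.of_forall fun s => ?_
      rw [norm_mul, Real.norm_of_nonneg (hα0 n s)]
      exact mul_le_of_le_one_left (norm_nonneg _) (hα1 n s)
    · have hne : ∀ᵐ s ∂((volume : Measure ℝ).restrict (Ioo 0 T)), s ≠ t :=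
        ae_restrict_of_ae (by rw [ae_iff]; simp)
      filter_upwards [hne, ae_restrict_mem measurableSet_Ioo] with s hs hsT
      rcases lt_or_gt_of_ne hs with hs | hs
      · rw [indicator_of_mem (show s ∈ Ioo 0 t from ⟨hsT.1, hs⟩)]
        refine tendsto_const_nhds.congr' ?_
        have e1 : ∀ᶠ n in atTop, δ n < s / 2 := hδ0.eventually (gt_mem_nhds (by linarith [hsT.1]))
        have e2 : ∀ᶠ n in atTop, δ n < t - s := hδ0.eventually (gt_mem_nhds (by linarith))
        filter_upwards [e1, e2] with n h1 h2
        simp only [hαd]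
        rw [smoothStep_of_ge (hδ n) (by linarith), smoothStep_of_le (hδ n) (by linarith), sub_zero,
          one_mul]
      · rw [indicator_of_notMem (fun h => by linarith [h.2])]
        refine tendsto_const_nhds.congr fun n => ?_
        rw [hαs n s fun h => by linarith [h.2], zero_mul]
  have main : ∀ e < E t, ∀ e₀ > E₀, e - e₀ ≤ ∫ s in (0)..t, g s := by
    intro e he e₀ he₀
    refine ge_of_tendsto hlim ?_
    obtain ⟨r, hr, hr'⟩ := Metric.eventually_nhds_iff.1 (hlsc e he)
    have h0' := h0.eventually (gt_mem_nhds he₀)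
    rw [eventually_nhdsWithin_iff] at h0'
    obtain ⟨r₀, hr₀, hr₀'⟩ := Metric.eventually_nhds_iff.1 h0'
    filter_upwards [hδ0.eventually (gt_mem_nhds hr),
      hδ0.eventually (gt_mem_nhds (half_pos hr₀))] with n h1 h2
    refine le_trans ?_ (hineq n)
    have h3 := hδ n
    have h4 := hδt n
    refine sub_le_sub ?_ ?_
    · refine le_integral_mul_deriv_smoothStep h3 (by linarith) (by linarith) hE fun s hs => ?_
      refine (hr' ?_).le
      rw [Real.dist_eq, abs_lt]
      constructor <;> linarith [hs.1, hs.2]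
    · refine integral_mul_deriv_smoothStep_le h3 (by linarith) (by linarith) hE fun s hs => ?_
      refine (hr₀' ?_ (show s ∈ Ioi (0 : ℝ) from h3.trans_le hs.1)).le
      rw [Real.dist_eq, abs_lt]
      constructor <;> linarith [hs.1, hs.2]
  refine le_of_forall_lt_imp_le_of_dense fun e he => ?_
  have h1 : ∀ e₀ > E₀, e - ∫ s in (0)..t, g s ≤ e₀ := fun e₀ he₀ => by
    linarith [main e he e₀ he₀]
  have h2 : e - ∫ s in (0)..t, g s ≤ E₀ := le_of_forall_gt_imp_ge_of_dense h1
  linarith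

/-! ### The weighted norm as a function of time -/

theorem weightNorm_two_sq {E : Type*} [NormedAddCommGroup E] {f : R3 → E} {γ : ℝ}
    (hf : AEStronglyMeasurable f (weightMeasure γ)) :
    weightNorm 2 γ f ^ 2 = ∫ x, ‖f x‖ ^ 2 ∂(weightMeasure γ) := by
  have hm : AEStronglyMeasurable (fun x => ‖f x‖ ^ 2) (weightMeasure γ) := hf.norm.pow 2
  rw [weightNorm, ← ENNReal.toReal_pow, sq_eLpNorm_two,
    integral_eq_lintegral_of_nonneg_ae (Eventually.of_forall fun x => by positivity) hm]
  congr 1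
  refine lintegral_congr fun x => ?_
  rw [ENNReal.ofReal_pow (norm_nonneg _), ofReal_norm]

theorem weightNorm_two_sq_eq_integral_mul {E : Type*} [NormedAddCommGroup E] {f : R3 → E} {γ : ℝ}
    (hf : AEStronglyMeasurable f volume) :
    weightNorm 2 γ f ^ 2 = ∫ x, ‖f x‖ ^ 2 * weight γ x := by
  have hm : AEStronglyMeasurable (fun x => ‖f x‖ ^ 2 * weight γ x) volume :=
    (hf.norm.pow 2).mul (continuous_weight γ).aestronglyMeasurable
  rw [weightNorm, ← ENNReal.toReal_pow, sq_eLpNorm_two, lintegral_weightMeasure,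
    integral_eq_lintegral_of_nonneg_ae (Eventually.of_forall fun x =>
      mul_nonneg (by positivity) (weight_nonneg γ x)) hm]
  congr 1
  refine lintegral_congr fun x => ?_
  rw [ENNReal.ofReal_mul (by positivity), ENNReal.ofReal_pow (norm_nonneg _), ofReal_norm, mul_comm]

/-- Weak continuity makes the weighted norm lower semicontinuous, since
`‖u(s)‖² ≥ 2 ⟨u(s), u(t)⟩ - ‖u(t)‖²`. -/
theorem WeaklyContinuous.eventually_lt {γ T : ℝ} {u : ℝ → R3 → R3} (h : WeaklyContinuous γ T u)
    {t : ℝ} (ht : t ∈ Ioo 0 T) {e : ℝ} (he : e < weightNorm 2 γ (u t) ^ 2) :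
    ∀ᶠ s in 𝓝 t, e < weightNorm 2 γ (u s) ^ 2 := by
  obtain ⟨hm, hw⟩ := h
  have hmt := hm t ⟨ht.1.le, ht.2⟩
  have hc : ContinuousAt (fun s => ∫ x, inner ℝ (u s x) (u t x) ∂(weightMeasure γ)) t :=
    (hw (u t) hmt).continuousAt (Ico_mem_nhds ht.1 ht.2)
  have hself : ∫ x, inner ℝ (u t x) (u t x) ∂(weightMeasure γ) = weightNorm 2 γ (u t) ^ 2 := by
    rw [weightNorm_two_sq hmt.1]
    simp only [real_inner_self_eq_norm_sq]
  have hlim : Tendsto (fun s => 2 * (∫ x, inner ℝ (u s x) (u t x) ∂(weightMeasure γ))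
      - weightNorm 2 γ (u t) ^ 2) (𝓝 t) (𝓝 (weightNorm 2 γ (u t) ^ 2)) := by
    have h1 := (hc.tendsto.const_mul 2).sub_const (weightNorm 2 γ (u t) ^ 2)
    rw [hself] at h1
    convert h1 using 2
    ring
  filter_upwards [hlim.eventually (lt_mem_nhds he), Ico_mem_nhds ht.1 ht.2] with s hs hsT
  refine hs.trans_le ?_
  have hms := hm s hsT
  have i1 : Integrable (fun x => ‖u s x‖ ^ 2) (weightMeasure γ) :=
    hms.integrable_norm_pow (p := 2) two_ne_zero
  have i2 : Integrable (fun x => ‖u t x‖ ^ 2) (weightMeasure γ) :=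
    hmt.integrable_norm_pow (p := 2) two_ne_zero
  have i3 : Integrable (fun x => inner ℝ (u s x) (u t x)) (weightMeasure γ) := by
    refine (i1.add i2).mono' (hms.1.inner hmt.1) (Eventually.of_forall fun x => ?_)
    refine (norm_inner_le_norm _ _).trans ?_
    simp only [Pi.add_apply]
    nlinarith [sq_nonneg (‖u s x‖ - ‖u t x‖), norm_nonneg (u s x), norm_nonneg (u t x)]
  rw [weightNorm_two_sq hms.1, weightNorm_two_sq hmt.1, ← integral_const_mul,
    ← integral_sub (i3.const_mul 2) i2]
  refine integral_mono ((i3.const_mul 2).sub i2) i1 fun x => ?_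
  have h1 := norm_sub_sq_real (u s x) (u t x)
  have h2 : 0 ≤ ‖u s x - u t x‖ ^ 2 := by positivity
  simp only
  linarith

theorem tendsto_weightNorm_sq {γ T : ℝ} (hT : 0 < T) {u : ℝ → R3 → R3} {u₀ : R3 → R3}
    (hu : ∀ t ∈ Ico 0 T, MemLp (u t) 2 (weightMeasure γ)) (hu₀ : MemLp u₀ 2 (weightMeasure γ))
    (h : Tendsto (fun t => eLpNorm (fun x => u t x - u₀ x) 2 (weightMeasure γ)) (𝓝[>] 0) (𝓝 0)) :
    Tendsto (fun t => weightNorm 2 γ (u t) ^ 2) (𝓝[>] 0) (𝓝 (weightNorm 2 γ u₀ ^ 2)) := by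
  refine Tendsto.pow ?_ 2
  have h1 : Tendsto (fun t => (eLpNorm (fun x => u t x - u₀ x) 2 (weightMeasure γ)).toReal)
      (𝓝[>] 0) (𝓝 0) := by
    simpa [Function.comp_def] using (ENNReal.tendsto_toReal ENNReal.zero_ne_top).comp h
  rw [tendsto_iff_dist_tendsto_zero]
  refine squeeze_zero' (Eventually.of_forall fun _ => dist_nonneg) ?_ h1
  filter_upwards [Ioo_mem_nhdsGT hT] with t ht
  have hut := hu t ⟨ht.1.le, ht.2⟩
  have hsub : eLpNorm (fun x => u t x - u₀ x) 2 (weightMeasure γ) ≠ ⊤ := (hut.sub hu₀).2.ne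
  have e1 : eLpNorm (u t) 2 (weightMeasure γ)
      ≤ eLpNorm (fun x => u t x - u₀ x) 2 (weightMeasure γ) + eLpNorm u₀ 2 (weightMeasure γ) := by
    have h2 := eLpNorm_add_le (hut.1.sub hu₀.1) hu₀.1 (p := 2) one_le_two
    rwa [sub_add_cancel] at h2
  have e2 : eLpNorm u₀ 2 (weightMeasure γ)
      ≤ eLpNorm (fun x => u t x - u₀ x) 2 (weightMeasure γ) + eLpNorm (u t) 2 (weightMeasure γ) := by
    have h2 := eLpNorm_sub_le hut.1 (hut.1.sub hu₀.1) (p := 2) one_le_two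
    rw [sub_sub_cancel] at h2
    rw [add_comm]
    exact h2
  have f1 := ENNReal.toReal_mono (ENNReal.add_ne_top.2 ⟨hsub, hu₀.2.ne⟩) e1
  have f2 := ENNReal.toReal_mono (ENNReal.add_ne_top.2 ⟨hsub, hut.2.ne⟩) e2
  rw [ENNReal.toReal_add hsub hu₀.2.ne] at f1
  rw [ENNReal.toReal_add hsub hut.2.ne] at f2
  rw [Real.dist_eq, abs_le, weightNorm, weightNorm]
  constructor <;> linarith

/-! ### The energy density at a fixed time -/

theorem toReal_sliceBound {U N B G : ℝ≥0∞} (hU : U ≠ ⊤) (hN : N ≠ ⊤) (hB : B ≠ ⊤) (hG : G ≠ ⊤) :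
    sliceBound U N B G ≠ ⊤ ∧ (sliceBound U N B G).toReal
      = U.toReal * N.toReal + U.toReal * (B.toReal * (U.toReal + N.toReal))
        + (B.toReal * (U.toReal + N.toReal) + G.toReal) * U.toReal + G.toReal * N.toReal
        + G.toReal * U.toReal := by
  lift U to ℝ≥0 using hU
  lift N to ℝ≥0 using hN
  lift B to ℝ≥0 using hB
  lift G to ℝ≥0 using hG
  unfold sliceBound
  constructor
  · exact_mod_cast ENNReal.coe_ne_top
  · norm_cast

theorem abs_integral_le_toReal {f r : R3 → ℝ} {Q : ℝ≥0∞} (h : ∀ᵐ x, |f x| ≤ r x)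
    (hr : ∫⁻ x, ENNReal.ofReal (r x) ≤ Q) (hQ : Q ≠ ⊤) : |∫ x, f x| ≤ Q.toReal := by
  have h1 : ‖∫ x, f x‖ₑ ≤ Q := by
    refine (enorm_integral_le_lintegral_enorm _).trans (le_trans (lintegral_mono_ae ?_) hr)
    filter_upwards [h] with x hx
    rw [Real.enorm_eq_ofReal_abs]
    exact ENNReal.ofReal_le_ofReal hx
  have h2 := ENNReal.toReal_mono hQ h1
  rwa [toReal_enorm, Real.norm_eq_abs] at h2

/-- Young's inequality: the terms bounded by `sliceBound` are absorbed by half of the dissipation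
`2 N²`. -/
theorem young_slice {K U N B G : ℝ} (hK : 0 ≤ K) :
    K * (U * N + U * (B * (U + N)) + (B * (U + N) + G) * U + G * N + G * U)
      ≤ N ^ 2 + (4 * K ^ 2 + 2 * K) * G ^ 2 + (4 * K ^ 2 + 2 * K) * ((1 + B ^ 2) * U ^ 2) := by
  have h1 : K * (U * N) ≤ N ^ 2 / 4 + K ^ 2 * U ^ 2 := by nlinarith [sq_nonneg (N / 2 - K * U)]
  have h2 : 2 * K * (B * U * N) ≤ N ^ 2 / 4 + 4 * K ^ 2 * (B * U) ^ 2 := by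
    nlinarith [sq_nonneg (N / 2 - 2 * K * (B * U))]
  have h3 : K * (G * N) ≤ N ^ 2 / 4 + K ^ 2 * G ^ 2 := by nlinarith [sq_nonneg (N / 2 - K * G)]
  have h4 : 2 * K * (B * U ^ 2) ≤ K * ((1 + B ^ 2) * U ^ 2) := by
    have : 0 ≤ K * ((1 - B) ^ 2 * U ^ 2) := by positivity
    nlinarith
  have h5 : 2 * K * (G * U) ≤ K * (G ^ 2 + U ^ 2) := by
    have : 0 ≤ K * (G - U) ^ 2 := by positivity
    nlinarith
  have h6 : 0 ≤ K ^ 2 * U ^ 2 := by positivity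
  have h7 : 0 ≤ K ^ 2 * G ^ 2 := by positivity
  have h8 : 0 ≤ K * G ^ 2 := by positivity
  have h9 : 0 ≤ K * (B * U) ^ 2 := by positivity
  have h10 : 0 ≤ K * U ^ 2 := by positivity
  have h11 : 0 ≤ N ^ 2 := by positivity
  nlinarith

theorem lintegral_const_mul_weight_mul (c δ : ℝ) (hc : 0 ≤ c) (r : R3 → ℝ) :
    ∫⁻ x, ENNReal.ofReal (c * (weight δ x * r x))
      = ENNReal.ofReal c * ∫⁻ x, ENNReal.ofReal (weight δ x) * ENNReal.ofReal (r x) := by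
  rw [← lintegral_const_mul' _ _ ENNReal.ofReal_ne_top]
  refine lintegral_congr fun x => ?_
  rw [ENNReal.ofReal_mul hc, ENNReal.ofReal_mul (weight_nonneg δ x)]

theorem ofReal_norm_mul_norm {E E' : Type*} [NormedAddCommGroup E] [NormedAddCommGroup E']
    (x : E) (y : E') : ENNReal.ofReal (‖x‖ * ‖y‖) = ‖x‖ₑ * ‖y‖ₑ := by
  rw [ENNReal.ofReal_mul (norm_nonneg _), ofReal_norm, ofReal_norm]

/-- At a fixed time, the integral of the energy density is the dissipation term plus terms
controlled by `sliceBound`. -/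
theorem SliceBounds.integral_energyDensity_le {C : ℝ≥0} {γ : ℝ} {v b : R3 → R3}
    {D F : R3 → Tensor3} {p : R3 → ℝ} (h : SliceBounds C γ v b D F p) (hγ : 0 ≤ γ) (hγ' : γ ≤ 2)
    (i₁ : Integrable fun x => inner ℝ (sqGradVec (v x) (D x)) (gradient (weight γ) x))
    (i₂ : Integrable fun x => ‖D x‖ ^ 2 * weight γ x)
    (i₃ : Integrable fun x => ‖v x‖ ^ 2 * inner ℝ (b x) (gradient (weight γ) x))
    (i₄ : Integrable fun x => p x * inner ℝ (v x) (gradient (weight γ) x))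
    (i₅ : Integrable fun x => ∑ i, ∑ j, (F x (i, j) * D x (i, j) * weight γ x
      + F x (i, j) * v x j * gradient (weight γ) x i)) :
    ∫ x, energyDensity (v x) (b x) (D x) (F x) (p x) (weight γ x) (gradient (weight γ) x)
      ≤ -2 * weightNorm 2 γ D ^ 2 + (72 + 6 * C) *
        (sliceBound (eLpNorm v 2 (weightMeasure γ)) (eLpNorm D 2 (weightMeasure γ))
          (eLpNorm b 3 (weightMeasure (3 * γ / 2))) (eLpNorm F 2 (weightMeasure γ))).toReal := by
  have hSt := (toReal_sliceBound h.memLp_v.2.ne h.memLp_D.2.ne h.memLp_b.2.ne h.memLp_F.2.ne).1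
  have mv := h.memLp_v.1.mono_ac (volume_absolutelyContinuous γ)
  have mD := h.memLp_D.1.mono_ac (volume_absolutelyContinuous γ)
  have mF := h.memLp_F.1.mono_ac (volume_absolutelyContinuous γ)
  have hd := h.drift
  have hp := h.pressure
  set S := sliceBound (eLpNorm v 2 (weightMeasure γ)) (eLpNorm D 2 (weightMeasure γ))
    (eLpNorm b 3 (weightMeasure (3 * γ / 2))) (eLpNorm F 2 (weightMeasure γ)) with hS
  have q1 : eLpNorm v 2 (weightMeasure γ) * eLpNorm D 2 (weightMeasure γ) ≤ S := by
    rw [hS, sliceBound, add_assoc, add_assoc, add_assoc]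
    exact le_self_add
  have q2 : eLpNorm F 2 (weightMeasure γ) * eLpNorm D 2 (weightMeasure γ)
      + eLpNorm F 2 (weightMeasure γ) * eLpNorm v 2 (weightMeasure γ) ≤ S := by
    rw [hS, sliceBound, add_assoc]
    exact le_add_self
  have hb : ∀ᵐ x : R3, |weight γ x| ≤ 2 * weight γ x ∧
      ‖gradient (weight γ) x‖ ≤ 2 * weight (γ + 1) x ∧ 2 * weight (γ + 1) x ≤ 2 * weight γ x := by
    have hne : ∀ᵐ x : R3, x ≠ 0 := by
      rw [ae_iff]
      simp
    filter_upwards [hne] with x hx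
    refine ⟨?_, ?_, ?_⟩
    · rw [abs_of_nonneg (weight_nonneg _ _)]
      linarith [weight_nonneg γ x]
    · refine (norm_gradient_weight_le hγ hx).trans ?_
      nlinarith [weight_nonneg (γ + 1) x]
    · linarith [weight_anti (show γ ≤ γ + 1 by linarith) x]
  -- the constants `36`, `2`, `2`, `18` below are those of `abs_terms_le` for `w = 2 w_γ`, with
  -- nine summands in the last case
  have e1 : |∫ x, inner ℝ (sqGradVec (v x) (D x)) (gradient (weight γ) x)|
      ≤ (ENNReal.ofReal 36 * S).toReal := by
    refine abs_integral_le_toReal (r := fun x => 36 * (weight γ x * (‖v x‖ * ‖D x‖))) ?_ ?_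
      (ENNReal.mul_ne_top ENNReal.ofReal_ne_top hSt)
    · filter_upwards [hb] with x ⟨h1, h2, h3⟩
      refine (abs_terms_le (v := v x) (b := 0) (A := D x) (G := 0) (q := 0)
        h1 h2 h3).1.trans_eq ?_
      ring
    · rw [lintegral_const_mul_weight_mul _ _ (by norm_num)]
      simp only [ofReal_norm_mul_norm]
      gcongr
      exact (lintegral_weight_mul_le mv mD γ).trans q1
  have e3 : |∫ x, ‖v x‖ ^ 2 * inner ℝ (b x) (gradient (weight γ) x)|
      ≤ (ENNReal.ofReal 2 * (C * S)).toReal := by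
    refine abs_integral_le_toReal (r := fun x => 2 * (weight (γ + 1) x * (‖v x‖ ^ 2 * ‖b x‖))) ?_ ?_
      (ENNReal.mul_ne_top ENNReal.ofReal_ne_top (ENNReal.mul_ne_top ENNReal.coe_ne_top hSt))
    · filter_upwards [hb] with x ⟨h1, h2, h3⟩
      refine (abs_terms_le (v := v x) (b := b x) (A := 0) (G := 0) (q := 0)
        h1 h2 h3).2.2.1.trans_eq ?_
      ring
    · rw [lintegral_const_mul_weight_mul _ _ (by norm_num)]
      gcongr
      refine le_trans (le_of_eq (lintegral_congr fun x => ?_)) hd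
      rw [ENNReal.ofReal_mul (by positivity), ENNReal.ofReal_pow (norm_nonneg _), ofReal_norm,
        ofReal_norm]
  have e4 : |∫ x, p x * inner ℝ (v x) (gradient (weight γ) x)|
      ≤ (ENNReal.ofReal 2 * (C * S)).toReal := by
    refine abs_integral_le_toReal (r := fun x => 2 * (weight (γ + 1) x * (‖p x‖ * ‖v x‖))) ?_ ?_
      (ENNReal.mul_ne_top ENNReal.ofReal_ne_top (ENNReal.mul_ne_top ENNReal.coe_ne_top hSt))
    · filter_upwards [hb] with x ⟨h1, h2, h3⟩
      refine (abs_terms_le (v := v x) (b := 0) (A := 0) (G := 0) (q := p x)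
        h1 h2 h3).2.2.2.1.trans_eq ?_
      ring
    · rw [lintegral_const_mul_weight_mul _ _ (by norm_num)]
      simp only [ofReal_norm_mul_norm]
      gcongr
  have e5 : |∫ x, ∑ i, ∑ j, (F x (i, j) * D x (i, j) * weight γ x
      + F x (i, j) * v x j * gradient (weight γ) x i)| ≤ (ENNReal.ofReal 18 * S).toReal := by
    refine abs_integral_le_toReal
      (r := fun x => 18 * (weight γ x * (‖F x‖ * ‖D x‖ + ‖F x‖ * ‖v x‖))) ?_ ?_
      (ENNReal.mul_ne_top ENNReal.ofReal_ne_top hSt)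
    · filter_upwards [hb] with x ⟨h1, h2, h3⟩
      have h5 := (abs_terms_le (v := v x) (b := 0) (A := D x) (G := F x) (q := 0)
        h1 h2 h3).2.2.2.2
      calc _ ≤ ∑ i : Fin 3, ∑ j : Fin 3, (2 * weight γ x * (‖F x‖ * ‖D x‖)
              + 2 * weight γ x * (‖F x‖ * ‖v x‖)) :=
            (Finset.abs_sum_le_sum_abs _ _).trans (Finset.sum_le_sum fun i _ =>
              (Finset.abs_sum_le_sum_abs _ _).trans (Finset.sum_le_sum fun j _ => h5 i j))
        _ = _ := by
            simp only [Finset.sum_const, Finset.card_univ, Fintype.card_fin, nsmul_eq_mul]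
            push_cast
            ring
    · rw [lintegral_const_mul_weight_mul _ _ (by norm_num)]
      gcongr
      refine le_trans ?_ ((add_le_add (lintegral_weight_mul_le mF mD γ)
        (lintegral_weight_mul_le mF mv γ)).trans q2)
      have hm : AEMeasurable (fun x => ENNReal.ofReal (weight γ x) * (‖F x‖ₑ * ‖D x‖ₑ)) volume :=
        (measurable_ofReal_weight γ).aemeasurable.mul (mF.enorm.mul mD.enorm)
      rw [← lintegral_add_left' hm]
      refine le_of_eq (lintegral_congr fun x => ?_)
      rw [ENNReal.ofReal_add (by positivity) (by positivity), ofReal_norm_mul_norm,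
        ofReal_norm_mul_norm, mul_add]
  have e2 := weightNorm_two_sq_eq_integral_mul (γ := γ) mD
  have hcomb := integral_energy_comb i₁ i₂ i₃ i₄ i₅
  simp only [ENNReal.toReal_mul, ENNReal.coe_toReal,
    ENNReal.toReal_ofReal (show (0 : ℝ) ≤ 36 by norm_num),
    ENNReal.toReal_ofReal (show (0 : ℝ) ≤ 2 by norm_num),
    ENNReal.toReal_ofReal (show (0 : ℝ) ≤ 18 by norm_num)] at e1 e3 e4 e5
  unfold energyDensity
  rw [hcomb, ← e2]
  rw [abs_le] at e1 e3 e4 e5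
  nlinarith [e1.1, e3.2, e4.2, e5.1]

/-! ### The weighted energy inequality -/

theorem IsSolution.ae_isWeakGradient_sq {γ T : ℝ} {u₀ : R3 → R3}
    {F : ℝ → R3 → Tensor3} {b u : ℝ → R3 → R3} {D : ℝ → R3 → Tensor3} {p : ℝ → R3 → ℝ}
    (hs : IsSolution γ T u₀ F b u D p) (hγ : 0 < γ) (hγ' : γ ≤ 2) :
    ∀ᵐ t ∂((volume : Measure ℝ).restrict (Ioo 0 T)),
      IsWeakGradient (fun x => ‖u t x‖ ^ 2) fun x => sqGradVec (u t x) (D t x) := by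
  filter_upwards [hs.isWeakJacobian, hs.memMixed.ae_memLp (by simp) two_ne_zero (by simp),
    hs.memMixed_grad.ae_memLp two_ne_zero two_ne_zero (by simp)] with t hj hu hD
  exact hj.isWeakGradient_sq hγ hγ' hu hD

/-- The weighted energy inequality, with all the terms of the right-hand side in one integral. -/
theorem IsSolution.weightNorm_sq_le {γ T : ℝ} {u₀ : R3 → R3}
    {F : ℝ → R3 → Tensor3} {b u : ℝ → R3 → R3} {D : ℝ → R3 → Tensor3} {p : ℝ → R3 → ℝ}
    (hs : IsSolution γ T u₀ F b u D p) (hγ : 0 < γ) (hγ' : γ ≤ 2) (hT : 0 < T)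
    (hF : MemMixed T 2 2 γ F) (hb : MemMixed T 3 3 (3 * γ / 2) b)
    (hu₀ : MemLp u₀ 2 (weightMeasure γ)) {t : ℝ} (ht : t ∈ Ico 0 T) :
    weightNorm 2 γ (u t) ^ 2 ≤ weightNorm 2 γ u₀ ^ 2 + ∫ s in (0)..t, ∫ x,
      energyDensity (u s x) (b s x) (D s x) (F s x) (p s x) (weight γ x)
        (gradient (weight γ) x) := by
  have hst := hs.stripIntegrable hγ hγ' hF hb
  rcases ht.1.eq_or_lt with h0 | h0
  · have e : weightNorm 2 γ (u 0) = weightNorm 2 γ u₀ := by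
      rw [weightNorm, weightNorm,
        eLpNorm_congr_ae ((absolutelyContinuous_volume γ).ae_le hs.initial)]
    rw [← h0, intervalIntegral.integral_same, e, add_zero]
  have mw := aestronglyMeasurable_weight_snd γ T
  have mg := aestronglyMeasurable_gradient_weight γ T
  have bw := ae_abs_weight_le (T := T) hγ.le
  have bg := ae_norm_gradient_weight_le (T := T) hγ.le
  have hE : ∀ᵐ s ∂((volume : Measure ℝ).restrict (Ioo 0 T)),
      weightNorm 2 γ (u s) ^ 2 = ∫ x, ‖u s x‖ ^ 2 * weight γ x := by
    filter_upwards [hs.memMixed.ae_memLp (by simp) two_ne_zero (by simp)] with s hsm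
    exact weightNorm_two_sq_eq_integral_mul (hsm.1.mono_ac (volume_absolutelyContinuous γ))
  have iE : IntegrableOn (fun s => weightNorm 2 γ (u s) ^ 2) (Ioo 0 T) := by
    have h1 := (hst.terms mw mg bw bg).1
    unfold stripMeasure at h1
    exact h1.integral_prod_left.congr (hE.mono fun s hs => hs.symm)
  have ig := hst.integrable_energyDensity mw mg bw bg
  unfold stripMeasure at ig
  refine le_add_integral_of_distrib h0 ht.2 iE ig.integral_prod_left ?_
    (fun e he => hs.weaklyContinuous.eventually_lt ⟨h0, ht.2⟩ he)
    (tendsto_weightNorm_sq hT hs.weaklyContinuous.1 hu₀ hs.tendsto_initial)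
  intro α hα hαc hαs hα0
  have h1 := hst.energy_time hγ.le (hs.ae_isWeakGradient_sq hγ hγ') hs.energyBalance hα hαc hαs hα0
  refine le_trans (le_of_eq ?_) h1
  congr 1
  refine integral_congr_ae ?_
  filter_upwards [hE] with s hs
  rw [hs]

end AdvectionDiffusion

theorem theorem2 (γ : ℝ) (hγ₀ : 0 < γ) (hγ₂ : γ ≤ 2) :
    ∃ C : ℝ, 0 < C ∧
      ∀ (T : ℝ) (u₀ : R3 → R3) (F : ℝ → R3 → Tensor3) (b u : ℝ → R3 → R3)
        (D : ℝ → R3 → Tensor3) (p : ℝ → R3 → ℝ),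
        0 < T →
        MemLp u₀ 2 (weightMeasure γ) → IsWeakDivFree u₀ →
        MemMixed T 2 2 γ F →
        MemMixed T 3 3 (3 * γ / 2) b →
        (∀ᵐ t ∂(volume.restrict (Ioo 0 T)), IsWeakDivFree (b t)) →
        IsSolution γ T u₀ F b u D p →
        -- the weighted energy inequality; `V` is the space gradient of `|u|²`
        (∃ V : ℝ → R3 → R3,
          (∀ᵐ t ∂(volume.restrict (Ioo 0 T)),
            IsWeakGradient (fun x => ‖u t x‖ ^ 2) (V t)) ∧
          Integrable (fun z : ℝ × R3 => inner ℝ (V z.1 z.2) (gradient (weight γ) z.2))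
            (stripMeasure T) ∧
          Integrable (fun z : ℝ × R3 =>
            ‖u z.1 z.2‖ ^ 2 * inner ℝ (b z.1 z.2) (gradient (weight γ) z.2))
            (stripMeasure T) ∧
          Integrable (fun z : ℝ × R3 =>
            p z.1 z.2 * inner ℝ (u z.1 z.2) (gradient (weight γ) z.2))
            (stripMeasure T) ∧
          (∀ i j : Fin 3, Integrable (fun z : ℝ × R3 =>
            F z.1 z.2 (i, j) * D z.1 z.2 (i, j) * weight γ z.2
              + F z.1 z.2 (i, j) * u z.1 z.2 j * gradient (weight γ) z.2 i)
            (stripMeasure T)) ∧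
          ∀ t ∈ Ico 0 T,
            weightNorm 2 γ (u t) ^ 2 + 2 * ∫ s in 0..t, weightNorm 2 γ (D s) ^ 2
              ≤ weightNorm 2 γ u₀ ^ 2
                - (∫ s in 0..t, ∫ x, inner ℝ (V s x) (gradient (weight γ) x))
                + (∫ s in 0..t, ∫ x, ‖u s x‖ ^ 2 * inner ℝ (b s x) (gradient (weight γ) x))
                + 2 * (∫ s in 0..t, ∫ x, p s x * inner ℝ (u s x) (gradient (weight γ) x))
                - 2 * ∑ i, ∑ j, ∫ s in 0..t, ∫ x,
                    (F s x (i, j) * D s x (i, j) * weight γ x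
                      + F s x (i, j) * u s x j * gradient (weight γ) x i)) ∧
        -- the Gronwall-type bound
        ∀ t ∈ Ico 0 T,
          weightNorm 2 γ (u t) ^ 2 + ∫ s in 0..t, weightNorm 2 γ (D s) ^ 2
            ≤ weightNorm 2 γ u₀ ^ 2
              + C * (∫ s in 0..t, weightNorm 2 γ (F s) ^ 2)
              + C * ∫ s in 0..t,
                  (1 + weightNorm 3 (3 * γ / 2) (b s) ^ 2) * weightNorm 2 γ (u s) ^ 2 := by
  obtain ⟨Cs, hsl⟩ := exists_ae_sliceBounds
  have hK : (0 : ℝ) < 72 + 6 * Cs := by positivity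
  -- the constant of `young_slice` for the factor `72 + 6 C` of `integral_energyDensity_le`
  refine ⟨4 * (72 + 6 * (Cs : ℝ)) ^ 2 + 2 * (72 + 6 * Cs), by positivity, ?_⟩
  intro T u₀ F b u D p hT hu₀ _ hF hb _ hs
  have hst := hs.stripIntegrable hγ₀ hγ₂ hF hb
  obtain ⟨-, j₁, j₂, j₃, j₄, j₅⟩ := hst.terms (aestronglyMeasurable_weight_snd γ T)
    (aestronglyMeasurable_gradient_weight γ T) (ae_abs_weight_le hγ₀.le)
    (ae_norm_gradient_weight_le hγ₀.le)
  have mD : ∀ᵐ s ∂((volume : Measure ℝ).restrict (Ioo 0 T)), AEStronglyMeasurable (D s) volume := by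
    filter_upwards [hs.memMixed_grad.ae_memLp two_ne_zero two_ne_zero (by simp)] with s h
    exact h.1.mono_ac (volume_absolutelyContinuous γ)
  have hN : ∀ᵐ s ∂((volume : Measure ℝ).restrict (Ioo 0 T)),
      weightNorm 2 γ (D s) ^ 2 = ∫ x, ‖D s x‖ ^ 2 * weight γ x :=
    mD.mono fun s h => weightNorm_two_sq_eq_integral_mul h
  have j₅' : Integrable (fun z : ℝ × R3 => ∑ i, ∑ j,
      (F z.1 z.2 (i, j) * D z.1 z.2 (i, j) * weight γ z.2
        + F z.1 z.2 (i, j) * u z.1 z.2 j * gradient (weight γ) z.2 i)) (stripMeasure T) :=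
    integrable_finsetSum _ fun i _ => integrable_finsetSum _ fun j _ => j₅ i j
  refine ⟨⟨fun t x => sqGradVec (u t x) (D t x), hs.ae_isWeakGradient_sq hγ₀ hγ₂, j₁, j₃, j₄, j₅,
    fun t ht => ?_⟩, fun t ht => ?_⟩
  -- both inequalities come from `weightNorm_sq_le`: the first by splitting the energy density into
  -- its terms, the second by bounding it at almost every time
  all_goals
    have hmain := hs.weightNorm_sq_le hγ₀ hγ₂ hT hF hb hu₀ ht
    have hsub : Ioc 0 t ⊆ Ioo 0 T := fun s hs => ⟨hs.1, hs.2.trans_lt ht.2⟩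
    have hac := ae_mono (Measure.restrict_mono hsub (le_refl (volume : Measure ℝ)))
    unfold stripMeasure at j₁ j₂ j₃ j₄ j₅ j₅'
  · have k₁ := (show IntegrableOn _ (Ioo 0 T) volume from j₁.integral_prod_left).mono_set hsub
    have k₂ := (show IntegrableOn _ (Ioo 0 T) volume from j₂.integral_prod_left).mono_set hsub
    have k₃ := (show IntegrableOn _ (Ioo 0 T) volume from j₃.integral_prod_left).mono_set hsub
    have k₄ := (show IntegrableOn _ (Ioo 0 T) volume from j₄.integral_prod_left).mono_set hsub
    have k₅ := (show IntegrableOn _ (Ioo 0 T) volume from j₅'.integral_prod_left).mono_set hsub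
    have k₅' := fun i j =>
      (show IntegrableOn _ (Ioo 0 T) volume from (j₅ i j).integral_prod_left).mono_set hsub
    have e : ∫ s in Ioc 0 t, ∫ x, energyDensity (u s x) (b s x) (D s x) (F s x) (p s x)
          (weight γ x) (gradient (weight γ) x)
        = -(∫ s in Ioc 0 t, ∫ x, inner ℝ (sqGradVec (u s x) (D s x)) (gradient (weight γ) x))
          - 2 * (∫ s in Ioc 0 t, ∫ x, ‖D s x‖ ^ 2 * weight γ x)
          + (∫ s in Ioc 0 t, ∫ x, ‖u s x‖ ^ 2 * inner ℝ (b s x) (gradient (weight γ) x))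
          + 2 * (∫ s in Ioc 0 t, ∫ x, p s x * inner ℝ (u s x) (gradient (weight γ) x))
          - 2 * ∫ s in Ioc 0 t, ∫ x, ∑ i, ∑ j, (F s x (i, j) * D s x (i, j) * weight γ x
              + F s x (i, j) * u s x j * gradient (weight γ) x i) := by
      rw [← integral_energy_comb k₁ k₂ k₃ k₄ k₅]
      refine integral_congr_ae ?_
      filter_upwards [hac j₁.prod_right_ae, hac j₂.prod_right_ae, hac j₃.prod_right_ae,
        hac j₄.prod_right_ae, hac j₅'.prod_right_ae] with s s₁ s₂ s₃ s₄ s₅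
      exact integral_energy_comb s₁ s₂ s₃ s₄ s₅
    have e₅ : ∫ s in Ioc 0 t, ∫ x, ∑ i, ∑ j, (F s x (i, j) * D s x (i, j) * weight γ x
          + F s x (i, j) * u s x j * gradient (weight γ) x i)
        = ∑ i, ∑ j, ∫ s in Ioc 0 t, ∫ x, (F s x (i, j) * D s x (i, j) * weight γ x
          + F s x (i, j) * u s x j * gradient (weight γ) x i) := by
      have h1 : ∀ᵐ s ∂((volume : Measure ℝ).restrict (Ioc 0 t)), ∀ i j : Fin 3,
          Integrable (fun x => F s x (i, j) * D s x (i, j) * weight γ x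
            + F s x (i, j) * u s x j * gradient (weight γ) x i) :=
        ae_all_iff.2 fun i => ae_all_iff.2 fun j => hac (j₅ i j).prod_right_ae
      calc _ = ∫ s in Ioc 0 t, ∑ i, ∑ j, ∫ x, (F s x (i, j) * D s x (i, j) * weight γ x
              + F s x (i, j) * u s x j * gradient (weight γ) x i) := by
            refine integral_congr_ae (h1.mono fun s h => ?_)
            simp only
            rw [integral_finsetSum _ fun i _ => integrable_finsetSum _ fun j _ => h i j]
            exact Finset.sum_congr rfl fun i _ => integral_finsetSum _ fun j _ => h i j
        _ = _ := by
            rw [integral_finsetSum _ fun i _ => integrable_finsetSum _ fun j _ => k₅' i j]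
            exact Finset.sum_congr rfl fun i _ => integral_finsetSum _ fun j _ => k₅' i j
    have e₂ : ∫ s in Ioc 0 t, weightNorm 2 γ (D s) ^ 2
        = ∫ s in Ioc 0 t, ∫ x, ‖D s x‖ ^ 2 * weight γ x := integral_congr_ae (hac hN)
    simp only [intervalIntegral.integral_of_le ht.1] at hmain ⊢
    rw [e, e₅] at hmain
    rw [e₂]
    linarith
  · have hfin := lintegral_sq_terms_lt_top hF hb hs
    have ig := (hst.integrable_energyDensity (aestronglyMeasurable_weight_snd γ T)
      (aestronglyMeasurable_gradient_weight γ T) (ae_abs_weight_le hγ₀.le)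
      (ae_norm_gradient_weight_le hγ₀.le))
    unfold stripMeasure at ig
    have kg := (show IntegrableOn _ (Ioo 0 T) volume from ig.integral_prod_left).mono_set hsub
    have mu := aemeasurable_eLpNorm_slice hs.memMixed.1 two_ne_zero (by simp) γ
    have mD := aemeasurable_eLpNorm_slice hs.memMixed_grad.1 two_ne_zero (by simp) γ
    have mF := aemeasurable_eLpNorm_slice hF.1 two_ne_zero (by simp) γ
    have mb := aemeasurable_eLpNorm_slice hb.1 three_ne_zero (by simp) (3 * γ / 2)
    have kU : IntegrableOn (fun s => weightNorm 2 γ (u s) ^ 2) (Ioo 0 T) := by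
      simp only [weightNorm, ← ENNReal.toReal_pow]
      refine integrable_toReal_of_lintegral_ne_top (mu.pow_const 2)
        (ne_top_of_le_ne_top hfin.ne (lintegral_mono fun s => ?_))
      exact le_add_right (le_add_right le_self_add)
    have kN : IntegrableOn (fun s => weightNorm 2 γ (D s) ^ 2) (Ioo 0 T) := by
      simp only [weightNorm, ← ENNReal.toReal_pow]
      refine integrable_toReal_of_lintegral_ne_top (mD.pow_const 2)
        (ne_top_of_le_ne_top hfin.ne (lintegral_mono fun s => ?_))
      exact le_add_right (le_add_right le_add_self)
    have kG : IntegrableOn (fun s => weightNorm 2 γ (F s) ^ 2) (Ioo 0 T) := by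
      simp only [weightNorm, ← ENNReal.toReal_pow]
      refine integrable_toReal_of_lintegral_ne_top (mF.pow_const 2)
        (ne_top_of_le_ne_top hfin.ne (lintegral_mono fun s => ?_))
      exact le_add_right le_add_self
    have kB : IntegrableOn (fun s => (weightNorm 3 (3 * γ / 2) (b s) * weightNorm 2 γ (u s)) ^ 2)
        (Ioo 0 T) := by
      simp only [weightNorm, ← ENNReal.toReal_mul, ← ENNReal.toReal_pow]
      refine integrable_toReal_of_lintegral_ne_top ((mb.mul mu).pow_const 2)
        (ne_top_of_le_ne_top hfin.ne (lintegral_mono fun s => ?_))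
      exact le_add_self
    have kV : IntegrableOn (fun s => (1 + weightNorm 3 (3 * γ / 2) (b s) ^ 2)
        * weightNorm 2 γ (u s) ^ 2) (Ioo 0 T) :=
      (kU.add kB).congr (Eventually.of_forall fun s => by simp only [Pi.add_apply]; ring)
    replace kN := kN.mono_set hsub
    replace kG := kG.mono_set hsub
    replace kV := kV.mono_set hsub
    set K : ℝ := 72 + 6 * (Cs : ℝ) with hKdef
    have hle : ∫ s in Ioc 0 t, ∫ x, energyDensity (u s x) (b s x) (D s x) (F s x) (p s x)
          (weight γ x) (gradient (weight γ) x)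
        ≤ ∫ s in Ioc 0 t, (((4 * K ^ 2 + 2 * K) * weightNorm 2 γ (F s) ^ 2
          + (4 * K ^ 2 + 2 * K) * ((1 + weightNorm 3 (3 * γ / 2) (b s) ^ 2)
            * weightNorm 2 γ (u s) ^ 2)) - weightNorm 2 γ (D s) ^ 2) := by
      refine integral_mono_ae kg (((kG.const_mul _).add (kV.const_mul _)).sub kN) ?_
      filter_upwards [hac (hsl γ T u₀ F b u D p hγ₀ hγ₂ hF hb hs), hac j₁.prod_right_ae,
        hac j₂.prod_right_ae, hac j₃.prod_right_ae, hac j₄.prod_right_ae, hac j₅'.prod_right_ae]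
        with s h s₁ s₂ s₃ s₄ s₅
      refine (h.integral_energyDensity_le hγ₀.le hγ₂ s₁ s₂ s₃ s₄ s₅).trans ?_
      rw [(toReal_sliceBound h.memLp_v.2.ne h.memLp_D.2.ne h.memLp_b.2.ne h.memLp_F.2.ne).2,
        ← hKdef]
      have hY := young_slice (U := weightNorm 2 γ (u s)) (N := weightNorm 2 γ (D s))
        (B := weightNorm 3 (3 * γ / 2) (b s)) (G := weightNorm 2 γ (F s)) hK.le
      simp only [weightNorm] at hY ⊢
      linarith
    have hsum : IntegrableOn (fun s => (4 * K ^ 2 + 2 * K) * weightNorm 2 γ (F s) ^ 2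
          + (4 * K ^ 2 + 2 * K) * ((1 + weightNorm 3 (3 * γ / 2) (b s) ^ 2)
            * weightNorm 2 γ (u s) ^ 2)) (Ioc 0 t) := (kG.const_mul _).add (kV.const_mul _)
    rw [integral_sub hsum kN, integral_add (kG.const_mul _) (kV.const_mul _), integral_const_mul,
      integral_const_mul] at hle
    simp only [intervalIntegral.integral_of_le ht.1] at hmain ⊢
    linarith
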